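/- **Setting.** Fix $q\in(0,1)$ and a type $G\in\{B,C,D\}$ with $\epsilon=\tfrac12,1,0$ respectively. A nonnegative signature of length $N$ is an integer tuple $\lambda=(\lambda_1\ge\dots\ge\lambda_N\ge 0)$. Put $V^s(z_1,\dots,z_N)=\prod_{i<j}(z_i+z_i^{-1}-z_j-z_j^{-1})$, and let $\chi^G_\lambda(z_1,\dots,z_N)$ be the Laurent polynomial given by Weyl's formula $\chi^G_\lambda=\det_{1\le i,j\le N}[w^G_{\lambda_i+N-i}(z_j)]/V^s(z)$, where $$w^B_l(z)=\frac{z^{l+1/2}-z^{-l-1/2}}{z^{1/2}-z^{-1/2}},\qquad w^C_l(z)=\frac{z^{l+1}-z^{-l-1}}{z-z^{-1}},\qquad w^D_l(z)=z^l+z^{-l}.$$ Let $\mathbb Y$ be the set of integer sequences $\mathbf y=(0\le y_1\le y_2\le\cdots)$. A sequence $\{\lambda(N)\}_{N\ge1}$ of nonnegative signatures ($\lambda(N)$ of length $N$) stabilizes to $\mathbf y\in\mathbb Y$ if $\lim_{N\to\infty}\lambda(N)_{N+1-i}=y_i$ for all $i\ge1$. **One-variable functions.** Write $(a;q)_n=\prod_{i=1}^n(1-aq^{i-1})$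 for $0\le n\le\infty$ and $(a_1,\dots,a_r;q)_n=\prod_{s}(a_s;q)_n$. For $m\ge0$ and $x\in\mathbb C\setminus\big((-\infty,0]\cup\{1\}\cup\{q^{n+\epsilon}:n\in\mathbb Z\}\big)$ let $$\Phi^{\mathbf y,G}_m(x;q)=A^G_m(x)\left\{\int_{-\pi \mathbf i/\ln q}^{\pi \mathbf i/\ln q}\frac{dv}{2\pi \mathbf i}\int_{\mathcal L}\frac{du}{2\pi \mathbf i}\,x^u K^G_m(u,v)\prod_{i=1}^\infty\frac{(1-q^{a_i-v})(1-q^{a_i+v})}{(1-q^{a_i-u})(1-q^{a_i+u})}+\frac1{\ln q}\int_{-\pi \mathbf i/(2\ln q)}^{\pi \mathbf i/(2\ln q)}x^vS^G_m(v)\frac{dv}{2\pi \mathbf i}\right\},$$ where $\mathbf i=\sqrt{-1}$, $a_i=y_i+i-1+\epsilon$, powers of $x$ use the principal logarithm, the $v$-integrals are along straight segments, and $\mathcal L$ consists of the line $\Im u=\frac{\pi}{2\ln q}$ directed from $-\infty$ to $+\infty$ and the line $\Im u=-\frac{\pi}{2\ln q}$ directed from $+\infty$ to $-\infty$. Here $$A^B_m=(\ln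 q)^2\,\frac{q^{\frac12(m+\frac12)}-q^{-\frac12(m+\frac12)}}{x^{1/2}-x^{-1/2}}\cdot\frac{(q^{m+1},q^{-m};q)_m(q,q^{2m+2};q)_\infty}{(q^{1/2}x,q^{1/2}/x;q)_m(q^{m+3/2}x,q^{m+3/2}/x;q)_\infty},$$ $$A^C_m=(\ln q)^2\,\frac{q^{m+1}-q^{-(m+1)}}{x-x^{-1}}\cdot\frac{(q^{m+2},q^{-m};q)_m(q,q^{2m+3};q)_\infty}{(qx,q/x;q)_m(q^{m+2}x,q^{m+2}/x;q)_\infty},$$ $$A^D_m=\frac{(2-\mathbf 1_{\{m=0\}})(\ln q)^2}{2}\cdot\frac{(q^m,q^{-m};q)_m(q,q^{2m+1};q)_\infty}{(x,1/x;q)_m(q^{m+1}x,q^{m+1}/x;q)_\infty},$$ $$K^B_m=\frac{(q^{\frac u2-(m+1)v}-q^{-\frac u2+(m+1)v})(q^{\frac v2}-q^{-\frac v2})}{(q^{\frac{v-u}2}-q^{\frac{u-v}2})(q^{\frac u2}-q^{-\frac u2})},\quad K^C_m=\frac{q^{(m+1)v}-q^{-(m+1)v}}{q^{u-v}-1},\quad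 K^D_m=\frac{q^{\frac u2-(m+\frac12)v}+q^{-\frac u2+(m+\frac12)v}}{q^{\frac{v-u}2}-q^{\frac{u-v}2}},$$ $$S^B_m=-(q^{(m+\frac12)v}-q^{-(m+\frac12)v}),\qquad S^C_m=-(q^{(m+1)v}-q^{-(m+1)v}),\qquad S^D_m=q^{mv}+q^{-mv}.$$ The function $\Phi^{\mathbf y,G}_m(\,\cdot\,;q)$ has an analytic continuation to $\mathbb C^*$, denoted in the same way. **Multivariate functions.** For $k\ge1$ let $c^G_k(q)=\prod_{i=1}^k(q^{i-1+2\epsilon},q^{1-i},q,q^{2k-2i+2\epsilon+1};q)_{i-1}^{-1}$, and let $\Phi^{\mathbf y,G}(x_1,\dots,x_k;q)$ be the analytic function on $(\mathbb C^*)^k$ that, where $V^s(x_1,\dots,x_k)\ne0$, equals $$c^G_k(q)\,\frac{V^s(q^\epsilon,q^{1+\epsilon},\dots,q^{k-1+\epsilon})}{V^s(x_1,\dots,x_k)}\det_{1\le i,j\le k}\Big[\Phi^{\mathbf y,G}_{j-1}(x_i;q)\,(q^\epsilon x_i,q^\epsilon/x_i;q)_{j-1}\,(q^{j+\epsilon}x_i,q^{j+\epsilon}/x_i;q)_{k-j}\Big].$$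 **Theorem.** (i) For every $\mathbf y\in\mathbb Y$ and $k\ge1$ the function $\Phi^{\mathbf y,G}(x_1,\dots,x_k;q)$ above exists (that is, the analytic continuations to $\mathbb C^*$ and to $(\mathbb C^*)^k$ exist), and for every sequence $\{\lambda(N)\}_{N\ge1}$ of nonnegative signatures that stabilizes to $\mathbf y$, $$\lim_{N\to\infty}\frac{\chi^G_{\lambda(N)}(x_1,\dots,x_k,q^{k+\epsilon},\dots,q^{N-1+\epsilon})}{\chi^G_{\lambda(N)}(q^\epsilon,q^{1+\epsilon},\dots,q^{N-1+\epsilon})}=\Phi^{\mathbf y,G}(x_1,\dots,x_k;q)\qquad(*)$$ uniformly on compact subsets of $(\mathbb C^*)^k$. (ii) Conversely, if $\{\lambda(N)\}_{N\ge1}$ is a sequence of nonnegative signatures such that for every $k\ge1$ the limit on the left-hand side of $(*)$ exists uniformly on compact subsets of $(\mathbb C^*)^k$, then there is $\mathbf y\in\mathbb Y$ to which $\{\lambda(N)\}_{N\ge1}$ stabilizes, and $(*)$ holds for every $k\ge1$, uniformly on compact subsets of $(\mathbb C^*)^k$. -/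

import Mathlib

open Filter Topology Set

/-- The three series of classical root systems: `B` for `SO(2N+1)`, `C` for `Sp(N)`, `D` for
`SO(2N)`. -/
inductive ClassicalType where
  | B
  | C
  | D

noncomputable section

namespace QChar

/-- The parameter `ε`, equal to `1/2`, `1`, `0` for types `B`, `C`, `D`. -/
def eps : ClassicalType → ℝ
  | .B => 1 / 2
  | .C => 1
  | .D => 0

/-! ### Characters -/

/-- `(ℂ*)^n`. -/
def punctured (n : ℕ) : Set (Fin n → ℂ) := {z | ∀ i, z i ≠ 0}

/-- `V^s(z_1, …, z_n) = ∏_{i < j} (z_i + z_i⁻¹ - z_j - z_j⁻¹)`. -/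
def Vs {n : ℕ} (z : Fin n → ℂ) : ℂ :=
  ∏ i : Fin n, ∏ j ∈ Finset.Ioi i, (z i + (z i)⁻¹ - z j - (z j)⁻¹)

/-- Entries of the determinant in Weyl's character formula, with `l = λ_i + N - i`.
For type `B`, numerator and denominator of
`(z^(l + 1/2) - z^(-(l + 1/2))) / (z^(1/2) - z^(-1/2))` have been multiplied by `z^(1/2)`. -/
def weylEntry (G : ClassicalType) (l : ℕ) (z : ℂ) : ℂ :=
  match G with
  | .B => (z ^ ((l : ℤ) + 1) - z ^ (-(l : ℤ))) / (z - 1)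
  | .C => (z ^ ((l : ℤ) + 1) - z ^ (-((l : ℤ) + 1))) / (z - z⁻¹)
  | .D => z ^ (l : ℤ) + z ^ (-(l : ℤ))

/-- Weyl's quotient. Indices start from `0`, so the exponent `λ_i + N - i` becomes
`lam i + (N - 1 - i)`. -/
def weylQuotient (G : ClassicalType) {N : ℕ} (lam : Fin N → ℕ) (z : Fin N → ℂ) : ℂ :=
  (Matrix.of fun i j : Fin N => weylEntry G (lam i + (N - 1 - (i : ℕ))) (z j)).det / Vs z

/-- The points of `(ℂ*)^N` at which no denominator in Weyl's formula vanishes. -/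
def regularPoints (N : ℕ) : Set (Fin N → ℂ) :=
  {z | (∀ i, z i ≠ 0 ∧ z i ^ 2 ≠ 1) ∧ Vs z ≠ 0}

/-- The character `χ^G_λ` as a function on `(ℂ*)^N`: the Laurent polynomial given by Weyl's
formula, that is, the extension by continuity of Weyl's quotient across the (removable) zeros of
its denominators. -/
def chi (G : ClassicalType) {N : ℕ} (lam : Fin N → ℕ) : (Fin N → ℂ) → ℂ :=
  extendFrom (regularPoints N) (weylQuotient G lam)

/-- The point `(x_1, …, x_k, q^(k+ε), …, q^(N-1+ε))`, for `k ≤ N`. -/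
def specialPoint (G : ClassicalType) (q : ℝ) (N : ℕ) {k : ℕ} (x : Fin k → ℂ) : Fin N → ℂ :=
  fun i => if h : (i : ℕ) < k then x ⟨i, h⟩ else (q : ℂ) ^ (((i : ℕ) : ℂ) + (eps G : ℂ))

/-- The normalized character
`χ^G_λ(x_1, …, x_k, q^(k+ε), …, q^(N-1+ε)) / χ^G_λ(q^ε, …, q^(N-1+ε))`. -/
def normalizedChar (G : ClassicalType) (q : ℝ) {N : ℕ} (lam : Fin N → ℕ) {k : ℕ}
    (x : Fin k → ℂ) : ℂ :=
  chi G lam (specialPoint G q N x) /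
    chi G lam (fun i : Fin N => (q : ℂ) ^ (((i : ℕ) : ℂ) + (eps G : ℂ)))

/-- The sequence of signatures `λ(N)` stabilizes to `y`: for each `i`, the `i`-th row from the
bottom of `λ(N)` converges to `y_i` (indices start from `0`). -/
def Stabilizes (lam : (N : ℕ) → Fin N → ℕ) (y : ℕ → ℕ) : Prop :=
  ∀ i : ℕ, Tendsto (fun N : ℕ => if h : i < N then lam N ⟨N - 1 - i, by omega⟩ else 0)
    atTop (𝓝 (y i))

/-- Convergence, uniform on compact subsets of `(ℂ*)^k`, of the normalized characters. -/
def CharsConvergeTo (G : ClassicalType) (q : ℝ) (lam : (N : ℕ) → Fin N → ℕ) (k : ℕ)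
    (f : (Fin k → ℂ) → ℂ) : Prop :=
  ∀ K : Set (Fin k → ℂ), IsCompact K → K ⊆ punctured k →
    TendstoUniformlyOn (fun (N : ℕ) (x : Fin k → ℂ) => normalizedChar G q (lam N) x) f atTop K

/-! ### The limit functions -/

/-- `(a; q)_n`. -/
def poch (q : ℝ) (a : ℂ) (n : ℕ) : ℂ := ∏ i ∈ Finset.range n, (1 - a * (q : ℂ) ^ i)

/-- `(a; q)_∞`. -/
def pochInf (q : ℝ) (a : ℂ) : ℂ := ∏' i : ℕ, (1 - a * (q : ℂ) ^ i)

/-- `(2πi)⁻¹ ∫_{-iT}^{iT} f(v) dv` along the straight segment. -/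
def segmentIntegral (T : ℝ) (f : ℂ → ℂ) : ℂ :=
  (2 * Real.pi * Complex.I)⁻¹ * ∫ t in (-T)..T, f (t * Complex.I) * Complex.I

/-- `(2πi)⁻¹ ∫_L f(u) du`, where `L` consists of the line `Im u = π / (2 ln q)` directed from
left to right and the line `Im u = -π / (2 ln q)` directed from right to left. -/
def contourIntegral (q : ℝ) (f : ℂ → ℂ) : ℂ :=
  (2 * Real.pi * Complex.I)⁻¹ *
    ((∫ s : ℝ, f (s + (Real.pi / (2 * Real.log q) : ℝ) * Complex.I)) -
      ∫ s : ℝ, f (s - (Real.pi / (2 * Real.log q) : ℝ) * Complex.I))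

/-- `∏_{i ≥ 1} (1 - q^(a_i - v)) (1 - q^(a_i + v)) / ((1 - q^(a_i - u)) (1 - q^(a_i + u)))`, with
`a_i = y_i + i - 1 + ε`. -/
def yProduct (G : ClassicalType) (q : ℝ) (y : ℕ → ℕ) (u v : ℂ) : ℂ :=
  ∏' i : ℕ,
    ((1 - (q : ℂ) ^ ((y i : ℂ) + i + eps G - v)) * (1 - (q : ℂ) ^ ((y i : ℂ) + i + eps G + v))) /
    ((1 - (q : ℂ) ^ ((y i : ℂ) + i + eps G - u)) * (1 - (q : ℂ) ^ ((y i : ℂ) + i + eps G + u)))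

/-- The factor in front of the braces in the definition of the one-variable function. -/
def prefactor (G : ClassicalType) (q : ℝ) (m : ℕ) (x : ℂ) : ℂ :=
  match G with
  | .B =>
    (Real.log q : ℂ) ^ 2 *
      (((q : ℂ) ^ (((m : ℂ) + 1 / 2) / 2) - (q : ℂ) ^ (-(((m : ℂ) + 1 / 2) / 2))) /
        (x ^ (1 / 2 : ℂ) - x ^ (-(1 / 2) : ℂ))) *
      (poch q ((q : ℂ) ^ ((m : ℂ) + 1)) m * poch q ((q : ℂ) ^ (-(m : ℂ))) m *
        pochInf q q * pochInf q ((q : ℂ) ^ (2 * (m : ℂ) + 2))) /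
      (poch q ((q : ℂ) ^ (1 / 2 : ℂ) * x) m * poch q ((q : ℂ) ^ (1 / 2 : ℂ) / x) m *
        pochInf q ((q : ℂ) ^ ((m : ℂ) + 3 / 2) * x) * pochInf q ((q : ℂ) ^ ((m : ℂ) + 3 / 2) / x))
  | .C =>
    (Real.log q : ℂ) ^ 2 *
      (((q : ℂ) ^ ((m : ℂ) + 1) - (q : ℂ) ^ (-((m : ℂ) + 1))) / (x - x⁻¹)) *
      (poch q ((q : ℂ) ^ ((m : ℂ) + 2)) m * poch q ((q : ℂ) ^ (-(m : ℂ))) m *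
        pochInf q q * pochInf q ((q : ℂ) ^ (2 * (m : ℂ) + 3))) /
      (poch q ((q : ℂ) * x) m * poch q ((q : ℂ) / x) m *
        pochInf q ((q : ℂ) ^ ((m : ℂ) + 2) * x) * pochInf q ((q : ℂ) ^ ((m : ℂ) + 2) / x))
  | .D =>
    (2 - if m = 0 then 1 else 0) * (Real.log q : ℂ) ^ 2 / 2 *
      (poch q ((q : ℂ) ^ (m : ℂ)) m * poch q ((q : ℂ) ^ (-(m : ℂ))) m *
        pochInf q q * pochInf q ((q : ℂ) ^ (2 * (m : ℂ) + 1))) /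
      (poch q x m * poch q (1 / x) m *
        pochInf q ((q : ℂ) ^ ((m : ℂ) + 1) * x) * pochInf q ((q : ℂ) ^ ((m : ℂ) + 1) / x))

/-- The rational factor in `q^u`, `q^v` in the integrand of the double integral. -/
def kernel (G : ClassicalType) (q : ℝ) (m : ℕ) (u v : ℂ) : ℂ :=
  match G with
  | .B =>
    (((q : ℂ) ^ (u / 2 - (m + 1) * v) - (q : ℂ) ^ (-(u / 2) + (m + 1) * v)) *
        ((q : ℂ) ^ (v / 2) - (q : ℂ) ^ (-(v / 2)))) /
      (((q : ℂ) ^ ((v - u) / 2) - (q : ℂ) ^ ((u - v) / 2)) *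
        ((q : ℂ) ^ (u / 2) - (q : ℂ) ^ (-(u / 2))))
  | .C => ((q : ℂ) ^ ((m + 1) * v) - (q : ℂ) ^ (-((m + 1) * v))) / ((q : ℂ) ^ (u - v) - 1)
  | .D =>
    ((q : ℂ) ^ (u / 2 - (m + 1 / 2) * v) + (q : ℂ) ^ (-(u / 2) + (m + 1 / 2) * v)) /
      ((q : ℂ) ^ ((v - u) / 2) - (q : ℂ) ^ ((u - v) / 2))

/-- The factor next to `x^v` in the single integral, together with the sign of that integral. -/
def singleFactor (G : ClassicalType) (q : ℝ) (m : ℕ) (v : ℂ) : ℂ :=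
  match G with
  | .B => -((q : ℂ) ^ ((m + 1 / 2) * v) - (q : ℂ) ^ (-((m + 1 / 2) * v)))
  | .C => -((q : ℂ) ^ ((m + 1) * v) - (q : ℂ) ^ (-((m + 1) * v)))
  | .D => (q : ℂ) ^ (m * v) + (q : ℂ) ^ (-(m * v))

/-- The explicit formula for the one-variable function `Φ_m^{y,G}(x; q)`. Powers of `x` are taken
with the principal branch of the logarithm. -/
def phiFormula (G : ClassicalType) (q : ℝ) (y : ℕ → ℕ) (m : ℕ) (x : ℂ) : ℂ :=
  prefactor G q m x *
    (segmentIntegral (Real.pi / Real.log q) (fun v =>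
        contourIntegral q (fun u => x ^ u * kernel G q m u v * yProduct G q y u v)) +
      1 / (Real.log q : ℂ) *
        segmentIntegral (Real.pi / (2 * Real.log q)) (fun v => x ^ v * singleFactor G q m v))

/-- The domain `ℂ \ ((-∞, 0] ∪ {1} ∪ {q^(n+ε) : n ∈ ℤ})` of the formula. -/
def phiDomain (G : ClassicalType) (q : ℝ) : Set ℂ :=
  {x | x ∈ Complex.slitPlane ∧ x ≠ 1 ∧ ∀ n : ℤ, x ≠ (q : ℂ) ^ ((n : ℂ) + (eps G : ℂ))}

/-- `F` is the analytic continuation of `x ↦ Φ_m^{y,G}(x; q)` to `ℂ*`. -/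
def IsPhiOne (G : ClassicalType) (q : ℝ) (y : ℕ → ℕ) (m : ℕ) (F : ℂ → ℂ) : Prop :=
  AnalyticOnNhd ℂ F {x | x ≠ 0} ∧ EqOn F (phiFormula G q y m) (phiDomain G q)

/-- The constant `c_k^G(q)`; the index `i` below is one less than in
`∏_{i=1}^k (q^(i-1+2ε), q^(1-i), q, q^(2k-2i+2ε+1); q)_{i-1}`. -/
def cConst (G : ClassicalType) (q : ℝ) (k : ℕ) : ℂ :=
  1 / ∏ i ∈ Finset.range k,
    (poch q ((q : ℂ) ^ ((i : ℂ) + 2 * eps G)) i * poch q ((q : ℂ) ^ (-(i : ℂ))) i *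
      poch q q i * poch q ((q : ℂ) ^ (2 * (k : ℂ) - 2 * i - 1 + 2 * eps G)) i)

/-- The determinantal formula for `Φ^{y,G}(x_1, …, x_k; q)` in terms of the one-variable functions
`F m = Φ_m^{y,G}(·; q)`. Column `j` (counted from `0`) has the entries
`F_j(x_i) (q^ε x_i, q^ε / x_i; q)_j (q^(j+1+ε) x_i, q^(j+1+ε) / x_i; q)_{k-1-j}`. -/
def phiDet (G : ClassicalType) (q : ℝ) (F : ℕ → ℂ → ℂ) {k : ℕ} (x : Fin k → ℂ) : ℂ :=
  cConst G q k *
    (Vs (fun i : Fin k => (q : ℂ) ^ (((i : ℕ) : ℂ) + (eps G : ℂ))) / Vs x) *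
    (Matrix.of fun i j : Fin k =>
      F j (x i) *
        (poch q ((q : ℂ) ^ (eps G : ℂ) * x i) j * poch q ((q : ℂ) ^ (eps G : ℂ) / x i) j) *
        (poch q ((q : ℂ) ^ (((j : ℕ) : ℂ) + 1 + eps G) * x i) (k - 1 - j) *
          poch q ((q : ℂ) ^ (((j : ℕ) : ℂ) + 1 + eps G) / x i) (k - 1 - j))).det

/-- `Φ` is the function `Φ^{y,G}(x_1, …, x_k; q)` on `(ℂ*)^k`: it is analytic there, and away from
the zeros of `V^s` it is given by the determinantal formula in which the one-variable functions
are continued analytically to `ℂ*`. These properties determine `Φ` on `(ℂ*)^k`. -/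
def IsPhi (G : ClassicalType) (q : ℝ) (y : ℕ → ℕ) (k : ℕ) (Φ : (Fin k → ℂ) → ℂ) : Prop :=
  AnalyticOnNhd ℂ Φ (punctured k) ∧
    ∃ F : ℕ → ℂ → ℂ, (∀ m, IsPhiOne G q y m (F m)) ∧
      ∀ x ∈ punctured k, Vs x ≠ 0 → Φ x = phiDet G q F x

end QChar

end

/-! ### Weyl's formula in the variable z + 1/z. -/

noncomputable section

namespace QChar


/-! In the variable Z = z + 1/z the entries of Weyl's determinant are polynomials W_l, and a
signature enters only through its exponents l_i = λ_i + N - i. The points q^(n+ε) become nodes. Up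
to the Weyl denominator `dn`, W_b(node n) equals q^((b+ε)(n+ε)) ± q^(-(b+ε)(n+ε)), which is
symmetric in b and n (`eval_weylPoly_node`). Inverting the matrix W_{l_i}(node n) is therefore
Lagrange interpolation at the nodes of index l_i followed by expansion in the orthogonal family W_n,
so the inverse is explicit (`nodeMat_mul_nodeMatInv`). Multiplied by it, the N - k specialized
columns become unit vectors. The Vandermonde denominator is treated likewise by interpolating
monomials, and a k × k determinantal formula for the normalized character remains
(`normalizedChar_mul_det`). Its entries h_n (`hfun`) vanish at the nodes r ≠ n with r < N, hence h_n
= E_n · L_n with L_n the Lagrange basis function and E_n a polynomial (`normalizedChar_eq_altQuot`).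

Asymptotics. Stabilization means that the sets of exponents converge pointwise to an infinite set B.
The coefficients of the Lagrange functions in W_n decay in β faster than any prescribed geometric
rate once enough elements of B are present (`prod_inv_norm_num_node_le`), so h_n converges by
dominated convergence (`tendsto_hfun`). On circles avoiding the nodes E_n = h_n / L_n converges too,
and the maximum principle extends this to discs (`exists_entire_limit`). The determinant over the
Vandermonde product is written with divided differences given by Cauchy integrals (`altQuot`), which
stay analytic and continuous at coinciding points.

The explicit formula. For finitely many exponents, symmetrize the double integral under v ↦ -v and
expand the integrand in partial fractions in q^u + q^(-u). A Gaussian factor makes the individual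
terms integrable and is removed afterwards. The poles at the nodes reproduce the series for h_m; the
poles u = ±v lie inside the contour only for |Im v| < π/(2|ln q|), and the single integral cancels
them (`brace_finset`). A dominating function uniform in the exponent set gives the limit
(`brace_charSet`), and the prefactor divides by the Lagrange function of all nodes
(`lag_univ_mul_phiNum`).

The converse. For k = 1 the coefficient of W_β in h_0 is zero when β is not an exponent and bounded
away from zero when it is (`half_le_norm_coef_prod_num`), so convergence forces each β to be
eventually in or eventually out. If the limiting set A were finite, take m > |A|. Then h_m tends to
0 on the unit circle, because the coefficient functional of index m kills polynomials of degree |A|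
(`norm_coef_lag_le`). The limit at (q^ε, …, q^(m-1+ε), x) would vanish for x on the circle, hence
identically, although its value at x = q^(m+ε) is 1 (`not_charsConvergeTo_of_finite`). So A is
infinite, and its increasing enumeration yields y. -/

open Polynomial in
/-- The polynomial `W_l` with `W_l (z + z⁻¹) = weylEntry G l z`. -/
def weylPoly (G : ClassicalType) : ℕ → ℂ[X]
  | 0 => match G with
    | .B => 1
    | .C => 1
    | .D => 2
  | 1 => match G with
    | .B => X + 1
    | .C => X
    | .D => X
  | n + 2 => X * weylPoly G (n + 1) - weylPoly G n

lemma weylPoly_add_two (G : ClassicalType) (n : ℕ) :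
    weylPoly G (n + 2) = Polynomial.X * weylPoly G (n + 1) - weylPoly G n := by
  rw [weylPoly]

/-- The sign with which `z^{-a}` enters Weyl's formula. -/
def sgn : ClassicalType → ℂ
  | .B => -1
  | .C => -1
  | .D => 1

/-- `exp c + exp (-c)`. -/
def ch (c : ℂ) : ℂ := Complex.exp c + Complex.exp (-c)

/-- The denominator in Weyl's formula at `z = exp c`. -/
def den (G : ClassicalType) (c : ℂ) : ℂ :=
  match G with
  | .B => Complex.exp (c / 2) - Complex.exp (-(c / 2))
  | .C => Complex.exp c - Complex.exp (-c)
  | .D => 1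

lemma ch_neg (c : ℂ) : ch (-c) = ch c := by simp [ch, add_comm]

/-- Both sides satisfy a_{l+2} = (e^c + e^(-c)) a_{l+1} - a_l with the same initial values. No
division occurs, so this holds also at zeros of the Weyl denominator; the left side depends on l
only through c(l + ε), which is the source of the duality between exponents and nodes. -/
lemma exp_add_eq_den_mul (G : ClassicalType) (l : ℕ) (c : ℂ) :
    Complex.exp (c * (l + eps G)) + sgn G * Complex.exp (-(c * (l + eps G))) =
      den G c * (weylPoly G l).eval (ch c) := by
  induction l using Nat.twoStepInduction with
  | zero =>
    cases G
    · simp [eps, sgn, den, weylPoly]; ring_nf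
    · simp [eps, sgn, den, weylPoly]; ring_nf
    · simp [eps, sgn, den, weylPoly]; ring_nf
  | one =>
    cases G
    · have h1 : c * (((1 : ℕ) : ℂ) + (eps .B : ℝ)) = c + c / 2 := by simp [eps]; ring
      have h2 : Complex.exp c = Complex.exp (c / 2) * Complex.exp (c / 2) := by
        rw [← Complex.exp_add]; ring_nf
      rw [h1]
      simp only [sgn, den, weylPoly, ch, neg_add, Complex.exp_add, Complex.exp_neg, h2]
      have := Complex.exp_ne_zero (c / 2)
      simp
      field_simp
      ring
    · have h1 : c * (((1 : ℕ) : ℂ) + (eps .C : ℝ)) = c + c := by simp [eps]; ring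
      rw [h1]
      simp only [sgn, den, weylPoly, ch, neg_add, Complex.exp_add]
      simp
      ring
    · simp [eps, sgn, den, weylPoly, ch]
  | more n h1 h2 =>
    rw [weylPoly_add_two]
    simp only [Polynomial.eval_sub, Polynomial.eval_mul, Polynomial.eval_X]
    have e : ∀ k : ℕ, c * ((k : ℂ) + (eps G : ℝ)) = k * c + c * (eps G : ℝ) := fun k => by ring
    rw [mul_sub, mul_left_comm, ← h1, ← h2]
    simp only [e, ch, neg_add, Complex.exp_add, Complex.exp_neg]
    have := Complex.exp_ne_zero c
    push_cast
    have e1 : Complex.exp ((n + 2) * c) = Complex.exp (n * c) * Complex.exp c ^ 2 := by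
      rw [← Complex.exp_nat_mul, ← Complex.exp_add]; push_cast; ring_nf
    have e2 : Complex.exp ((n + 1) * c) = Complex.exp (n * c) * Complex.exp c := by
      rw [← Complex.exp_add]; ring_nf
    rw [e1, e2]
    have := Complex.exp_ne_zero (n * c)
    have := Complex.exp_ne_zero (c * eps G)
    field_simp
    ring

lemma weylEntry_add_two (G : ClassicalType) (n : ℕ) {z : ℂ} (hz : z ≠ 0) :
    weylEntry G (n + 2) z = (z + z⁻¹) * weylEntry G (n + 1) z - weylEntry G n z := by
  cases G
  · simp only [weylEntry]
    rw [← mul_div_assoc, ← sub_div]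
    congr 1
    push_cast
    simp only [neg_add, zpow_add₀ hz, zpow_neg, zpow_natCast, zpow_ofNat]
    field_simp
    ring
  · simp only [weylEntry]
    rw [← mul_div_assoc, ← sub_div]
    congr 1
    push_cast
    simp only [neg_add, zpow_add₀ hz, zpow_neg, zpow_natCast, zpow_ofNat]
    field_simp
    ring
  · simp only [weylEntry]
    push_cast
    simp only [neg_add, zpow_add₀ hz, zpow_neg, zpow_natCast, zpow_ofNat]
    field_simp
    ring

lemma weylEntry_eq_eval (G : ClassicalType) (l : ℕ) {z : ℂ} (hz : z ≠ 0) (hz' : z ^ 2 ≠ 1) :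
    weylEntry G l z = (weylPoly G l).eval (z + z⁻¹) := by
  have h1 : z - 1 ≠ 0 := fun h => hz' (by linear_combination (z + 1) * h)
  have h2 : z - z⁻¹ ≠ 0 := fun h => hz' (by
    have : z * (z - z⁻¹) = 0 := by rw [h, mul_zero]
    rw [mul_sub, mul_inv_cancel₀ hz] at this
    linear_combination this)
  induction l using Nat.twoStepInduction with
  | zero =>
    cases G
    · simp [weylEntry, weylPoly, h1]
    · simp [weylEntry, weylPoly, h2]
    · simp [weylEntry, weylPoly]; norm_num
  | one =>
    cases G
    · simp only [weylEntry, weylPoly]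
      rw [div_eq_iff h1]
      norm_num [zpow_ofNat]
      field_simp; ring
    · simp only [weylEntry, weylPoly]
      rw [div_eq_iff h2]
      norm_num [zpow_ofNat]
      field_simp; ring
    · simp [weylEntry, weylPoly]
  | more n h1 h2 =>
    rw [weylEntry_add_two G n hz, weylPoly_add_two, h1, h2]
    simp

lemma degree_weylPoly (G : ClassicalType) (n : ℕ) : (weylPoly G n).degree = n := by
  induction n using Nat.twoStepInduction with
  | zero => cases G <;> simp [weylPoly]; exact Polynomial.degree_C (by norm_num : (2 : ℂ) ≠ 0)
  | one => cases G <;> simp [weylPoly]; exact Polynomial.degree_X_add_C 1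
  | more n h1 h2 =>
    have : (Polynomial.X * weylPoly G (n + 1)).degree = ((n + 2 : ℕ) : WithBot ℕ) := by
      rw [Polynomial.degree_mul, h2, Polynomial.degree_X]; norm_cast; ring_nf
    rw [weylPoly_add_two, Polynomial.degree_sub_eq_left_of_degree_lt, this]
    rw [this, h1]; norm_cast; omega

/-- A crude geometric bound from the recurrence. It suffices because the coefficients it is paired
with decay faster than any given geometric rate. -/
lemma norm_eval_weylPoly_le (G : ClassicalType) (n : ℕ) (X : ℂ) :
    ‖(weylPoly G n).eval X‖ ≤ 2 * (‖X‖ + 1) ^ n := by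
  have h0 := norm_nonneg X
  induction n using Nat.twoStepInduction with
  | zero => cases G <;> simp [weylPoly]
  | one =>
    cases G
    · simp only [weylPoly, Polynomial.eval_add, Polynomial.eval_X, Polynomial.eval_one]
      refine (norm_add_le _ _).trans ?_
      simp; linarith
    · simp [weylPoly]; linarith
    · simp [weylPoly]; linarith
  | more n h1 h2 =>
    rw [weylPoly_add_two]
    simp only [Polynomial.eval_sub, Polynomial.eval_mul, Polynomial.eval_X]
    refine (norm_sub_le _ _).trans ?_
    rw [norm_mul]
    have h3 : (0 : ℝ) ≤ (‖X‖ + 1) ^ n := by positivity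
    calc ‖X‖ * ‖(weylPoly G (n + 1)).eval X‖ + ‖(weylPoly G n).eval X‖
        ≤ ‖X‖ * (2 * (‖X‖ + 1) ^ (n + 1)) + 2 * (‖X‖ + 1) ^ n := by gcongr
      _ ≤ 2 * (‖X‖ + 1) ^ (n + 2) := by
        rw [pow_succ, pow_add]; nlinarith [mul_nonneg h3 h0]

/-! ### The special points as nodes. -/

/-- `q^(n + ε)`. -/
def qe (G : ClassicalType) (q : ℝ) (n : ℕ) : ℝ := q ^ ((n : ℝ) + eps G)

/-- `q^(n + ε) + q^(-(n + ε))`. -/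
def node (G : ClassicalType) (q : ℝ) (n : ℕ) : ℂ := ch (Real.log q * (n + eps G))

/-- The denominator in Weyl's formula at `q^(n + ε)`. -/
def dn (G : ClassicalType) (q : ℝ) (n : ℕ) : ℂ := den G (Real.log q * (n + eps G))

/-- `(1 - q^(r + ε) z) (1 - q^(r + ε) / z)` as a function of `Z = z + z⁻¹`. -/
def num (G : ClassicalType) (q : ℝ) (r : ℕ) (Z : ℂ) : ℂ := 1 - qe G q r * Z + (qe G q r : ℂ) ^ 2

lemma eps_nonneg (G : ClassicalType) : 0 ≤ eps G := by cases G <;> norm_num [eps]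

section

variable {G : ClassicalType} {q : ℝ} [hq : Fact (0 < q ∧ q < 1)]

lemma q_pos (q : ℝ) [hq : Fact (0 < q ∧ q < 1)] : 0 < q := hq.out.1

lemma q_lt_one (q : ℝ) [hq : Fact (0 < q ∧ q < 1)] : q < 1 := hq.out.2

lemma log_q_neg (q : ℝ) [hq : Fact (0 < q ∧ q < 1)] : Real.log q < 0 :=
  Real.log_neg (q_pos q) (q_lt_one q)

lemma qe_pos (n : ℕ) : 0 < qe G q n := Real.rpow_pos_of_pos (q_pos q) _

lemma qe_eq (n : ℕ) : qe G q n = q ^ n * q ^ eps G := by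
  rw [qe, Real.rpow_add (q_pos q), Real.rpow_natCast]

lemma qe_le (n : ℕ) : qe G q n ≤ q ^ n := by
  rw [qe_eq]
  exact mul_le_of_le_one_right (pow_nonneg (q_pos q).le n) (Real.rpow_le_one (q_pos q).le (q_lt_one q).le (eps_nonneg G))

lemma qe_le_one (n : ℕ) : qe G q n ≤ 1 :=
  (qe_le n).trans (pow_le_one₀ (q_pos q).le (q_lt_one q).le)

lemma qe_lt_qe {m n : ℕ} (h : m < n) : qe G q n < qe G q m :=
  Real.rpow_lt_rpow_of_exponent_gt (q_pos q) (q_lt_one q) (by simpa using h)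

lemma exp_log_mul (n : ℕ) : Complex.exp (Real.log q * (n + eps G)) = qe G q n := by
  rw [qe, Real.rpow_def_of_pos (q_pos q)]; push_cast; rfl

lemma node_eq (n : ℕ) : node G q n = qe G q n + (qe G q n : ℂ)⁻¹ := by
  rw [node, ch, Complex.exp_neg, exp_log_mul]

lemma node_eq_ofReal (n : ℕ) : node G q n = ((qe G q n + (qe G q n)⁻¹ : ℝ) : ℂ) := by
  rw [node_eq]; push_cast; rfl

lemma num_eq (r : ℕ) (Z : ℂ) : num G q r Z = -qe G q r * (Z - node G q r) := by
  have : (qe G q r : ℂ) ≠ 0 := by exact_mod_cast (qe_pos r).ne'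
  rw [num, node_eq]; field_simp; ring

omit hq in
lemma num_ch (r : ℕ) (c : ℂ) :
    num G q r (ch c) = (1 - qe G q r * Complex.exp c) * (1 - qe G q r * Complex.exp (-c)) := by
  have h : Complex.exp c * Complex.exp (-c) = 1 := by rw [← Complex.exp_add]; simp
  rw [num, ch]; linear_combination (-(qe G q r : ℂ) ^ 2) * h

lemma num_node (r n : ℕ) : num G q r (node G q n) =
    ((1 - qe G q r * qe G q n) * (1 - qe G q r / qe G q n) : ℝ) := by
  rw [node, num_ch, Complex.exp_neg, exp_log_mul]; push_cast; rw [div_eq_mul_inv]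

lemma qe_mul_qe_lt_one {r n : ℕ} (h : r ≠ n) : qe G q r * qe G q n < 1 := by
  rcases lt_or_gt_of_ne h with h | h
  · exact mul_lt_one_of_nonneg_of_lt_one_right (qe_le_one r) (qe_pos n).le
      ((qe_lt_qe h).trans_le (qe_le_one r))
  · exact mul_lt_one_of_nonneg_of_lt_one_left (qe_pos r).le
      ((qe_lt_qe h).trans_le (qe_le_one n)) (qe_le_one n)

lemma num_node_ne_zero {r n : ℕ} (h : r ≠ n) : num G q r (node G q n) ≠ 0 := by
  rw [num_node]
  have h1 := qe_mul_qe_lt_one (G := G) (q := q) h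
  have h2 : qe G q r / qe G q n ≠ 1 := by
    rw [Ne, div_eq_one_iff_eq (qe_pos n).ne']
    rcases lt_or_gt_of_ne h with h | h
    · exact (qe_lt_qe h).ne'
    · exact (qe_lt_qe h).ne
  have : (1 - qe G q r * qe G q n) * (1 - qe G q r / qe G q n) ≠ 0 :=
    mul_ne_zero (by linarith) (sub_ne_zero.2 h2.symm)
  exact_mod_cast this

lemma node_injective : Function.Injective (node G q) := by
  intro a b h
  by_contra hab
  apply num_node_ne_zero (G := G) (q := q) hab
  rw [num_eq, h]; simp

lemma num_eq_zero_iff (r : ℕ) (Z : ℂ) : num G q r Z = 0 ↔ Z = node G q r := by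
  have : (qe G q r : ℂ) ≠ 0 := by exact_mod_cast (qe_pos r).ne'
  rw [num_eq]; simp [this, sub_eq_zero]

omit hq in
-- Duality: both sides equal e^w + sgn · e^(-w) with w = ln q · (b + ε)(n + ε), which is symmetric
-- in b and n.
lemma eval_weylPoly_node (b n : ℕ) :
    dn G q n * (weylPoly G b).eval (node G q n) = dn G q b * (weylPoly G n).eval (node G q b) := by
  rw [dn, dn, node, node, ← exp_add_eq_den_mul, ← exp_add_eq_den_mul]
  ring_nf

/-- The constant is the worst case: type B with n = 0, where the exponential has argument (ln
q)(1/2)/2. -/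
lemma le_norm_dn (n : ℕ) : 1 - Real.exp (Real.log q / 4) ≤ ‖dn G q n‖ := by
  have hL := log_q_neg q
  have key : ∀ c : ℝ, c ≤ Real.log q / 4 →
      1 - Real.exp (Real.log q / 4) ≤ ‖Complex.exp c - Complex.exp (-c)‖ := by
    intro c hc
    have h1 : Complex.exp c - Complex.exp (-c) = ((Real.exp c - Real.exp (-c) : ℝ) : ℂ) := by
      push_cast; rfl
    rw [h1, Complex.norm_real, Real.norm_eq_abs, abs_sub_comm]
    refine le_trans ?_ (le_abs_self _)
    have h2 : Real.exp c ≤ Real.exp (Real.log q / 4) := Real.exp_le_exp.2 hc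
    have h3 : 1 ≤ Real.exp (-c) := Real.one_le_exp (by linarith)
    linarith
  have hn : (0 : ℝ) ≤ n := n.cast_nonneg
  cases G
  · have := key (Real.log q * (n + 1 / 2) / 2) (by nlinarith)
    simpa [dn, den, eps] using this
  · have := key (Real.log q * (n + 1)) (by nlinarith)
    simpa [dn, den, eps] using this
  · simp [dn, den]; positivity

lemma one_sub_exp_pos (q : ℝ) [hq : Fact (0 < q ∧ q < 1)] : 0 < 1 - Real.exp (Real.log q / 4) := by
  have hL := log_q_neg q
  have : Real.exp (Real.log q / 4) < 1 := Real.exp_lt_one_iff.2 (by linarith)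
  linarith

lemma dn_ne_zero (n : ℕ) : dn G q n ≠ 0 := by
  rw [← norm_pos_iff]
  exact (one_sub_exp_pos q).trans_le (le_norm_dn n)

end


/-! ### Expansion coefficients -/

/-- Minus the square of the Weyl denominator, up to a sign, as a function of `z + z⁻¹`. -/
def rho : ClassicalType → ℂ → ℂ
  | .B, Z => Z - 2
  | .C, Z => Z ^ 2 - 4
  | .D, _ => -1

/-- Half the squared norm of `weylPoly G m` for the weight `-rho G`. -/
def wnorm : ClassicalType → ℕ → ℂ
  | .D, 0 => 2
  | _, _ => 1

/-- The coefficient of `weylPoly G m` in the expansion of a function of `Z = z + z⁻¹`. -/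
def coef (G : ClassicalType) (q : ℝ) (m : ℕ) (f : ℂ → ℂ) : ℂ :=
  -(Real.log q / (2 * wnorm G m)) * segmentIntegral (Real.pi / Real.log q) (fun v =>
    (weylPoly G m).eval (ch (Real.log q * v)) * rho G (ch (Real.log q * v)) *
      f (ch (Real.log q * v)))

lemma wnorm_ne_zero (G : ClassicalType) (m : ℕ) : wnorm G m ≠ 0 := by
  cases G <;> cases m <;> simp [wnorm]

lemma sgn_mul_self (G : ClassicalType) : sgn G * sgn G = 1 := by cases G <;> simp [sgn]

lemma rho_ch (G : ClassicalType) (c : ℂ) : rho G (ch c) = -sgn G * den G c ^ 2 := by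
  have h : Complex.exp c * Complex.exp (-c) = 1 := by rw [← Complex.exp_add]; simp
  cases G
  · have h1 : Complex.exp (c / 2) * Complex.exp (-(c / 2)) = 1 := by rw [← Complex.exp_add]; simp
    have h2 : Complex.exp c = Complex.exp (c / 2) ^ 2 := by
      rw [← Complex.exp_nat_mul]; push_cast; ring_nf
    have h3 : Complex.exp (-c) = Complex.exp (-(c / 2)) ^ 2 := by
      rw [← Complex.exp_nat_mul]; push_cast; ring_nf
    simp only [rho, sgn, den, ch, h2, h3]
    linear_combination 2 * h1
  · simp only [rho, sgn, den, ch]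
    linear_combination 4 * h
  · simp [rho, sgn, den]

/-- `2 ε` as a natural number. -/
def twoEps : ClassicalType → ℕ
  | .B => 1
  | .C => 2
  | .D => 0

lemma twoEps_eq (G : ClassicalType) : (twoEps G : ℂ) = 2 * (eps G : ℂ) := by
  cases G <;> simp [twoEps, eps]

/-- The weight `rho` is the square of the Weyl denominator up to sign, so it turns both polynomials
into two-term exponential sums. Their product has four terms of integer frequency because 2ε is an
integer. -/
lemma weylPoly_mul_weylPoly_mul_rho (G : ClassicalType) (m n : ℕ) (c : ℂ) :
    (weylPoly G m).eval (ch c) * rho G (ch c) * (weylPoly G n).eval (ch c) =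
      -sgn G * (Complex.exp (((m + n + twoEps G : ℕ) : ℤ) * c) +
        Complex.exp ((-((m + n + twoEps G : ℕ) : ℤ) : ℤ) * c)) -
      (Complex.exp (((m : ℤ) - n : ℤ) * c) + Complex.exp (((n : ℤ) - m : ℤ) * c)) := by
  have h : (weylPoly G m).eval (ch c) * rho G (ch c) * (weylPoly G n).eval (ch c) =
      -sgn G * (den G c * (weylPoly G m).eval (ch c)) * (den G c * (weylPoly G n).eval (ch c)) := by
    rw [rho_ch]; ring
  rw [h, ← exp_add_eq_den_mul, ← exp_add_eq_den_mul]
  push_cast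
  have e1 : ((m : ℂ) + n + twoEps G) * c = c * (m + eps G) + c * (n + eps G) := by
    rw [twoEps_eq]; ring
  have e2 : (-((m : ℂ) + n + twoEps G)) * c = -(c * (m + eps G)) + -(c * (n + eps G)) := by
    rw [twoEps_eq]; ring
  have e3 : ((m : ℂ) - n) * c = c * (m + eps G) + -(c * (n + eps G)) := by ring
  have e4 : ((n : ℂ) - m) * c = -(c * (m + eps G)) + (c * (n + eps G)) := by ring
  rw [e1, e2, e3, e4]
  simp only [Complex.exp_add]
  have hs := sgn_mul_self G
  linear_combination (-(Complex.exp (c * (m + eps G)) * Complex.exp (-(c * (n + eps G)))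
    + Complex.exp (-(c * (m + eps G))) * Complex.exp (c * (n + eps G)))
    - sgn G * Complex.exp (-(c * (m + eps G))) * Complex.exp (-(c * (n + eps G)))) * hs

lemma continuous_ch : Continuous ch := by unfold ch; fun_prop

lemma continuous_rho (G : ClassicalType) : Continuous (rho G) := by
  cases G <;> (unfold rho; fun_prop)

lemma ch_mul_I (L t : ℝ) : ch (L * (t * Complex.I)) = ((2 * Real.cos (L * t) : ℝ) : ℂ) := by
  rw [ch]; push_cast; rw [Complex.cos]; ring_nf

lemma norm_ch_mul_I_le (L t : ℝ) : ‖ch (L * (t * Complex.I))‖ ≤ 2 := by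
  rw [ch_mul_I, Complex.norm_real, Real.norm_eq_abs, abs_mul, abs_two]
  linarith [Real.abs_cos_le_one (L * t)]

lemma norm_rho_le (G : ClassicalType) {Z : ℂ} (hZ : ‖Z‖ ≤ 2) : ‖rho G Z‖ ≤ 8 := by
  cases G
  · refine (norm_sub_le _ _).trans ?_; norm_num; linarith
  · refine (norm_sub_le _ _).trans ?_
    rw [norm_pow]; norm_num
    nlinarith [norm_nonneg Z]
  · simp [rho]

lemma segmentIntegral_congr {T : ℝ} {f g : ℂ → ℂ} (h : ∀ t : ℝ, f (t * Complex.I) = g (t * Complex.I)) :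
    segmentIntegral T f = segmentIntegral T g := by
  simp only [segmentIntegral, h]

lemma segmentIntegral_const_mul (T : ℝ) (c : ℂ) (f : ℂ → ℂ) :
    segmentIntegral T (fun v => c * f v) = c * segmentIntegral T f := by
  simp only [segmentIntegral, mul_assoc, intervalIntegral.integral_const_mul]
  ring

lemma segmentIntegral_sum {ι : Type*} (T : ℝ) (s : Finset ι) {f : ι → ℂ → ℂ}
    (hf : ∀ i ∈ s, Continuous (fun t : ℝ => f i (t * Complex.I))) :
    segmentIntegral T (fun v => ∑ i ∈ s, f i v) = ∑ i ∈ s, segmentIntegral T (f i) := by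
  simp only [segmentIntegral, Finset.sum_mul]
  rw [intervalIntegral.integral_finsetSum, Finset.mul_sum]
  intro i hi
  exact ((hf i hi).mul continuous_const).intervalIntegrable _ _

lemma norm_segmentIntegral_le {T M : ℝ} {f : ℂ → ℂ} (hf : ∀ t : ℝ, ‖f (t * Complex.I)‖ ≤ M) :
    ‖segmentIntegral T f‖ ≤ |T| / Real.pi * M := by
  rw [segmentIntegral, norm_mul]
  have h1 := intervalIntegral.norm_integral_le_of_norm_le_const (a := -T) (b := T)
    (f := fun t : ℝ => f (t * Complex.I) * Complex.I) (C := M) (fun t _ => by simpa using hf t)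
  have h2 : ‖(2 * Real.pi * Complex.I : ℂ)⁻¹‖ = (2 * Real.pi)⁻¹ := by
    simp [abs_of_pos Real.pi_pos]
  rw [h2]
  have hpi := Real.pi_pos
  calc _ ≤ (2 * Real.pi)⁻¹ * (M * |T - -T|) := by gcongr
    _ = |T| / Real.pi * M := by
      rw [show T - -T = 2 * T by ring, abs_mul, abs_two]; field_simp

section

variable {G : ClassicalType} {q : ℝ} [hq : Fact (0 < q ∧ q < 1)]

/-- The segment is exactly one period of q^v. It is traversed downwards since ln q < 0, which makes
the mean of 1 equal to 1 / ln q, a negative number. -/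
lemma segmentIntegral_exp (k : ℤ) :
    segmentIntegral (Real.pi / Real.log q) (fun v => Complex.exp (k * (Real.log q * v))) =
      if k = 0 then (Real.log q : ℂ)⁻¹ else 0 := by
  have hL : (Real.log q : ℂ) ≠ 0 := by exact_mod_cast (log_q_neg q).ne
  have hpi : (Real.pi : ℂ) ≠ 0 := by exact_mod_cast Real.pi_ne_zero
  rw [segmentIntegral]
  split_ifs with hk
  · subst hk
    simp only [Int.cast_zero, zero_mul, Complex.exp_zero, one_mul, intervalIntegral.integral_const]
    rw [Complex.real_smul]
    push_cast
    field_simp [Complex.I_ne_zero]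
    ring
  · have hk' : (k : ℂ) ≠ 0 := by exact_mod_cast hk
    have hc : (k : ℂ) * Real.log q * Complex.I ≠ 0 :=
      mul_ne_zero (mul_ne_zero hk' hL) Complex.I_ne_zero
    have h1 : ∀ t : ℝ, Complex.exp (k * (Real.log q * (t * Complex.I))) * Complex.I =
        Complex.I * Complex.exp (k * Real.log q * Complex.I * t) := fun t => by ring_nf
    simp only [h1]
    rw [intervalIntegral.integral_const_mul, integral_exp_mul_complex hc]
    push_cast
    have e1 : (k : ℂ) * Real.log q * Complex.I * (Real.pi / Real.log q) =
        k * Real.log q * Complex.I * -(Real.pi / Real.log q) + k * (2 * Real.pi * Complex.I) := by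
      field_simp; ring
    rw [e1, Complex.exp_periodic.int_mul k]
    simp

/-- Orthogonality: only zero frequencies survive integration. The frequencies ±(m - n) vanish when m
= n; ±(m + n + 2ε) vanish only in type D with m = n = 0, which explains the exceptional value of
`wnorm`. -/
lemma coef_weylPoly (m n : ℕ) :
    coef G q m (fun Z => (weylPoly G n).eval Z) = if m = n then 1 else 0 := by
  have hL : (Real.log q : ℂ) ≠ 0 := by exact_mod_cast (log_q_neg q).ne
  have hw := wnorm_ne_zero G m
  have h1 : segmentIntegral (Real.pi / Real.log q) (fun v =>
      (weylPoly G m).eval (ch (Real.log q * v)) * rho G (ch (Real.log q * v)) *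
        (weylPoly G n).eval (ch (Real.log q * v))) =
      ∑ i : Fin 4, segmentIntegral (Real.pi / Real.log q) (fun v =>
        ![-sgn G, -sgn G, -1, -1] i * Complex.exp ((![((m + n + twoEps G : ℕ) : ℤ),
          -((m + n + twoEps G : ℕ) : ℤ), (m : ℤ) - n, (n : ℤ) - m] i : ℤ) *
            (Real.log q * v))) := by
    rw [← segmentIntegral_sum]
    · apply segmentIntegral_congr
      intro t
      rw [weylPoly_mul_weylPoly_mul_rho, Fin.sum_univ_four]
      simp only [Matrix.cons_val]
      ring
    · intro i _; fun_prop
  rw [coef, h1]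
  simp only [segmentIntegral_const_mul, segmentIntegral_exp, Fin.sum_univ_four, Matrix.cons_val]
  have c1 : ((m : ℤ) - n = 0) ↔ m = n := by omega
  have c2 : ((n : ℤ) - m = 0) ↔ m = n := by omega
  have c3 : (-((m + n + twoEps G : ℕ) : ℤ) = 0) ↔ m + n + twoEps G = 0 := by omega
  have c4 : (((m + n + twoEps G : ℕ) : ℤ) = 0) ↔ m + n + twoEps G = 0 := by omega
  simp only [c1, c2, c3, c4]
  by_cases hmn : m = n
  · subst hmn
    cases G
    · simp [twoEps, wnorm]; field_simp; norm_num
    · simp [twoEps, wnorm]; field_simp; norm_num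
    · by_cases hm : m = 0
      · subst hm; simp [twoEps, wnorm, sgn]; field_simp; norm_num
      · obtain ⟨m, rfl⟩ := Nat.exists_eq_succ_of_ne_zero hm
        simp [twoEps, wnorm]; field_simp; norm_num
  · have : m + n + twoEps G ≠ 0 := by omega
    simp only [hmn, this, if_false]
    simp

omit hq in
lemma continuous_coef_integrand (m : ℕ) {f : ℂ → ℂ} (hf : Continuous f) :
    Continuous (fun t : ℝ => (weylPoly G m).eval (ch (Real.log q * (t * Complex.I))) *
      rho G (ch (Real.log q * (t * Complex.I))) * f (ch (Real.log q * (t * Complex.I)))) := by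
  have h1 : Continuous (fun t : ℝ => ch (Real.log q * (t * Complex.I))) :=
    continuous_ch.comp (by fun_prop)
  exact (((weylPoly G m).continuous.comp h1).mul ((continuous_rho G).comp h1)).mul (hf.comp h1)

omit hq in
lemma coef_sum {ι : Type*} (m : ℕ) (s : Finset ι) (c : ι → ℂ) {f : ι → ℂ → ℂ}
    (hf : ∀ i ∈ s, Continuous (f i)) :
    coef G q m (fun Z => ∑ i ∈ s, c i * f i Z) = ∑ i ∈ s, c i * coef G q m (f i) := by
  have h1 : ∀ i ∈ s, c i * coef G q m (f i) = -(Real.log q / (2 * wnorm G m)) *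
      segmentIntegral (Real.pi / Real.log q) (fun v => c i *
        ((weylPoly G m).eval (ch (Real.log q * v)) * rho G (ch (Real.log q * v)) *
          f i (ch (Real.log q * v)))) := fun i _ => by
    rw [segmentIntegral_const_mul, coef]; ring
  rw [Finset.sum_congr rfl h1, ← Finset.mul_sum, ← segmentIntegral_sum, coef]
  · congr 1
    apply segmentIntegral_congr
    intro t
    rw [Finset.mul_sum]
    exact Finset.sum_congr rfl fun i _ => by ring
  · intro i hi
    exact continuous_const.mul (continuous_coef_integrand m (hf i hi))

/-- On the unit circle ‖z + 1/z‖ ≤ 2; there the polynomial is at most 2 · 3^m and `rho` at most 8.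
-/
lemma norm_coef_le (m : ℕ) {f : ℂ → ℂ} {M : ℝ} (hf : ∀ Z, ‖Z‖ ≤ 2 → ‖f Z‖ ≤ M) :
    ‖coef G q m f‖ ≤ 8 * 3 ^ m * M := by
  have hL := log_q_neg q
  have h1 := norm_segmentIntegral_le (T := Real.pi / Real.log q) (M := 2 * 3 ^ m * 8 * M)
    (f := fun v => (weylPoly G m).eval (ch (Real.log q * v)) * rho G (ch (Real.log q * v)) *
      f (ch (Real.log q * v))) (fun t => by
      have h2 := norm_ch_mul_I_le (Real.log q) t
      rw [norm_mul, norm_mul]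
      have h3 := norm_eval_weylPoly_le G m (ch (Real.log q * (t * Complex.I)))
      have h4 : 2 * (‖ch (Real.log q * (t * Complex.I))‖ + 1) ^ m ≤ 2 * 3 ^ m := by
        gcongr; linarith
      have h5 := norm_rho_le G h2
      have h6 := hf _ h2
      gcongr
      exact h3.trans h4)
  rw [coef, norm_mul]
  have h7 : ‖-((Real.log q : ℂ) / (2 * wnorm G m))‖ ≤ |Real.log q| / 2 := by
    rw [norm_neg, norm_div, Complex.norm_real, Real.norm_eq_abs, norm_mul]
    gcongr
    have : 1 ≤ ‖wnorm G m‖ := by cases G <;> cases m <;> simp [wnorm]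
    norm_num; linarith
  calc _ ≤ |Real.log q| / 2 * (|Real.pi / Real.log q| / Real.pi * (2 * 3 ^ m * 8 * M)) := by gcongr
    _ = 8 * 3 ^ m * M := by
      rw [abs_div, abs_of_pos Real.pi_pos]
      have : |Real.log q| ≠ 0 := abs_ne_zero.2 hL.ne
      have := Real.pi_ne_zero
      field_simp

omit hq in
lemma tendsto_coef {α : Type*} {l : Filter α} [l.IsCountablyGenerated] (m : ℕ) {F : α → ℂ → ℂ}
    {f : ℂ → ℂ} {M : ℝ} (hF : ∀ᶠ a in l, Continuous (F a))
    (hM : ∀ᶠ a in l, ∀ Z, ‖Z‖ ≤ 2 → ‖F a Z‖ ≤ M)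
    (hlim : ∀ Z, ‖Z‖ ≤ 2 → Tendsto (fun a => F a Z) l (𝓝 (f Z))) :
    Tendsto (fun a => coef G q m (F a)) l (𝓝 (coef G q m f)) := by
  refine Tendsto.const_mul _ (Tendsto.const_mul _ ?_)
  refine intervalIntegral.tendsto_integral_filter_of_dominated_convergence
    (fun _ => 2 * 3 ^ m * 8 * M) ?_ ?_ intervalIntegrable_const ?_
  · filter_upwards [hF] with a ha
    exact ((continuous_coef_integrand m ha).mul continuous_const).aestronglyMeasurable
  · filter_upwards [hM] with a ha
    refine Eventually.of_forall fun t _ => ?_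
    have h2 := norm_ch_mul_I_le (Real.log q) t
    rw [norm_mul, norm_mul, norm_mul, Complex.norm_I, mul_one]
    have h3 := norm_eval_weylPoly_le G m (ch (Real.log q * (t * Complex.I)))
    have h4 : 2 * (‖ch (Real.log q * (t * Complex.I))‖ + 1) ^ m ≤ 2 * 3 ^ m := by
      gcongr; linarith
    have h5 := norm_rho_le G h2
    have h6 := ha _ h2
    gcongr
    exact h3.trans h4
  · refine Eventually.of_forall fun t _ => ?_
    exact (Tendsto.const_mul _ (hlim _ (norm_ch_mul_I_le _ t))).mul_const _

omit hq in
-- Since W_n has exact degree n, the top coefficient can be removed and the degree induction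
-- continues.
lemma exists_eq_sum_weylPoly (G : ClassicalType) (N : ℕ) : ∀ P : Polynomial ℂ, P.degree < N →
    ∃ c : ℕ → ℂ, P = ∑ i ∈ Finset.range N, Polynomial.C (c i) * weylPoly G i := by
  induction N with
  | zero => intro P hP; exact ⟨0, by simpa [Polynomial.degree_lt_iff_coeff_zero, Polynomial.ext_iff] using hP⟩
  | succ N ih =>
    intro P hP
    set W := weylPoly G N
    have hW : W.natDegree = N := Polynomial.natDegree_eq_of_degree_eq_some (degree_weylPoly G N)
    have hW0 : W.coeff N ≠ 0 := by
      rw [← hW]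
      exact Polynomial.leadingCoeff_ne_zero.2 fun h => by
        have := degree_weylPoly G N; simp [W] at h; simp [h] at this
    obtain ⟨c, hc⟩ := ih (P - Polynomial.C (P.coeff N / W.coeff N) * W) (by
      rw [Polynomial.degree_lt_iff_coeff_zero] at hP ⊢
      intro m hm
      rw [Polynomial.coeff_sub, Polynomial.coeff_C_mul]
      rcases hm.eq_or_lt with rfl | hm
      · field_simp; simp
      · rw [hP m hm, Polynomial.coeff_eq_zero_of_natDegree_lt (p := W) (n := m) (by rw [hW]; exact hm)]; simp)
    refine ⟨Function.update c N (P.coeff N / W.coeff N), ?_⟩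
    rw [Finset.sum_range_succ, Function.update_self, ← sub_eq_iff_eq_add, hc]
    refine Finset.sum_congr rfl fun i hi => ?_
    rw [Function.update_of_ne (Finset.mem_range.1 hi).ne]

lemma eval_eq_sum_coef {N : ℕ} {P : Polynomial ℂ} (hP : P.degree < N) (Z : ℂ) :
    P.eval Z = ∑ m ∈ Finset.range N, coef G q m (fun Z => P.eval Z) * (weylPoly G m).eval Z := by
  obtain ⟨c, hc⟩ := exists_eq_sum_weylPoly G N P hP
  have h1 : ∀ Z, P.eval Z = ∑ i ∈ Finset.range N, c i * (weylPoly G i).eval Z := fun Z => by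
    conv_lhs => rw [hc]
    simp [Polynomial.eval_finsetSum]
  rw [h1]
  refine Finset.sum_congr rfl fun m hm => ?_
  simp only [h1]
  rw [coef_sum _ _ _ fun i _ => (weylPoly G i).continuous]
  simp only [coef_weylPoly]
  rw [Finset.sum_eq_single m]
  · simp
  · intro b _ hb; simp [hb.symm]
  · intro h; exact absurd hm h

lemma coef_eq_zero_of_degree_lt {m : ℕ} {P : Polynomial ℂ} (hP : P.degree < m) :
    coef G q m (fun Z => P.eval Z) = 0 := by
  obtain ⟨c, hc⟩ := exists_eq_sum_weylPoly G m P hP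
  have h1 : ∀ Z, P.eval Z = ∑ i ∈ Finset.range m, c i * (weylPoly G i).eval Z := fun Z => by
    conv_lhs => rw [hc]
    simp [Polynomial.eval_finsetSum]
  simp only [h1]
  rw [coef_sum _ _ _ fun i _ => (weylPoly G i).continuous]
  refine Finset.sum_eq_zero fun i hi => ?_
  rw [coef_weylPoly, if_neg (Finset.mem_range.1 hi).ne', mul_zero]

end


/-! ### Lagrange basis functions with infinitely many nodes -/

open Classical in
/-- The function `∏ (Z - node r) / (node β - node r)` over `r ∈ B`, `r ≠ β`. -/
def lag (G : ClassicalType) (q : ℝ) (B : Set ℕ) (β : ℕ) (Z : ℂ) : ℂ :=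
  ∏' r : ℕ, if r ∈ B ∧ r ≠ β then num G q r Z / num G q r (node G q β) else 1

section

variable {G : ClassicalType} {q : ℝ} [hq : Fact (0 < q ∧ q < 1)]

omit hq in
lemma lag_finset (s : Finset ℕ) (β : ℕ) (Z : ℂ) :
    lag G q s β Z = ∏ r ∈ s.erase β, num G q r Z / num G q r (node G q β) := by
  rw [lag, tprod_eq_prod (s := s.erase β)]
  · refine Finset.prod_congr rfl fun r hr => ?_
    rw [if_pos]
    exact ⟨Finset.mem_of_mem_erase hr, Finset.ne_of_mem_erase hr⟩
  · intro r hr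
    rw [if_neg]
    rintro ⟨h1, h2⟩
    exact hr (Finset.mem_erase.2 ⟨h2, h1⟩)

lemma lag_eq_eval (s : Finset ℕ) (β : ℕ) (Z : ℂ) :
    lag G q s β Z = (Lagrange.basis s (node G q) β).eval Z := by
  rw [lag_finset, Lagrange.basis, Polynomial.eval_prod]
  refine Finset.prod_congr rfl fun r hr => ?_
  have h := (node_injective (G := G) (q := q)).ne (Finset.ne_of_mem_erase hr).symm
  have h1 : (qe G q r : ℂ) ≠ 0 := by exact_mod_cast (qe_pos r).ne'
  have h2 : node G q β - node G q r ≠ 0 := sub_ne_zero.2 h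
  rw [Lagrange.basisDivisor, num_eq, num_eq]
  simp
  field_simp

omit hq in
lemma continuous_num (r : ℕ) : Continuous (num G q r) := by unfold num; fun_prop

omit hq in
lemma continuous_lag_finset (s : Finset ℕ) (β : ℕ) : Continuous (lag G q s β) := by
  have : lag G q s β = fun Z => ∏ r ∈ s.erase β, num G q r Z / num G q r (node G q β) :=
    funext fun Z => lag_finset s β Z
  rw [this]
  exact continuous_finsetProd _ fun r _ => (continuous_num r).div_const _

lemma lag_node_self (s : Finset ℕ) (β : ℕ) : lag G q s β (node G q β) = 1 := by
  rw [lag_finset]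
  exact Finset.prod_eq_one fun r hr =>
    div_self (num_node_ne_zero (Finset.ne_of_mem_erase hr))

omit hq in
lemma lag_node_ne {s : Finset ℕ} {β r : ℕ} (hr : r ∈ s) (h : r ≠ β) [Fact (0 < q ∧ q < 1)] :
    lag G q s β (node G q r) = 0 := by
  rw [lag_finset]
  refine Finset.prod_eq_zero (Finset.mem_erase.2 ⟨h, hr⟩) ?_
  rw [(num_eq_zero_iff r _).2 rfl, zero_div]

/-- In exponential form, products over arbitrary sets of indices are bounded by geometric sums. -/
lemma norm_num_le (r : ℕ) (Z : ℂ) : ‖num G q r Z‖ ≤ Real.exp ((‖Z‖ + 1) * q ^ r) := by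
  have h0 := q_pos q
  have h1 := qe_pos (G := G) (q := q) r
  have h2 := qe_le (G := G) (q := q) r
  have h3 := qe_le_one (G := G) (q := q) r
  have h4 := norm_nonneg Z
  calc ‖num G q r Z‖ ≤ 1 + qe G q r * ‖Z‖ + qe G q r ^ 2 := by
        rw [num]
        refine (norm_add_le _ _).trans (add_le_add ((norm_sub_le _ _).trans ?_) ?_)
        · simp [abs_of_pos h1]
        · simp
    _ ≤ 1 + q ^ r * ‖Z‖ + q ^ r := by
        have : qe G q r ^ 2 ≤ q ^ r := by nlinarith
        gcongr
    _ = (‖Z‖ + 1) * q ^ r + 1 := by ring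
    _ ≤ _ := Real.add_one_le_exp _

lemma sum_pow_le {ι : Type*} (t : Finset ι) (f : ι → ℕ) (hf : Set.InjOn f t) :
    ∑ r ∈ t, q ^ f r ≤ (1 - q)⁻¹ := by
  classical
  rw [← tsum_geometric_of_lt_one (q_pos q).le (q_lt_one q),
    ← Finset.sum_image (g := f) (f := fun n => q ^ n) hf]
  exact (summable_geometric_of_lt_one (q_pos q).le (q_lt_one q)).sum_le_tsum _
    fun i _ => pow_nonneg (q_pos q).le i

lemma prod_norm_num_le (t : Finset ℕ) (Z : ℂ) :
    ∏ r ∈ t, ‖num G q r Z‖ ≤ Real.exp ((‖Z‖ + 1) * (1 - q)⁻¹) := by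
  calc ∏ r ∈ t, ‖num G q r Z‖ ≤ ∏ r ∈ t, Real.exp ((‖Z‖ + 1) * q ^ r) :=
        Finset.prod_le_prod (fun _ _ => norm_nonneg _) fun r _ => norm_num_le r Z
    _ = Real.exp ((‖Z‖ + 1) * ∑ r ∈ t, q ^ r) := by rw [← Real.exp_sum, Finset.mul_sum]
    _ ≤ _ := by
      have := sum_pow_le (q := q) t id (Set.injOn_id _)
      simp only [id] at this
      gcongr

lemma inv_one_sub_pow_le {j : ℕ} (hj : j ≠ 0) {t : ℝ} (ht : t ≤ q ^ j) :
    (1 - t)⁻¹ ≤ Real.exp (q ^ j * (1 - q)⁻¹) := by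
  have h0 := q_pos q
  have h1 := q_lt_one q
  have h2 : q ^ j ≤ q := by simpa using pow_le_pow_of_le_one h0.le h1.le (Nat.one_le_iff_ne_zero.2 hj)
  have h3 : 0 < 1 - q := by linarith
  calc (1 - t)⁻¹ = t * (1 - t)⁻¹ + 1 := by
        have : 1 - t ≠ 0 := by linarith
        field_simp; ring
    _ ≤ q ^ j * (1 - q)⁻¹ + 1 := by
        have : (1 - t)⁻¹ ≤ (1 - q)⁻¹ := inv_anti₀ h3 (by linarith)
        have : 0 ≤ (1 - t)⁻¹ := inv_nonneg.2 (by linarith)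
        gcongr
    _ ≤ _ := Real.add_one_le_exp _

/-- The value is (1 - q^(r+β+2ε))(1 - q^(r-β)). For r < β the second factor is of size q^(-(β-r)),
whose inverse is a genuine gain; everything else is within e^(O(q^|r-β|)) of 1. The exponent (r - β)
+ (β - r), in truncated subtraction, is |r - β|. -/
lemma inv_norm_num_node_le {r β : ℕ} (h : r ≠ β) :
    ‖num G q r (node G q β)‖⁻¹ ≤
      Real.exp (2 * (1 - q)⁻¹ * q ^ ((r - β) + (β - r))) * (if r < β then q ^ (β - r) else 1) := by
  have h0 := q_pos q
  have hr := qe_pos (G := G) (q := q) r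
  have hb := qe_pos (G := G) (q := q) β
  set j := (r - β) + (β - r) with hj
  have hj0 : j ≠ 0 := by omega
  have hmul : qe G q r * qe G q β ≤ q ^ j := by
    calc qe G q r * qe G q β ≤ q ^ r * q ^ β :=
          mul_le_mul (qe_le r) (qe_le β) hb.le (by positivity)
      _ = q ^ (r + β) := (pow_add _ _ _).symm
      _ ≤ q ^ j := pow_le_pow_of_le_one h0.le (q_lt_one q).le (by omega)
  have h1 := inv_one_sub_pow_le (q := q) hj0 hmul
  have hlt := qe_mul_qe_lt_one (G := G) (q := q) h
  have hexp : Real.exp (2 * (1 - q)⁻¹ * q ^ j) =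
      Real.exp (q ^ j * (1 - q)⁻¹) * Real.exp (q ^ j * (1 - q)⁻¹) := by
    rw [← Real.exp_add]; ring_nf
  have h2 : |1 - qe G q r / qe G q β|⁻¹ ≤
      Real.exp (q ^ j * (1 - q)⁻¹) * (if r < β then q ^ (β - r) else 1) := by
    have hε : q ^ eps G ≠ 0 := (Real.rpow_pos_of_pos h0 _).ne'
    split_ifs with hrb
    · have e1 : qe G q β / qe G q r = q ^ (β - r) := by
        rw [qe_eq, qe_eq, mul_div_mul_right _ _ hε, pow_sub₀ _ h0.ne' hrb.le, div_eq_mul_inv]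
      have e2 : 1 - qe G q r / qe G q β = -((1 - q ^ (β - r)) * (q ^ (β - r))⁻¹) := by
        rw [← e1]; field_simp; ring
      have hp : 0 < q ^ (β - r) := by positivity
      have hp1 : q ^ (β - r) < 1 := pow_lt_one₀ h0.le (q_lt_one q) (by omega)
      rw [e2, abs_neg, abs_mul, mul_inv, abs_inv, inv_inv, abs_of_pos hp, abs_of_pos (by linarith)]
      have := inv_one_sub_pow_le (q := q) hj0 (t := q ^ (β - r)) (by rw [hj]; simp [hrb.le])
      gcongr
    · have e1 : qe G q r / qe G q β = q ^ (r - β) := by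
        rw [qe_eq, qe_eq, mul_div_mul_right _ _ hε, pow_sub₀ _ h0.ne' (not_lt.1 hrb), div_eq_mul_inv]
      have hp : 0 < q ^ (r - β) := by positivity
      have hp1 : q ^ (r - β) < 1 := pow_lt_one₀ h0.le (q_lt_one q) (by omega)
      rw [e1, abs_of_pos (by linarith), mul_one]
      exact inv_one_sub_pow_le hj0 (by rw [hj]; simp [not_lt.1 hrb])
  rw [num_node, Complex.norm_real, Real.norm_eq_abs, abs_mul, mul_inv, hexp, mul_assoc,
    abs_of_pos (by linarith)]
  exact mul_le_mul h1 h2 (by positivity) (by positivity)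

/-- The exponential errors sum to two geometric series, one on each side of β. The gains are all at
most 1, so only those with r in S need be kept, and q^β / q^r ≥ 1 whenever r ≥ β. Each element of S
thus contributes a factor q^β: a large fixed S beats any geometric growth in β. -/
lemma prod_inv_norm_num_node_le {s S : Finset ℕ} (hS : S ⊆ s) (β : ℕ) :
    ∏ r ∈ s.erase β, ‖num G q r (node G q β)‖⁻¹ ≤
      Real.exp (4 * (1 - q)⁻¹ ^ 2) * ∏ r ∈ S, (q ^ β / q ^ r) := by
  have h0 := q_pos q
  have h1 := q_lt_one q
  have hq1 : 0 < (1 - q)⁻¹ := inv_pos.2 (by linarith)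
  set g : ℕ → ℝ := fun r => if r < β then q ^ (β - r) else 1 with hg
  have hg0 : ∀ r, 0 ≤ g r := fun r => by simp only [hg]; split_ifs <;> positivity
  have hg1 : ∀ r, g r ≤ 1 := fun r => by
    simp only [hg]; split_ifs
    · exact pow_le_one₀ h0.le h1.le
    · exact le_rfl
  have hg2 : ∀ r, g r ≤ q ^ β / q ^ r := fun r => by
    simp only [hg]; split_ifs with h
    · rw [pow_sub₀ _ h0.ne' h.le, div_eq_mul_inv]
    · rw [one_le_div (by positivity)]
      exact pow_le_pow_of_le_one h0.le h1.le (by omega)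
  have hsum : ∑ r ∈ s.erase β, q ^ ((r - β) + (β - r)) ≤ 2 * (1 - q)⁻¹ := by
    rw [← Finset.sum_filter_add_sum_filter_not _ (fun r => r < β)]
    have a1 := sum_pow_le (q := q) ((s.erase β).filter (fun r => r < β))
      (fun r => (r - β) + (β - r)) (by
        intro a ha b hb hab
        simp at ha hb hab
        omega)
    have a2 := sum_pow_le (q := q) ((s.erase β).filter (fun r => ¬ r < β))
      (fun r => (r - β) + (β - r)) (by
        intro a ha b hb hab
        simp at ha hb hab
        omega)
    linarith
  calc ∏ r ∈ s.erase β, ‖num G q r (node G q β)‖⁻¹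
      ≤ ∏ r ∈ s.erase β, (Real.exp (2 * (1 - q)⁻¹ * q ^ ((r - β) + (β - r))) * g r) :=
        Finset.prod_le_prod (fun _ _ => by positivity) fun r hr =>
          inv_norm_num_node_le (Finset.ne_of_mem_erase hr)
    _ = Real.exp (2 * (1 - q)⁻¹ * ∑ r ∈ s.erase β, q ^ ((r - β) + (β - r))) *
        ∏ r ∈ s.erase β, g r := by
        rw [Finset.prod_mul_distrib, ← Real.exp_sum, Finset.mul_sum]
    _ ≤ Real.exp (4 * (1 - q)⁻¹ ^ 2) * ∏ r ∈ S, (q ^ β / q ^ r) := by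
        have a1 : 2 * (1 - q)⁻¹ * ∑ r ∈ s.erase β, q ^ ((r - β) + (β - r)) ≤
            4 * (1 - q)⁻¹ ^ 2 := by nlinarith
        have a2 : ∏ r ∈ s.erase β, g r ≤ ∏ r ∈ S, (q ^ β / q ^ r) := by
          have b1 : ∏ r ∈ s.erase β, g r ≤ ∏ r ∈ S.erase β, g r := by
            rw [← Finset.prod_sdiff (Finset.erase_subset_erase β hS)]
            exact mul_le_of_le_one_left (Finset.prod_nonneg fun r _ => hg0 r)
              (Finset.prod_le_one (fun r _ => hg0 r) fun r _ => hg1 r)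
          -- Erasing β is harmless because g equals 1 there.
          have b2 : ∏ r ∈ S.erase β, g r = ∏ r ∈ S, g r := by
            by_cases hb : β ∈ S
            · rw [← Finset.mul_prod_erase S g hb]; simp [hg]
            · rw [Finset.erase_eq_of_notMem hb]
          exact b1.trans (b2.le.trans (Finset.prod_le_prod (fun r _ => hg0 r) fun r _ => hg2 r))
        have a3 : 0 ≤ ∏ r ∈ s.erase β, g r := Finset.prod_nonneg fun r _ => hg0 r
        gcongr

lemma norm_lag_le {s S : Finset ℕ} (hS : S ⊆ s) (β : ℕ) (Z : ℂ) :
    ‖lag G q s β Z‖ ≤ Real.exp ((‖Z‖ + 1) * (1 - q)⁻¹) *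
      (Real.exp (4 * (1 - q)⁻¹ ^ 2) * ∏ r ∈ S, (q ^ β / q ^ r)) := by
  have h1 := prod_norm_num_le (G := G) (q := q) (s.erase β) Z
  have h2 := prod_inv_norm_num_node_le (G := G) (q := q) hS β
  rw [lag_finset, norm_prod]
  simp only [norm_div, div_eq_mul_inv (‖num G q _ _‖), Finset.prod_mul_distrib]
  exact mul_le_mul h1 h2 (Finset.prod_nonneg fun _ _ => by positivity) (Real.exp_pos _).le

/-- `num` at distinct nodes is bounded away from zero. -/
lemma exists_le_norm_num_node (β : ℕ) :
    ∃ c > 0, ∀ r, r ≠ β → c ≤ ‖num G q r (node G q β)‖ := by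
  refine ⟨(Real.exp (2 * (1 - q)⁻¹))⁻¹, by positivity, fun r hr => ?_⟩
  have h0 := q_pos q
  have h1 := q_lt_one q
  have hq1 : 0 < (1 - q)⁻¹ := inv_pos.2 (by linarith)
  have h := inv_norm_num_node_le (G := G) (q := q) hr
  have h2 : (if r < β then q ^ (β - r) else 1) ≤ 1 := by
    split_ifs
    · exact pow_le_one₀ h0.le h1.le
    · exact le_rfl
  have h3 : Real.exp (2 * (1 - q)⁻¹ * q ^ ((r - β) + (β - r))) ≤ Real.exp (2 * (1 - q)⁻¹) := by
    rw [Real.exp_le_exp]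
    exact mul_le_of_le_one_right (by positivity) (pow_le_one₀ h0.le h1.le)
  have h4 : ‖num G q r (node G q β)‖⁻¹ ≤ Real.exp (2 * (1 - q)⁻¹) * 1 :=
    h.trans (mul_le_mul h3 h2 (by split_ifs <;> positivity) (by positivity))
  rw [mul_one] at h4
  exact inv_le_of_inv_le₀ (norm_pos_iff.2 (num_node_ne_zero hr)) h4

lemma num_div_sub_one {r β : ℕ} (h : r ≠ β) (Z : ℂ) :
    num G q r Z / num G q r (node G q β) - 1 =
      -qe G q r * (Z - node G q β) / num G q r (node G q β) := by
  rw [div_sub_one (num_node_ne_zero h)]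
  congr 1
  rw [num, num]; ring

open Classical in
-- Each factor is 1 + O(q^r), locally uniformly in Z, because `num` is affine of slope -q^(r+ε) and
-- is bounded below at distinct nodes. Dominated convergence for products then lets the set and the
-- point vary together.
lemma tendsto_lag {α : Type*} {l : Filter α} {B : α → Set ℕ} {B' : Set ℕ}
    (hB : ∀ r, ∀ᶠ a in l, (r ∈ B a ↔ r ∈ B')) (β : ℕ) {Z : α → ℂ} {Z' : ℂ}
    (hZ : Tendsto Z l (𝓝 Z')) :
    Tendsto (fun a => lag G q (B a) β (Z a)) l (𝓝 (lag G q B' β Z')) := by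
  have key : ∀ (B : Set ℕ) (Z : ℂ), lag G q B β Z = ∏' r : ℕ,
      (1 + if r ∈ B ∧ r ≠ β then num G q r Z / num G q r (node G q β) - 1 else 0) := by
    intro B Z
    rw [lag]
    congr 1
    ext r
    split_ifs <;> ring
  simp only [key]
  obtain ⟨c, hc0, hc⟩ := exists_le_norm_num_node (G := G) (q := q) β
  have h0 := q_pos q
  refine tendsto_tprod_one_add_of_dominated_convergence
    (bound := fun r => q ^ r * ((‖Z'‖ + 1 + ‖node G q β‖) / c))
    ((summable_geometric_of_lt_one (q_pos q).le (q_lt_one q)).mul_right _) ?_ ?_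
  · intro r
    by_cases h : r ∈ B' ∧ r ≠ β
    · have : Tendsto (fun a => num G q r (Z a) / num G q r (node G q β) - 1) l
          (𝓝 (num G q r Z' / num G q r (node G q β) - 1)) :=
        (((continuous_num r).tendsto Z').comp hZ).div_const _ |>.sub_const _
      rw [if_pos h]
      refine this.congr' ?_
      filter_upwards [hB r] with a ha
      rw [if_pos]; rwa [ha]
    · rw [if_neg h]
      refine tendsto_const_nhds.congr' ?_
      filter_upwards [hB r] with a ha
      rw [if_neg]; rwa [ha]
  · have hZ2 : ∀ᶠ a in l, ‖Z a‖ < ‖Z'‖ + 1 := hZ.norm.eventually_lt_const (by linarith)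
    filter_upwards [hZ2] with a ha r
    split_ifs with h
    · rw [num_div_sub_one h.2, norm_div, norm_mul, norm_neg, Complex.norm_real, Real.norm_eq_abs,
        abs_of_pos (qe_pos r), mul_div_assoc]
      have h1 := hc r h.2
      have h2 := qe_le (G := G) (q := q) r
      have h3 : ‖Z a - node G q β‖ ≤ ‖Z'‖ + 1 + ‖node G q β‖ :=
        (norm_sub_le _ _).trans (by linarith)
      gcongr
    · rw [norm_zero]; positivity

open Classical in
lemma lag_ne_zero {B : Set ℕ} {β : ℕ} {Z : ℂ} (hZ : ∀ r ∈ B, r ≠ β → Z ≠ node G q r) :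
    lag G q B β Z ≠ 0 := by
  obtain ⟨c, hc0, hc⟩ := exists_le_norm_num_node (G := G) (q := q) β
  have h0 := q_pos q
  have key : lag G q B β Z = ∏' r : ℕ,
      (1 + if r ∈ B ∧ r ≠ β then num G q r Z / num G q r (node G q β) - 1 else 0) := by
    rw [lag]
    congr 1
    ext r
    split_ifs <;> ring
  rw [key]
  refine tprod_one_add_ne_zero_of_summable (fun r => ?_) ?_
  · split_ifs with h
    · rw [add_sub_cancel]
      refine div_ne_zero ?_ (num_node_ne_zero h.2)
      rw [Ne, num_eq_zero_iff]
      exact hZ r h.1 h.2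
    · simp
  · refine Summable.of_nonneg_of_le (fun _ => norm_nonneg _) (fun r => ?_)
      ((summable_geometric_of_lt_one (q_pos q).le (q_lt_one q)).mul_right
        ((‖Z‖ + ‖node G q β‖) / c))
    split_ifs with h
    · rw [num_div_sub_one h.2, norm_div, norm_mul, norm_neg, Complex.norm_real, Real.norm_eq_abs,
        abs_of_pos (qe_pos r), mul_div_assoc]
      have h1 := hc r h.2
      have h2 := qe_le (G := G) (q := q) r
      have h3 : ‖Z - node G q β‖ ≤ ‖Z‖ + ‖node G q β‖ := norm_sub_le _ _
      gcongr
    · rw [norm_zero]; positivity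

end


/-! ### Normalized determinants with one free column -/

open Classical in
/-- The solution `h` of `weylPoly β X = ∑ m, weylPoly β (node m) * h m X`, `β ∈ B`. -/
def hfun (G : ClassicalType) (q : ℝ) (m : ℕ) (B : Set ℕ) (X : ℂ) : ℂ :=
  dn G q m * ∑' β : ℕ, if β ∈ B then
    (weylPoly G β).eval X / dn G q β * coef G q m (lag G q B β) else 0

section

variable {G : ClassicalType} {q : ℝ} [hq : Fact (0 < q ∧ q < 1)]

omit hq in
lemma hfun_finset (m : ℕ) (s : Finset ℕ) (X : ℂ) :
    hfun G q m s X = dn G q m * ∑ β ∈ s,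
      (weylPoly G β).eval X / dn G q β * coef G q m (lag G q s β) := by
  rw [hfun, tsum_eq_sum (s := s)]
  · congr 1
    exact Finset.sum_congr rfl fun β hβ => if_pos hβ
  · intro β hβ
    exact if_neg hβ

/-- A bound for the Lagrange basis functions on `‖Z‖ ≤ 2`. -/
def lagBound (q : ℝ) : ℝ := Real.exp (3 * (1 - q)⁻¹) * Real.exp (4 * (1 - q)⁻¹ ^ 2)

omit hq in
lemma lagBound_pos (q : ℝ) : 0 < lagBound q := by unfold lagBound; positivity

lemma norm_lag_le_of_norm_le_two {s S : Finset ℕ} (hS : S ⊆ s) (β : ℕ) {Z : ℂ} (hZ : ‖Z‖ ≤ 2) :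
    ‖lag G q s β Z‖ ≤ lagBound q * ∏ r ∈ S, (q ^ β / q ^ r) := by
  have h0 := q_pos q
  have hq1 : 0 < (1 - q)⁻¹ := inv_pos.2 (by linarith [q_lt_one q])
  refine (norm_lag_le hS β Z).trans ?_
  rw [lagBound, mul_assoc]
  have : (‖Z‖ + 1) * (1 - q)⁻¹ ≤ 3 * (1 - q)⁻¹ := by gcongr; linarith
  have h2 : 0 ≤ ∏ r ∈ S, (q ^ β / q ^ r) := Finset.prod_nonneg fun _ _ => by positivity
  gcongr

lemma tendsto_coef_lag {α : Type*} {l : Filter α} [l.IsCountablyGenerated] {s : α → Finset ℕ}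
    {B : Set ℕ} (hs : ∀ r, ∀ᶠ a in l, (r ∈ s a ↔ r ∈ B)) (m β : ℕ) :
    Tendsto (fun a => coef G q m (lag G q (s a) β)) l (𝓝 (coef G q m (lag G q B β))) := by
  refine tendsto_coef (M := lagBound q) m
    (Eventually.of_forall fun a => continuous_lag_finset (s a) β) ?_ ?_
  · refine Eventually.of_forall fun a Z hZ => ?_
    simpa using norm_lag_le_of_norm_le_two (Finset.empty_subset (s a)) β hZ
  · intro Z _
    exact tendsto_lag (B := fun a => (s a : Set ℕ)) hs β tendsto_const_nhds

lemma norm_inv_dn_le (β : ℕ) : ‖(dn G q β)⁻¹‖ ≤ (1 - Real.exp (Real.log q / 4))⁻¹ := by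
  rw [norm_inv]
  exact inv_anti₀ (one_sub_exp_pos q) (le_norm_dn β)

/-- Dominated convergence for the series over β. A general filter is used so that the set of
exponents and the point move simultaneously, which later yields locally uniform convergence. -/
lemma tendsto_hfun {α : Type*} {l : Filter α} [l.IsCountablyGenerated] {s : α → Finset ℕ}
    {B : Set ℕ} (hs : ∀ r, ∀ᶠ a in l, (r ∈ s a ↔ r ∈ B)) (hB : B.Infinite) (m : ℕ)
    {X : α → ℂ} {X' : ℂ} (hX : Tendsto X l (𝓝 X')) :
    Tendsto (fun a => hfun G q m (s a) (X a)) l (𝓝 (hfun G q m B X')) := by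
  have h0 := q_pos q
  refine Tendsto.const_mul _ ?_
  set Λ : ℝ := ‖X'‖ + 2
  have hΛ : 0 < Λ := by positivity
  -- The polynomials grow at most like Λ^β near the limit point. R elements of B give decay q^(Rβ),
  -- so the terms are dominated by a multiple of 2^(-β). Finding R such elements is where infinitude
  -- of B enters.
  obtain ⟨R, hR⟩ : ∃ R : ℕ, q ^ R * Λ ≤ 1 / 2 := by
    obtain ⟨R, hR⟩ := exists_pow_lt_of_lt_one (show 0 < 1 / (2 * Λ) by positivity) (q_lt_one q)
    refine ⟨R, ?_⟩
    calc q ^ R * Λ ≤ 1 / (2 * Λ) * Λ := by gcongr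
      _ = 1 / 2 := by field_simp
  obtain ⟨S, hSB, hSR⟩ := hB.exists_subset_card_eq R
  have hD := one_sub_exp_pos q
  set D := (1 - Real.exp (Real.log q / 4))⁻¹
  have hD0 : 0 < D := inv_pos.2 hD
  have hl := lagBound_pos q
  set C : ℝ := 2 * D * (8 * 3 ^ m * (lagBound q * (∏ r ∈ S, q ^ r)⁻¹))
  have hP : 0 < ∏ r ∈ S, q ^ r := Finset.prod_pos fun r _ => by positivity
  refine tendsto_tsum_of_dominated_convergence (bound := fun β => C * (1 / 2) ^ β)
    ((summable_geometric_of_lt_one (by norm_num) (by norm_num)).mul_left _) ?_ ?_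
  · intro β
    by_cases hβ : β ∈ B
    · rw [if_pos hβ]
      have h1 := ((((weylPoly G β).continuous.tendsto X').comp hX).div_const
        (dn G q β)).mul (tendsto_coef_lag (G := G) (q := q) hs m β)
      refine h1.congr' ?_
      filter_upwards [hs β] with a ha
      rw [if_pos (by exact_mod_cast ha.2 hβ)]; rfl
    · rw [if_neg hβ]
      refine tendsto_const_nhds.congr' ?_
      filter_upwards [hs β] with a ha
      rw [if_neg]
      exact_mod_cast fun h => hβ (ha.1 h)
  · have e1 : ∀ᶠ a in l, S ⊆ s a := by
      have : ∀ᶠ a in l, ∀ r ∈ S, (r ∈ s a ↔ r ∈ B) := (Finset.eventually_all S).2 fun r _ => hs r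
      filter_upwards [this] with a ha r hr
      exact (ha r hr).2 (hSB hr)
    have e2 : ∀ᶠ a in l, ‖X a‖ < ‖X'‖ + 1 := hX.norm.eventually_lt_const (by linarith)
    filter_upwards [e1, e2] with a ha hXa β
    split_ifs with hβ
    · have b1 : ‖(weylPoly G β).eval (X a)‖ ≤ 2 * Λ ^ β :=
        (norm_eval_weylPoly_le G β (X a)).trans (by gcongr; linarith)
      have b2 := norm_inv_dn_le (G := G) (q := q) β
      have b3 : ‖coef G q m (lag G q (s a) β)‖ ≤
          8 * 3 ^ m * (lagBound q * ∏ r ∈ S, (q ^ β / q ^ r)) :=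
        norm_coef_le m fun Z hZ => norm_lag_le_of_norm_le_two ha β hZ
      have b4 : ∏ r ∈ S, (q ^ β / q ^ r) = (q ^ R) ^ β * (∏ r ∈ S, q ^ r)⁻¹ := by
        rw [Finset.prod_div_distrib, Finset.prod_const, hSR, div_eq_mul_inv, ← pow_mul, ← pow_mul,
          mul_comm β R]
      rw [b4] at b3
      rw [norm_mul, div_eq_mul_inv, norm_mul]
      calc _ ≤ 2 * Λ ^ β * D *
            (8 * 3 ^ m * (lagBound q * ((q ^ R) ^ β * (∏ r ∈ S, q ^ r)⁻¹))) := by gcongr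
        _ = C * (q ^ R * Λ) ^ β := by rw [mul_pow]; ring
        _ ≤ C * (1 / 2) ^ β := by gcongr
    · rw [norm_zero]; positivity

/-- The Lagrange polynomial has degree |s| - 1, so its expansion in the W_n ends there; the sum is
its value at a node. -/
lemma lag_interpolation {s : Finset ℕ} {β β' : ℕ} (hβ : β ∈ s) (hβ' : β' ∈ s) :
    ∑ n ∈ Finset.range s.card, coef G q n (lag G q s β') * (weylPoly G n).eval (node G q β) =
      if β = β' then 1 else 0 := by
  have h1 : (fun Z => lag G q s β' Z) = fun Z => (Lagrange.basis s (node G q) β').eval Z :=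
    funext fun Z => lag_eq_eval s β' Z
  have hdeg : (Lagrange.basis s (node G q) β').degree < (s.card : ℕ) := by
    rw [Lagrange.degree_basis (node_injective (G := G) (q := q)).injOn hβ']
    have : 0 < s.card := Finset.card_pos.2 ⟨β, hβ⟩
    exact_mod_cast Nat.sub_lt this one_pos
  have h2 := eval_eq_sum_coef (G := G) (q := q) hdeg (node G q β)
  rw [← h1, ← lag_eq_eval] at h2
  rw [← h2]
  split_ifs with h
  · rw [h, lag_node_self]
  · exact lag_node_ne hβ h

variable {N : ℕ}

/-- The matrix of the values of the Weyl polynomials at the nodes. -/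
def nodeMat (G : ClassicalType) (q : ℝ) (l : Fin N → ℕ) : Matrix (Fin N) (Fin N) ℂ :=
  Matrix.of fun i n => (weylPoly G (l i)).eval (node G q n)

/-- The inverse of `nodeMat`. -/
def nodeMatInv (G : ClassicalType) (q : ℝ) (l : Fin N → ℕ) : Matrix (Fin N) (Fin N) ℂ :=
  Matrix.of fun n i => dn G q n / dn G q (l i) *
    coef G q n (lag G q (Finset.univ.image l : Finset ℕ) (l i))

/-- By duality W_{l_i}(node n) is dn(l_i) / dn(n) times W_n(node l_i). The inverse must then hold
the W_n-coefficients of the polynomials dual to the nodes l_i, which are the Lagrange polynomials.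
-/
lemma nodeMat_mul_nodeMatInv {l : Fin N → ℕ} (hl : Function.Injective l) :
    nodeMat G q l * nodeMatInv G q l = 1 := by
  ext i j
  set s : Finset ℕ := Finset.univ.image l
  have hs : s.card = N := by simp [s, Finset.card_image_of_injective _ hl]
  have hmem : ∀ i, l i ∈ s := fun i => by simp [s]
  have h1 := lag_interpolation (G := G) (q := q) (hmem i) (hmem j)
  rw [hs, Finset.sum_range] at h1
  rw [Matrix.mul_apply, Matrix.one_apply]
  simp only [hl.eq_iff] at h1
  have hd := dn_ne_zero (G := G) (q := q) (l j)
  have h2 : ∀ n : Fin N, nodeMat G q l i n * nodeMatInv G q l n j = dn G q (l i) / dn G q (l j) *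
      (coef G q n (lag G q s (l j)) * (weylPoly G n).eval (node G q (l i))) := by
    intro n
    have := eval_weylPoly_node (G := G) (q := q) (l i) n
    simp only [nodeMat, nodeMatInv, Matrix.of_apply]
    rw [div_mul_eq_mul_div, div_mul_eq_mul_div, mul_div_assoc', div_left_inj' hd]
    linear_combination coef G q n (lag G q s (l j)) * this
  simp only [h2, ← Finset.mul_sum, h1]
  split_ifs with h
  · rw [h, div_self hd, one_mul]
  · rw [mul_zero]

lemma nodeMatInv_mul_nodeMat {l : Fin N → ℕ} (hl : Function.Injective l) :
    nodeMatInv G q l * nodeMat G q l = 1 :=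
  mul_eq_one_comm.1 (nodeMat_mul_nodeMatInv hl)

lemma det_nodeMat_ne_zero {l : Fin N → ℕ} (hl : Function.Injective l) :
    (nodeMat G q l).det ≠ 0 := by
  intro h
  have := congrArg Matrix.det (nodeMat_mul_nodeMatInv (G := G) (q := q) hl)
  rw [Matrix.det_mul, h, zero_mul, Matrix.det_one] at this
  exact zero_ne_one this

omit hq in
lemma hfun_eq_sum {l : Fin N → ℕ} (hl : Function.Injective l) (n : Fin N) (X : ℂ) :
    hfun G q n (Finset.univ.image l : Finset ℕ) X =
      ∑ i, nodeMatInv G q l n i * (weylPoly G (l i)).eval X := by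
  rw [hfun_finset, Finset.sum_image fun a _ b _ h => hl h, Finset.mul_sum]
  refine Finset.sum_congr rfl fun i _ => ?_
  simp only [nodeMatInv, Matrix.of_apply]
  ring

lemma hfun_node {l : Fin N → ℕ} (hl : Function.Injective l) (n j : Fin N) :
    hfun G q n (Finset.univ.image l : Finset ℕ) (node G q j) = if n = j then 1 else 0 := by
  rw [hfun_eq_sum hl]
  have := congrFun (congrFun (nodeMatInv_mul_nodeMat (G := G) (q := q) hl) n) j
  rwa [Matrix.mul_apply, Matrix.one_apply] at this

/-- The matrix of the values of the Weyl polynomials factors through `nodeMat`. -/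
lemma weylMat_eq_mul {l : Fin N → ℕ} (hl : Function.Injective l) (Z : Fin N → ℂ) :
    (Matrix.of fun i j => (weylPoly G (l i)).eval (Z j)) = nodeMat G q l *
      Matrix.of fun n j : Fin N => hfun G q n (Finset.univ.image l : Finset ℕ) (Z j) := by
  have : (Matrix.of fun n j : Fin N => hfun G q n (Finset.univ.image l : Finset ℕ) (Z j)) =
      nodeMatInv G q l * Matrix.of fun i j => (weylPoly G (l i)).eval (Z j) := by
    ext n j
    rw [Matrix.mul_apply]
    exact hfun_eq_sum hl n (Z j)
  rw [this, ← mul_assoc, nodeMat_mul_nodeMatInv hl, one_mul]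

/-- `hfun` is divisible by the Lagrange basis function of the nodes `node n`, `n < N`. -/
lemma exists_hfun_eq_eval_mul {l : Fin N → ℕ} (hl : Function.Injective l) (m : Fin N) :
    ∃ P : Polynomial ℂ, ∀ X, hfun G q m (Finset.univ.image l : Finset ℕ) X =
      P.eval X * lag G q (Finset.range N) m X := by
  set H : Polynomial ℂ := ∑ i, Polynomial.C (nodeMatInv G q l m i) * weylPoly G (l i)
  have hH : ∀ X, hfun G q m (Finset.univ.image l : Finset ℕ) X = H.eval X := fun X => by
    rw [hfun_eq_sum hl]; simp [H, Polynomial.eval_finsetSum]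
  set b := Lagrange.basis (Finset.range N) (node G q) m
  have hdvd : Lagrange.nodal ((Finset.range N).erase m) (node G q) ∣ H := by
    rw [Lagrange.nodal]
    refine Finset.prod_dvd_of_coprime ?_ ?_
    · intro a _ c _ hac
      exact Polynomial.isCoprime_X_sub_C_of_isUnit_sub
        (sub_ne_zero.2 ((node_injective (G := G) (q := q)).ne hac)).isUnit
    · intro n hn
      rw [Polynomial.dvd_iff_isRoot, Polynomial.IsRoot, ← hH]
      have hnN := Finset.mem_range.1 (Finset.mem_of_mem_erase hn)
      have := hfun_node (G := G) (q := q) hl m ⟨n, hnN⟩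
      rw [this, if_neg]
      intro h
      exact Finset.ne_of_mem_erase hn (by rw [h])
  obtain ⟨P, hP⟩ := hdvd
  -- The constant converts the monic nodal polynomial into the normalized Lagrange basis polynomial.
  refine ⟨Polynomial.C (∏ n ∈ (Finset.range N).erase m, (node G q m - node G q n)) * P,
    fun X => ?_⟩
  rw [hH, hP, lag_eq_eval, Lagrange.basis, Polynomial.eval_mul, Polynomial.eval_mul,
    Polynomial.eval_C, Lagrange.eval_nodal, Polynomial.eval_prod]
  simp only [Lagrange.basisDivisor, Polynomial.eval_mul, Polynomial.eval_C, Polynomial.eval_sub,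
    Polynomial.eval_X, Finset.prod_mul_distrib, Finset.prod_inv_distrib]
  have : ∏ n ∈ (Finset.range N).erase m, (node G q m - node G q n) ≠ 0 :=
    Finset.prod_ne_zero_iff.2 fun n hn =>
      sub_ne_zero.2 ((node_injective (G := G) (q := q)).ne (Finset.ne_of_mem_erase hn).symm)
  field_simp

end


/-! ### Divided differences and quotients of alternants -/

/-- The divided difference of `g` at `X 0, …, X i`. -/
def divDiff (R : ℝ) (g : ℂ → ℂ) {k : ℕ} (X : Fin k → ℂ) (i : Fin k) : ℂ :=
  (2 * Real.pi * Complex.I)⁻¹ * ∮ w in C(0, R), g w * ∏ r ∈ Finset.Iic i, (w - X r)⁻¹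

/-- The quotient of `det (p j (X i))` by the Vandermonde determinant. -/
def altQuot (R : ℝ) {k : ℕ} (p : Fin k → ℂ → ℂ) (X : Fin k → ℂ) : ℂ :=
  (Matrix.of fun i j => divDiff R (p j) X i).det

/-- The Vandermonde product `∏_{i < j} (X j - X i)`. -/
def vdm {k : ℕ} (X : Fin k → ℂ) : ℂ := ∏ i : Fin k, ∏ j ∈ Finset.Ioi i, (X j - X i)

section

variable {R : ℝ} {k : ℕ} {X : Fin k → ℂ}

lemma sub_ne_zero_of_mem_sphere (hX : ∀ r, ‖X r‖ < R) {w : ℂ} (hw : w ∈ Metric.sphere (0 : ℂ) R)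
    (r : Fin k) : w - X r ≠ 0 := by
  rw [mem_sphere_zero_iff_norm] at hw
  intro h
  have := hX r
  rw [← sub_eq_zero.1 h, hw] at this
  exact lt_irrefl _ this

lemma continuousOn_prod_inv (hX : ∀ r, ‖X r‖ < R) (s : Finset (Fin k)) :
    ContinuousOn (fun w => ∏ r ∈ s, (w - X r)⁻¹) (Metric.sphere (0 : ℂ) R) :=
  continuousOn_finsetProd _ fun r _ => ContinuousOn.inv₀ (by fun_prop)
    fun _ hw => sub_ne_zero_of_mem_sphere hX hw r

/-- Partial fractions, read off from Lagrange interpolation of the constant 1. -/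
lemma prod_inv_eq_sum_nodalWeight {s : Finset (Fin k)} (hs : s.Nonempty)
    (hinj : Function.Injective X) {w : ℂ} (hw : ∀ r, w - X r ≠ 0) :
    ∏ r ∈ s, (w - X r)⁻¹ = ∑ r ∈ s, Lagrange.nodalWeight s X r * (w - X r)⁻¹ := by
  have h1 := Lagrange.eval_interpolate_not_at_node (s := s) (v := X) 1
    (fun i _ => sub_ne_zero.1 (hw i))
  rw [Lagrange.interpolate_one hinj.injOn hs, Polynomial.eval_one, Lagrange.eval_nodal] at h1
  simp only [Pi.one_apply, mul_one] at h1
  rw [Finset.prod_inv_distrib]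
  exact inv_eq_of_mul_eq_one_right h1.symm

lemma divDiff_eq_sum {g : ℂ → ℂ} (hg : Differentiable ℂ g) (hinj : Function.Injective X)
    (hX : ∀ r, ‖X r‖ < R) (i : Fin k) :
    divDiff R g X i = ∑ r ∈ Finset.Iic i, Lagrange.nodalWeight (Finset.Iic i) X r * g (X r) := by
  have hR : 0 < R := (norm_nonneg _).trans_lt (hX i)
  have h1 : (∮ w in C(0, R), g w * ∏ r ∈ Finset.Iic i, (w - X r)⁻¹) =
      ∮ w in C(0, R), ∑ r ∈ Finset.Iic i,
        Lagrange.nodalWeight (Finset.Iic i) X r • ((w - X r)⁻¹ • g w) := by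
    refine circleIntegral.integral_congr hR.le fun w hw => ?_
    rw [prod_inv_eq_sum_nodalWeight ⟨i, by simp⟩ hinj (sub_ne_zero_of_mem_sphere hX hw),
      Finset.mul_sum]
    exact Finset.sum_congr rfl fun r _ => by simp only [smul_eq_mul]; ring
  have h2 : ∀ r, (∮ w in C(0, R), (w - X r)⁻¹ • g w) = (2 * Real.pi * Complex.I) • g (X r) :=
    fun r => (hg.differentiableOn.mono (subset_univ _)).circleIntegral_sub_inv_smul
      (by simpa using hX r)
  have hc : ∀ r, CircleIntegrable (fun w => Lagrange.nodalWeight (Finset.Iic i) X r •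
      ((w - X r)⁻¹ • g w)) 0 R := fun r => by
    have h3 : ContinuousOn (fun w => (w - X r)⁻¹ • g w) (Metric.sphere (0 : ℂ) R) :=
      ContinuousOn.fun_smul (ContinuousOn.fun_inv₀ (by fun_prop)
        fun w hw => sub_ne_zero_of_mem_sphere hX hw r) hg.continuous.continuousOn
    exact (h3.const_smul (Lagrange.nodalWeight (Finset.Iic i) X r)).circleIntegrable hR.le
  rw [divDiff, h1, circleIntegral.integral_fun_sum (fun r _ => hc r), Finset.mul_sum]
  refine Finset.sum_congr rfl fun r _ => ?_
  rw [circleIntegral.integral_smul, h2]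
  have := Complex.two_pi_I_ne_zero
  simp only [smul_eq_mul]
  field_simp

lemma vdm_eq_prod_Iio (X : Fin k → ℂ) : vdm X = ∏ j : Fin k, ∏ i ∈ Finset.Iio j, (X j - X i) := by
  rw [vdm]
  exact Finset.prod_comm' fun i j => by simp

lemma vdm_ne_zero_iff : vdm X ≠ 0 ↔ Function.Injective X := by
  rw [vdm, ← Matrix.det_vandermonde, Matrix.det_vandermonde_ne_zero_iff]

/-- Passing from values to divided differences is a lower triangular change of rows with diagonal
entries ∏_{r<i} (X_i - X_r)⁻¹, so its determinant is the inverse of the Vandermonde product. -/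
lemma altQuot_mul_vdm {p : Fin k → ℂ → ℂ} (hp : ∀ j, Differentiable ℂ (p j))
    (hinj : Function.Injective X) (hX : ∀ r, ‖X r‖ < R) :
    altQuot R p X * vdm X = (Matrix.of fun i j => p j (X i)).det := by
  set A : Matrix (Fin k) (Fin k) ℂ := Matrix.of fun i r =>
    if r ≤ i then Lagrange.nodalWeight (Finset.Iic i) X r else 0
  have h1 : (Matrix.of fun i j => divDiff R (p j) X i) = A * Matrix.of fun i j => p j (X i) := by
    ext i j
    rw [Matrix.mul_apply, Matrix.of_apply, divDiff_eq_sum (hp j) hinj hX]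
    simp only [A, Matrix.of_apply, ite_mul, zero_mul]
    rw [← Finset.sum_filter]
    congr 1
    ext r; simp
  have h2 : A.det * vdm X = 1 := by
    have htri : A.det = ∏ i, A i i := by
      refine Matrix.det_of_isLowerTriangular A fun i j hij => ?_
      have : i < j := hij
      simp [A, this]
    rw [htri, vdm_eq_prod_Iio, ← Finset.prod_mul_distrib]
    refine Finset.prod_eq_one fun i _ => ?_
    simp only [A, Matrix.of_apply, le_refl, if_true, Lagrange.nodalWeight]
    have : (Finset.Iic i).erase i = Finset.Iio i := by ext r; simp [lt_iff_le_and_ne, and_comm]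
    rw [this, ← Finset.prod_mul_distrib]
    refine Finset.prod_eq_one fun r hr => inv_mul_cancel₀ (sub_ne_zero.2 (hinj.ne ?_))
    exact (Finset.mem_Iio.1 hr).ne'
  rw [altQuot, h1, Matrix.det_mul]
  linear_combination (Matrix.of fun i j => p j (X i)).det * h2

open scoped BoundedContinuousFunction

/-- The circle of radius `R` as a bounded continuous function of the angle. -/
def circleBCF (R : ℝ) : ℝ →ᵇ ℂ :=
  BoundedContinuousFunction.ofNormedAddCommGroup (circleMap 0 R) (continuous_circleMap 0 R) |R|
    fun θ => by simp [circleMap]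

/-- `θ ↦ (R e^{iθ} - X)⁻¹` as a bounded continuous function. -/
def invBCF (R : ℝ) {x : ℂ} (hx : ‖x‖ < R) : ℝ →ᵇ ℂ :=
  BoundedContinuousFunction.ofNormedAddCommGroup (fun θ => (circleMap 0 R θ - x)⁻¹)
    (Continuous.inv₀ ((continuous_circleMap 0 R).sub continuous_const) fun θ h => by
      have h1 : ‖circleMap 0 R θ‖ = R := by
        simp [circleMap, abs_of_pos ((norm_nonneg x).trans_lt hx)]
      rw [sub_eq_zero.1 h] at h1
      linarith)
    (R - ‖x‖)⁻¹ fun θ => by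
      have h1 : ‖circleMap 0 R θ‖ = R := by
        simp [circleMap, abs_of_pos ((norm_nonneg x).trans_lt hx)]
      rw [norm_inv]
      refine inv_anti₀ (by linarith) ?_
      have := norm_sub_norm_le (circleMap 0 R θ) x
      rwa [h1] at this

lemma circleBCF_sub_mul_invBCF {x : ℂ} (hx : ‖x‖ < R) :
    (circleBCF R - algebraMap ℂ _ x) * invBCF R hx = 1 := by
  ext θ
  have h1 : ‖circleMap 0 R θ‖ = R := by
    simp [circleMap, abs_of_pos ((norm_nonneg x).trans_lt hx)]
  have h2 : circleMap 0 R θ - x ≠ 0 := fun h => by rw [sub_eq_zero.1 h] at h1; linarith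
  change (circleMap 0 R θ - algebraMap ℂ (ℝ →ᵇ ℂ) x θ) * (circleMap 0 R θ - x)⁻¹ = 1
  rw [show algebraMap ℂ (ℝ →ᵇ ℂ) x θ = x by simp [BoundedContinuousFunction.algebraMap_apply]]
  exact mul_inv_cancel₀ h2

/-- Integration against a continuous weight over `[0, 2π]`. -/
def integralCLM (f : ℝ → ℂ) (hf : Continuous f) : (ℝ →ᵇ ℂ) →L[ℂ] ℂ :=
  LinearMap.mkContinuous
    { toFun := fun φ => ∫ θ in (0 : ℝ)..2 * Real.pi, f θ * φ θ
      map_add' := fun φ ψ => by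
        simp only [BoundedContinuousFunction.coe_add, Pi.add_apply, mul_add]
        exact intervalIntegral.integral_add ((hf.mul φ.continuous).intervalIntegrable _ _)
          ((hf.mul ψ.continuous).intervalIntegrable _ _)
      map_smul' := fun c φ => by
        simp only [BoundedContinuousFunction.coe_smul, smul_eq_mul, RingHom.id_apply,
          mul_left_comm _ c, intervalIntegral.integral_const_mul] }
    (∫ θ in (0 : ℝ)..2 * Real.pi, ‖f θ‖) fun φ => by
      have h : (0 : ℝ) ≤ 2 * Real.pi := by positivity
      refine (intervalIntegral.norm_integral_le_integral_norm h).trans ?_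
      rw [← intervalIntegral.integral_mul_const]
      refine intervalIntegral.integral_mono_on h ((hf.mul φ.continuous).norm.intervalIntegrable _ _)
        ((hf.norm.mul continuous_const).intervalIntegrable _ _) fun θ _ => ?_
      rw [norm_mul]
      exact mul_le_mul_of_nonneg_left (φ.norm_coe_le_norm θ) (norm_nonneg _)

/-- The integral is a continuous linear functional applied to a product of inverses in the Banach
algebra of bounded continuous functions of the angle. Inversion is analytic at units, so
differentiation under the integral sign is not needed. -/
lemma analyticAt_divDiff {g : ℂ → ℂ} (hg : Continuous g) (hX : ∀ r, ‖X r‖ < R) (i : Fin k) :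
    AnalyticAt ℂ (fun X => divDiff R g X i) X := by
  have hcont : Continuous fun θ : ℝ => circleMap 0 R θ * Complex.I * g (circleMap 0 R θ) := by
    have := continuous_circleMap 0 R
    fun_prop
  have key : AnalyticAt ℂ (fun Y : Fin k → ℂ => (2 * Real.pi * Complex.I)⁻¹ *
      integralCLM _ hcont (∏ r ∈ Finset.Iic i,
        Ring.inverse (circleBCF R - algebraMap ℂ (ℝ →ᵇ ℂ) (Y r)))) X := by
    refine analyticAt_const.mul (((integralCLM _ hcont).analyticAt _).comp ?_)
    refine Finset.analyticAt_fun_prod _ fun r _ => ?_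
    have h1 : AnalyticAt ℂ (fun Y : Fin k → ℂ => circleBCF R - algebraMap ℂ (ℝ →ᵇ ℂ) (Y r)) X :=
      analyticAt_const.sub (((Algebra.linearMap ℂ (ℝ →ᵇ ℂ)).toContinuousLinearMap.comp
        (ContinuousLinearMap.proj (R := ℂ) (φ := fun _ : Fin k => ℂ) r)).analyticAt X)
    have h2 := analyticAt_inverse (𝕜 := ℂ) (Units.mkOfMulEqOne _ _
      (circleBCF_sub_mul_invBCF (R := R) (hX r)))
    exact AnalyticAt.comp (g := Ring.inverse) h2 h1
  refine key.congr ?_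
  have hnear : ∀ᶠ Y : Fin k → ℂ in 𝓝 X, ∀ r, ‖Y r‖ < R := by
    rw [eventually_all]
    intro r
    exact ((continuous_apply r).norm.tendsto X).eventually_lt_const (hX r)
  filter_upwards [hnear] with Y hY
  rw [divDiff, circleIntegral]
  congr 1
  have hinv : ∀ r, Ring.inverse (circleBCF R - algebraMap ℂ (ℝ →ᵇ ℂ) (Y r)) =
      invBCF R (hY r) := fun r => by
    have := Ring.inverse_unit (Units.mkOfMulEqOne _ _ (circleBCF_sub_mul_invBCF (R := R) (hY r)))
    exact this
  simp only [hinv]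
  change ∫ θ in (0 : ℝ)..2 * Real.pi, _ = _
  refine intervalIntegral.integral_congr fun θ _ => ?_
  have : (∏ r ∈ Finset.Iic i, invBCF R (hY r)) θ =
      ∏ r ∈ Finset.Iic i, (circleMap 0 R θ - Y r)⁻¹ := by
    induction Finset.Iic i using Finset.induction_on with
    | empty => simp
    | insert a s ha ih =>
      rw [Finset.prod_insert ha, Finset.prod_insert ha, BoundedContinuousFunction.mul_apply, ih]
      rfl
  simp only [this, deriv_circleMap, smul_eq_mul]
  ring

lemma analyticAt_det {E : Type*} [NormedAddCommGroup E] [NormedSpace ℂ E]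
    {M : E → Matrix (Fin k) (Fin k) ℂ} {x : E} (h : ∀ i j, AnalyticAt ℂ (fun y => M y i j) x) :
    AnalyticAt ℂ (fun y => (M y).det) x := by
  simp only [Matrix.det_apply']
  exact Finset.analyticAt_fun_sum _ fun σ _ => analyticAt_const.mul
    (Finset.analyticAt_fun_prod _ fun i _ => h _ _)

lemma analyticAt_altQuot {p : Fin k → ℂ → ℂ} (hp : ∀ j, Continuous (p j))
    (hX : ∀ r, ‖X r‖ < R) : AnalyticAt ℂ (altQuot R p) X :=
  analyticAt_det fun i j => analyticAt_divDiff (hp j) hX i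

lemma tendsto_divDiff {α : Type*} {l : Filter α} [l.IsCountablyGenerated] {g : α → ℂ → ℂ}
    {g' : ℂ → ℂ} {M : ℝ} (hg : ∀ a, Continuous (g a))
    (hM : ∀ᶠ a in l, ∀ w ∈ Metric.sphere (0 : ℂ) R, ‖g a w‖ ≤ M)
    (hlim : ∀ w ∈ Metric.sphere (0 : ℂ) R, Tendsto (fun a => g a w) l (𝓝 (g' w)))
    {Y : α → Fin k → ℂ} (hY : Tendsto Y l (𝓝 X)) (hX : ∀ r, ‖X r‖ < R) (i : Fin k) :
    Tendsto (fun a => divDiff R (g a) (Y a) i) l (𝓝 (divDiff R g' X i)) := by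
  have hR : 0 < R := (norm_nonneg _).trans_lt (hX i)
  have hYr : ∀ r, Tendsto (fun a => Y a r) l (𝓝 (X r)) := fun r =>
    ((continuous_apply r).tendsto X).comp hY
  -- An intermediate radius keeps all nearby points at distance at least R - ρ from the circle of
  -- integration.
  obtain ⟨ρ, hρ, hρR⟩ : ∃ ρ, (∀ r, ‖X r‖ < ρ) ∧ ρ < R := by
    obtain ⟨r0, hr0⟩ : ∃ r0, ∀ r, ‖X r‖ ≤ ‖X r0‖ := by
      have : Nonempty (Fin k) := ⟨i⟩
      exact Finite.exists_max fun r => ‖X r‖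
    obtain ⟨ρ, h1, h2⟩ := exists_between (hX r0)
    exact ⟨ρ, fun r => (hr0 r).trans_lt h1, h2⟩
  have hYρ : ∀ᶠ a in l, ∀ r, ‖Y a r‖ < ρ := by
    rw [eventually_all]
    exact fun r => (hYr r).norm.eventually_lt_const (hρ r)
  refine Tendsto.const_mul _ ?_
  simp only [circleIntegral]
  refine intervalIntegral.tendsto_integral_filter_of_dominated_convergence
    (fun _ => R * (M * ∏ r ∈ Finset.Iic i, (R - ρ)⁻¹)) ?_ ?_ intervalIntegrable_const ?_
  · filter_upwards [hYρ] with a ha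
    refine Continuous.aestronglyMeasurable ?_
    have h1 : ContinuousOn (fun w => g a w * ∏ r ∈ Finset.Iic i, (w - Y a r)⁻¹)
        (Metric.sphere (0 : ℂ) R) :=
      (hg a).continuousOn.mul (continuousOn_prod_inv (fun r => (ha r).trans hρR) _)
    have h2 : Continuous fun θ : ℝ => deriv (circleMap 0 R) θ := by
      simp only [deriv_circleMap]
      exact (continuous_circleMap 0 R).mul continuous_const
    exact h2.smul (h1.comp_continuous (continuous_circleMap 0 R)
      fun θ => circleMap_mem_sphere 0 hR.le θ)
  · filter_upwards [hYρ, hM] with a ha hMa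
    refine Eventually.of_forall fun θ _ => ?_
    have hw := circleMap_mem_sphere (0 : ℂ) hR.le θ
    have hw' : ‖circleMap 0 R θ‖ = R := by simpa using hw
    rw [norm_smul, norm_mul, deriv_circleMap, norm_mul, Complex.norm_I, mul_one, hw', norm_prod]
    have h1 := hMa _ hw
    have h2 : ∏ r ∈ Finset.Iic i, ‖(circleMap 0 R θ - Y a r)⁻¹‖ ≤
        ∏ r ∈ Finset.Iic i, (R - ρ)⁻¹ := by
      refine Finset.prod_le_prod (fun _ _ => norm_nonneg _) fun r _ => ?_
      rw [norm_inv]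
      refine inv_anti₀ (by linarith) ?_
      have := norm_sub_norm_le (circleMap 0 R θ) (Y a r)
      have := ha r
      linarith
    have h3 : 0 ≤ ∏ r ∈ Finset.Iic i, ‖(circleMap 0 R θ - Y a r)⁻¹‖ :=
      Finset.prod_nonneg fun _ _ => norm_nonneg _
    have hM0 : 0 ≤ M := (norm_nonneg _).trans h1
    gcongr
  · refine Eventually.of_forall fun θ _ => ?_
    have hw := circleMap_mem_sphere (0 : ℂ) hR.le θ
    refine Tendsto.const_smul ((hlim _ hw).mul ?_) _
    exact tendsto_finsetProd _ fun r _ => (tendsto_const_nhds.sub (hYr r)).inv₀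
      (sub_ne_zero_of_mem_sphere hX hw r)

lemma tendsto_det {α : Type*} {l : Filter α} {M : α → Matrix (Fin k) (Fin k) ℂ}
    {M' : Matrix (Fin k) (Fin k) ℂ} (h : ∀ i j, Tendsto (fun a => M a i j) l (𝓝 (M' i j))) :
    Tendsto (fun a => (M a).det) l (𝓝 M'.det) := by
  have : Continuous fun M : Matrix (Fin k) (Fin k) ℂ => M.det := Continuous.matrix_det continuous_id
  exact (this.tendsto M').comp (tendsto_pi_nhds.2 fun i => tendsto_pi_nhds.2 fun j => h i j)

lemma tendsto_altQuot {α : Type*} {l : Filter α} [l.IsCountablyGenerated]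
    {p : α → Fin k → ℂ → ℂ} {p' : Fin k → ℂ → ℂ} {M : Fin k → ℝ} (hp : ∀ a j, Continuous (p a j))
    (hM : ∀ j, ∀ᶠ a in l, ∀ w ∈ Metric.sphere (0 : ℂ) R, ‖p a j w‖ ≤ M j)
    (hlim : ∀ j, ∀ w ∈ Metric.sphere (0 : ℂ) R, Tendsto (fun a => p a j w) l (𝓝 (p' j w)))
    {Y : α → Fin k → ℂ} (hY : Tendsto Y l (𝓝 X)) (hX : ∀ r, ‖X r‖ < R) :
    Tendsto (fun a => altQuot R (p a) (Y a)) l (𝓝 (altQuot R p' X)) :=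
  tendsto_det fun i j => tendsto_divDiff (fun a => hp a j) (hM j) (hlim j) hY hX i

end


/-! ### Characters as quotients of alternants -/

/-- `z + z⁻¹`. -/
def jk (z : ℂ) : ℂ := z + z⁻¹

/-- The exponents `λ_i + N - i` in Weyl's formula. -/
def rows {N : ℕ} (lam : Fin N → ℕ) : Fin N → ℕ := fun i => lam i + (N - 1 - (i : ℕ))

/-- The set of the exponents in Weyl's formula. -/
def rowSet {N : ℕ} (lam : Fin N → ℕ) : Finset ℕ := Finset.univ.image (rows lam)

lemma rows_injective {N : ℕ} {lam : Fin N → ℕ} (h : Antitone lam) :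
    Function.Injective (rows lam) := by
  have : StrictAnti (rows lam) := fun i j hij => by
    have h1 := h hij.le
    have h2 : (i : ℕ) < j := hij
    have := j.isLt
    simp only [rows]; omega
  exact this.injective

lemma jk_exp (c : ℂ) : jk (Complex.exp c) = ch c := by rw [jk, ch, Complex.exp_neg]

lemma jk_eq_iff {z s : ℂ} (hz : z ≠ 0) : jk z = s ↔ z ^ 2 - s * z + 1 = 0 := by
  rw [jk]
  constructor
  · rintro rfl; field_simp; ring
  · intro h; field_simp; linear_combination h

lemma jk_eq_jk_iff {z w : ℂ} (hz : z ≠ 0) (hw : w ≠ 0) :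
    jk z = jk w ↔ (z - w) * (z * w - 1) = 0 := by
  have e : (z - w) * (z * w - 1) = z * w * (jk z - jk w) := by
    rw [jk, jk]; field_simp; ring
  rw [e, mul_eq_zero, or_iff_right (mul_ne_zero hz hw), sub_eq_zero]

/-- The sign relating `Vs` and `vdm`. -/
def vsSign (k : ℕ) : ℂ := ∏ i : Fin k, ∏ _j ∈ Finset.Ioi i, (-1)

lemma vsSign_mul_self (k : ℕ) : vsSign k * vsSign k = 1 := by
  rw [vsSign, ← Finset.prod_mul_distrib]
  refine Finset.prod_eq_one fun i _ => ?_
  rw [← Finset.prod_mul_distrib]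
  exact Finset.prod_eq_one fun j _ => by norm_num

lemma vsSign_ne_zero (k : ℕ) : vsSign k ≠ 0 := fun h => by
  have := vsSign_mul_self k; simp [h] at this

lemma Vs_eq {k : ℕ} (z : Fin k → ℂ) : Vs z = vsSign k * vdm (fun i => jk (z i)) := by
  rw [Vs, vsSign, vdm, ← Finset.prod_mul_distrib]
  refine Finset.prod_congr rfl fun i _ => ?_
  rw [← Finset.prod_mul_distrib]
  refine Finset.prod_congr rfl fun j _ => ?_
  rw [jk, jk]; ring

lemma Vs_ne_zero_iff {k : ℕ} {z : Fin k → ℂ} :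
    Vs z ≠ 0 ↔ Function.Injective fun i => jk (z i) := by
  rw [Vs_eq, mul_ne_zero_iff, and_iff_right (vsSign_ne_zero k), vdm_ne_zero_iff]

lemma eventually_quadratic_ne_zero {a b c : ℂ} (h : a ≠ 0 ∨ b ≠ 0) :
    ∀ᶠ t in 𝓝[≠] (0 : ℂ), a * t ^ 2 + b * t + c ≠ 0 := by
  set P : Polynomial ℂ := Polynomial.C a * Polynomial.X ^ 2 + Polynomial.C b * Polynomial.X +
    Polynomial.C c
  have hP : P ≠ 0 := by
    intro h0
    rcases h with h | h
    · apply h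
      have := congrArg (fun P => Polynomial.coeff P 2) h0
      simpa [P, Polynomial.coeff_X, Polynomial.coeff_C] using this
    · apply h
      have := congrArg (fun P => Polynomial.coeff P 1) h0
      simpa [P, Polynomial.coeff_X, Polynomial.coeff_C] using this
  have hfin : {t | P.IsRoot t}.Finite := Polynomial.finite_setOfPred_isRoot hP
  have hcl : IsClosed ({t | P.IsRoot t} \ {0}) := (hfin.subset sdiff_subset).isClosed
  have h1 : ({t | P.IsRoot t} \ {0})ᶜ ∈ 𝓝 (0 : ℂ) := hcl.isOpen_compl.mem_nhds (by simp)
  filter_upwards [nhdsWithin_le_nhds h1, self_mem_nhdsWithin] with t ht ht0 hz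
  apply ht
  refine ⟨?_, ht0⟩
  simpa [P, Polynomial.IsRoot] using hz

/-- Points of `(ℂ*)^k` can be approximated by points with distinct values of `z + z⁻¹` that avoid
a given finite set. -/
lemma mem_closure_generic {k : ℕ} (z : Fin k → ℂ) (S : Finset ℂ) :
    z ∈ closure {w : Fin k → ℂ | w ∈ punctured k ∧ (∀ i, jk (w i) ∉ S) ∧
      Function.Injective fun i => jk (w i)} := by
  -- The coordinates move with distinct nonzero speeds. Each bad event is then the vanishing of a
  -- polynomial in t of degree at most 2 that is not identically zero, so it fails for small t ≠ 0.
  set γ : ℂ → Fin k → ℂ := fun t i => z i + t * ((i : ℕ) + 1)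
  have hγ : Tendsto γ (𝓝[≠] 0) (𝓝 z) := by
    have : Continuous γ := by fun_prop
    have h := this.tendsto 0
    rw [show γ 0 = z by simp [γ]] at h
    exact h.mono_left nhdsWithin_le_nhds
  have hpos : ∀ i : Fin k, ((i : ℕ) : ℂ) + 1 ≠ 0 := fun i => Nat.cast_add_one_ne_zero _
  refine mem_closure_of_tendsto hγ ?_
  have h0 : ∀ᶠ t in 𝓝[≠] (0 : ℂ), ∀ i, γ t i ≠ 0 := by
    rw [eventually_all]
    intro i
    filter_upwards [eventually_quadratic_ne_zero (a := 0) (b := ((i : ℕ) : ℂ) + 1) (c := z i)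
      (Or.inr (hpos i))] with t ht h
    apply ht
    simp only [γ] at h
    linear_combination h
  have h1 : ∀ᶠ t in 𝓝[≠] (0 : ℂ), ∀ i, ∀ s ∈ S, γ t i ^ 2 - s * γ t i + 1 ≠ 0 := by
    rw [eventually_all]
    intro i
    refine (Finset.eventually_all S).2 fun s _ => ?_
    filter_upwards [eventually_quadratic_ne_zero (a := (((i : ℕ) : ℂ) + 1) ^ 2)
      (b := 2 * z i * ((i : ℕ) + 1) - s * ((i : ℕ) + 1)) (c := z i ^ 2 - s * z i + 1)
      (Or.inl (pow_ne_zero 2 (hpos i)))] with t ht h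
    apply ht
    simp only [γ] at h
    linear_combination h
  have h2 : ∀ᶠ t in 𝓝[≠] (0 : ℂ), ∀ i j, i ≠ j → γ t i - γ t j ≠ 0 := by
    simp only [eventually_all]
    intro i j hij
    have : ((i : ℕ) : ℂ) - (j : ℕ) ≠ 0 :=
      sub_ne_zero.2 (by exact_mod_cast fun h => hij (Fin.ext h))
    filter_upwards [eventually_quadratic_ne_zero (a := 0) (b := ((i : ℕ) : ℂ) - (j : ℕ))
      (c := z i - z j) (Or.inr this)] with t ht h
    apply ht
    simp only [γ] at h
    linear_combination h
  have h3 : ∀ᶠ t in 𝓝[≠] (0 : ℂ), ∀ i j, γ t i * γ t j - 1 ≠ 0 := by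
    simp only [eventually_all]
    intro i j
    filter_upwards [eventually_quadratic_ne_zero (a := (((i : ℕ) : ℂ) + 1) * ((j : ℕ) + 1))
      (b := z i * ((j : ℕ) + 1) + z j * ((i : ℕ) + 1)) (c := z i * z j - 1)
      (Or.inl (mul_ne_zero (hpos i) (hpos j)))] with t ht h
    apply ht
    simp only [γ] at h
    linear_combination h
  filter_upwards [h0, h1, h2, h3] with t a0 a1 a2 a3
  refine ⟨a0, fun i hi => a1 i _ hi ((jk_eq_iff (a0 i)).1 rfl), fun i j hij => ?_⟩
  by_contra hne
  exact mul_ne_zero (a2 i j hne) (a3 i j) ((jk_eq_jk_iff (a0 i) (a0 j)).1 hij)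

lemma mem_closure_regularPoints {N : ℕ} (z : Fin N → ℂ) :
    z ∈ closure (regularPoints N) := by
  refine closure_mono ?_ (mem_closure_generic z {2, -2})
  rintro w ⟨h1, h2, h3⟩
  refine ⟨fun i => ⟨h1 i, fun h => h2 i ?_⟩, Vs_ne_zero_iff.2 h3⟩
  rcases sq_eq_one_iff.1 h with h | h <;> rw [jk, h] <;> norm_num

lemma analyticAt_jk_comp {k : ℕ} {z : Fin k → ℂ} (hz : z ∈ punctured k) :
    AnalyticAt ℂ (fun w : Fin k → ℂ => fun i => jk (w i)) z := by
  rw [analyticAt_pi_iff]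
  intro i
  have h1 : AnalyticAt ℂ (fun w : Fin k → ℂ => w i) z :=
    (ContinuousLinearMap.proj (R := ℂ) (φ := fun _ : Fin k => ℂ) i).analyticAt z
  exact h1.add (h1.inv (hz i))

/-- The values of `z + z⁻¹` lie in the disc of radius `R`. -/
lemma eventually_norm_jk_lt {k : ℕ} {z : Fin k → ℂ} (hz : z ∈ punctured k) {R : ℝ}
    (hR : ∀ i, ‖jk (z i)‖ < R) : ∀ᶠ w in 𝓝 z, ∀ i, ‖jk (w i)‖ < R := by
  have h := (analyticAt_jk_comp hz).continuousAt
  rw [eventually_all]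
  intro i
  exact ((continuous_apply i).continuousAt.comp h).norm.eventually_lt_const (hR i)

lemma exists_norm_jk_lt {k : ℕ} (z : Fin k → ℂ) : ∃ R, ∀ i, ‖jk (z i)‖ < R := by
  refine ⟨∑ i, ‖jk (z i)‖ + 1, fun i => ?_⟩
  have := Finset.single_le_sum (f := fun i => ‖jk (z i)‖) (fun _ _ => norm_nonneg _)
    (Finset.mem_univ i)
  linarith

lemma isOpen_punctured (k : ℕ) : IsOpen (punctured k) := by
  have : punctured k = ⋂ i, {z : Fin k → ℂ | z i ≠ 0} := by ext; simp [punctured]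
  rw [this]
  exact isOpen_iInter_of_finite fun i => isOpen_ne.preimage (continuous_apply i)

/-- The divided difference expression is continuous on all of (ℂ*)^N and agrees with Weyl's quotient
at the dense set of regular points, so it is the continuous extension. The sign appears because `Vs`
and `vdm` take their differences in opposite order. -/
lemma chi_eq_altQuot (G : ClassicalType) {N : ℕ} (lam : Fin N → ℕ) {z : Fin N → ℂ}
    (hz : z ∈ punctured N) {R : ℝ} (hR : ∀ i, ‖jk (z i)‖ < R) :
    chi G lam z = vsSign N *
      altQuot R (fun j Z => (weylPoly G (rows lam j)).eval Z) (fun i => jk (z i)) := by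
  have han : AnalyticAt ℂ (fun w : Fin N → ℂ => vsSign N *
      altQuot R (fun j Z => (weylPoly G (rows lam j)).eval Z) (fun i => jk (w i))) z :=
    analyticAt_const.mul (AnalyticAt.comp (g := altQuot R _)
      (analyticAt_altQuot (fun j => (weylPoly G (rows lam j)).continuous) hR)
      (analyticAt_jk_comp hz))
  refine extendFrom_eq (mem_closure_regularPoints z) ?_
  refine (han.continuousAt.tendsto.mono_left nhdsWithin_le_nhds).congr' ?_
  filter_upwards [self_mem_nhdsWithin, nhdsWithin_le_nhds (eventually_norm_jk_lt hz hR)]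
    with w hw hwR
  have hinj := Vs_ne_zero_iff.1 hw.2
  have h1 := altQuot_mul_vdm (p := fun j Z => (weylPoly G (rows lam j)).eval Z)
    (fun j => (weylPoly G (rows lam j)).differentiable) hinj hwR
  rw [weylQuotient, eq_div_iff hw.2, Vs_eq, ← Matrix.det_transpose]
  have h2 : (Matrix.of fun i j : Fin N => weylEntry G (lam i + (N - 1 - (i : ℕ))) (w j)).transpose =
      Matrix.of fun i j => (weylPoly G (rows lam j)).eval (jk (w i)) := by
    ext i j
    exact weylEntry_eq_eval G _ (hw.1 i).1 (hw.1 i).2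
  rw [h2, ← h1]
  linear_combination (altQuot R (fun j Z => (weylPoly G (rows lam j)).eval Z)
    (fun i => jk (w i)) * vdm (fun i => jk (w i))) * vsSign_mul_self N

lemma analyticAt_chi (G : ClassicalType) {N : ℕ} (lam : Fin N → ℕ) {z : Fin N → ℂ}
    (hz : z ∈ punctured N) : AnalyticAt ℂ (chi G lam) z := by
  obtain ⟨R, hR⟩ := exists_norm_jk_lt z
  have han : AnalyticAt ℂ (fun w : Fin N → ℂ => vsSign N *
      altQuot R (fun j Z => (weylPoly G (rows lam j)).eval Z) (fun i => jk (w i))) z :=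
    analyticAt_const.mul (AnalyticAt.comp (g := altQuot R _)
      (analyticAt_altQuot (fun j => (weylPoly G (rows lam j)).continuous) hR)
      (analyticAt_jk_comp hz))
  refine han.congr ?_
  filter_upwards [(isOpen_punctured N).mem_nhds hz, eventually_norm_jk_lt hz hR] with w h1 h2
  exact (chi_eq_altQuot G lam h1 h2).symm

/-- With polynomial entries no condition z_i² ≠ 1 is needed, which matters in type D, where q^0 = 1
is one of the special points. -/
lemma chi_mul_Vs (G : ClassicalType) {N : ℕ} (lam : Fin N → ℕ) {z : Fin N → ℂ}
    (hz : z ∈ punctured N) (hinj : Function.Injective fun i => jk (z i)) :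
    chi G lam z * Vs z =
      (Matrix.of fun i j => (weylPoly G (rows lam i)).eval (jk (z j))).det := by
  obtain ⟨R, hR⟩ := exists_norm_jk_lt z
  have h1 := altQuot_mul_vdm (p := fun j Z => (weylPoly G (rows lam j)).eval Z)
    (fun j => (weylPoly G (rows lam j)).differentiable) hinj hR
  rw [chi_eq_altQuot G lam hz hR, Vs_eq, ← Matrix.det_transpose]
  have h2 : (Matrix.of fun i j => (weylPoly G (rows lam i)).eval (jk (z j))).transpose =
      Matrix.of fun i j => (weylPoly G (rows lam j)).eval (jk (z i)) := rfl
  rw [h2, ← h1]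
  linear_combination (altQuot R (fun j Z => (weylPoly G (rows lam j)).eval Z)
    (fun i => jk (z i)) * vdm (fun i => jk (z i))) * vsSign_mul_self N

lemma det_eq_det_castLE {k N : ℕ} (h : k ≤ N) (M : Matrix (Fin N) (Fin N) ℂ)
    (hM : ∀ n j : Fin N, k ≤ (j : ℕ) → M n j = if n = j then 1 else 0) :
    M.det = (Matrix.of fun i j : Fin k => M (Fin.castLE h i) (Fin.castLE h j)).det := by
  obtain ⟨r, rfl⟩ := Nat.exists_eq_add_of_le h
  rw [← Matrix.det_submatrix_equiv_self finSumFinEquiv M]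
  have : M.submatrix finSumFinEquiv finSumFinEquiv = Matrix.fromBlocks
      (Matrix.of fun i j : Fin k => M (Fin.castLE h i) (Fin.castLE h j)) 0
      (Matrix.of fun (i : Fin r) (j : Fin k) => M (Fin.natAdd k i) (Fin.castLE h j)) 1 := by
    ext i j
    rcases i with i | i <;> rcases j with j | j
    · rfl
    · simp only [Matrix.submatrix_apply, finSumFinEquiv_apply_left, finSumFinEquiv_apply_right,
        Matrix.fromBlocks_apply₁₂, Matrix.zero_apply]
      rw [hM _ _ (by simp), if_neg]
      intro h; have := congrArg Fin.val h; simp at this; omega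
    · rfl
    · simp only [Matrix.submatrix_apply, finSumFinEquiv_apply_right, Matrix.fromBlocks_apply₂₂,
        Matrix.one_apply]
      rw [hM _ _ (by simp)]
      simp [Fin.ext_iff]
  rw [this, Matrix.det_fromBlocks_zero₁₂, Matrix.det_one, mul_one]

section

variable {G : ClassicalType} {q : ℝ} [hq : Fact (0 < q ∧ q < 1)]

lemma cpow_eq_qe (n : ℕ) : (q : ℂ) ^ ((n : ℂ) + (eps G : ℂ)) = qe G q n := by
  rw [qe, Complex.ofReal_cpow (q_pos q).le]; push_cast; rfl

lemma jk_cpow (n : ℕ) : jk ((q : ℂ) ^ ((n : ℂ) + (eps G : ℂ))) = node G q n := by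
  rw [cpow_eq_qe, jk, node_eq]

lemma qe_ne_zero (n : ℕ) : (qe G q n : ℂ) ≠ 0 := by exact_mod_cast (qe_pos n).ne'

variable {N k : ℕ}

lemma specialPoint_mem_punctured {x : Fin k → ℂ} (hx : x ∈ punctured k) :
    specialPoint G q N x ∈ punctured N := by
  intro i
  rw [specialPoint]
  split_ifs with h
  · exact hx _
  · rw [cpow_eq_qe]; exact qe_ne_zero _

lemma nodes_mem_punctured :
    (fun i : Fin N => (q : ℂ) ^ (((i : ℕ) : ℂ) + (eps G : ℂ))) ∈ punctured N := fun i => by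
  simp only [cpow_eq_qe]; exact qe_ne_zero _

lemma injective_jk_nodes :
    Function.Injective fun i : Fin N => jk ((q : ℂ) ^ (((i : ℕ) : ℂ) + (eps G : ℂ))) := by
  intro i j h
  simp only [jk_cpow] at h
  exact Fin.ext (node_injective h)

/-- Interpolating the monomials of degree below N at the nodes factors the Vandermonde matrix of Z
through that of the nodes. -/
lemma vandermonde_eq (Z : Fin N → ℂ) :
    vdm Z = vdm (fun i : Fin N => node G q i) *
      (Matrix.of fun n j : Fin N => lag G q (Finset.range N) n (Z j)).det := by
  rw [vdm, vdm, ← Matrix.det_vandermonde, ← Matrix.det_vandermonde,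
    ← Matrix.det_transpose (Matrix.vandermonde Z),
    ← Matrix.det_transpose (Matrix.vandermonde fun i : Fin N => node G q i), ← Matrix.det_mul]
  congr 1
  ext i j
  rw [Matrix.mul_apply]
  simp only [Matrix.transpose_apply, Matrix.vandermonde_apply, Matrix.of_apply]
  have hdeg : (Polynomial.X ^ (i : ℕ) : Polynomial ℂ).degree < (Finset.range N).card := by
    rw [Polynomial.degree_X_pow, Finset.card_range]; exact_mod_cast i.isLt
  have h := congrArg (Polynomial.eval (Z j))
    (Lagrange.eq_interpolate (node_injective (G := G) (q := q)).injOn hdeg)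
  rw [Lagrange.interpolate_apply, Polynomial.eval_finsetSum, Finset.sum_range] at h
  simp only [Polynomial.eval_pow, Polynomial.eval_X, Polynomial.eval_mul, Polynomial.eval_C] at h
  rw [h]
  exact Finset.sum_congr rfl fun n _ => by rw [lag_eq_eval]

lemma lag_range_node {n j : ℕ} (hj : j < N) :
    lag G q (Finset.range N) n (node G q j) = if n = j then 1 else 0 := by
  split_ifs with h
  · rw [h, lag_node_self]
  · exact lag_node_ne (Finset.mem_range.2 hj) (Ne.symm h)

lemma jk_specialPoint (x : Fin k → ℂ) (i : Fin N) : jk (specialPoint G q N x i) =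
    if h : (i : ℕ) < k then jk (x ⟨i, h⟩) else node G q i := by
  rw [specialPoint]
  split_ifs with h
  · rfl
  · exact jk_cpow _

/-- Numerator and Vandermonde denominator both factor through their values at the nodes, and these
values cancel against the normalization. In the remaining N × N matrices the specialized columns are
unit vectors, so only k × k blocks survive. -/
lemma normalizedChar_mul_det (hkN : k ≤ N) {lam : Fin N → ℕ} (hlam : Antitone lam)
    {x : Fin k → ℂ} (hx : x ∈ punctured k)
    (hinj : Function.Injective fun i => jk (specialPoint G q N x i)) :
    normalizedChar G q lam x *
        (Matrix.of fun n j : Fin k => lag G q (Finset.range N) n (jk (x j))).det =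
      (Matrix.of fun n j : Fin k => hfun G q n (rowSet lam) (jk (x j))).det := by
  have hl := rows_injective hlam
  have h1 := chi_mul_Vs G lam (specialPoint_mem_punctured (G := G) (q := q) (N := N) hx) hinj
  have h2 := chi_mul_Vs G lam (nodes_mem_punctured (G := G) (q := q) (N := N)) injective_jk_nodes
  rw [weylMat_eq_mul (q := q) hl, Matrix.det_mul] at h1 h2
  have hA := det_nodeMat_ne_zero (G := G) (q := q) hl
  have h3 : (Matrix.of fun n j : Fin N => hfun G q n (Finset.univ.image (rows lam) : Finset ℕ)
      (jk ((q : ℂ) ^ (((j : ℕ) : ℂ) + (eps G : ℂ))))) = 1 := by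
    ext n j
    simp only [Matrix.of_apply, jk_cpow]
    rw [hfun_node hl, Matrix.one_apply]
  rw [h3, Matrix.det_one, mul_one, Vs_eq] at h2
  rw [Vs_eq, vandermonde_eq (G := G) (q := q)] at h1
  simp only [jk_cpow] at h2
  have e1 : ∀ j : Fin k, jk (specialPoint G q N x (Fin.castLE hkN j)) = jk (x j) := fun j => by
    rw [jk_specialPoint, dif_pos (by simp)]; rfl
  have d1 : (Matrix.of fun n j : Fin N => lag G q (Finset.range N) n
      (jk (specialPoint G q N x j))).det =
      (Matrix.of fun n j : Fin k => lag G q (Finset.range N) n (jk (x j))).det := by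
    rw [det_eq_det_castLE hkN]
    · simp only [Matrix.of_apply, e1, Fin.val_castLE]
    · intro n j hj
      simp only [Matrix.of_apply]
      rw [jk_specialPoint, dif_neg (by omega), lag_range_node j.isLt]
      simp [Fin.ext_iff]
  have d2 : (Matrix.of fun n j : Fin N => hfun G q n (Finset.univ.image (rows lam) : Finset ℕ)
      (jk (specialPoint G q N x j))).det =
      (Matrix.of fun n j : Fin k => hfun G q n (rowSet lam) (jk (x j))).det := by
    rw [det_eq_det_castLE hkN]
    · simp only [Matrix.of_apply, e1, Fin.val_castLE, rowSet]
    · intro n j hj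
      simp only [Matrix.of_apply]
      rw [jk_specialPoint, dif_neg (by omega), hfun_node hl]
  rw [d1, d2] at h1
  have hc : chi G lam (fun i : Fin N => (q : ℂ) ^ (((i : ℕ) : ℂ) + (eps G : ℂ))) ≠ 0 := by
    intro h; rw [h, zero_mul] at h2; exact hA h2.symm
  have hV : vsSign N * vdm (fun i : Fin N => node G q i) ≠ 0 := by
    intro h; rw [h, mul_zero] at h2; exact hA h2.symm
  rw [normalizedChar, div_mul_eq_mul_div, div_eq_iff hc]
  refine mul_left_cancel₀ hV ?_
  linear_combination h1 - (Matrix.of fun n j : Fin k =>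
    hfun G q n (rowSet lam) (jk (x j))).det * h2

end


section

variable {G : ClassicalType} {q : ℝ} [hq : Fact (0 < q ∧ q < 1)] {N k : ℕ}

lemma analyticAt_normalizedChar (lam : Fin N → ℕ) {x : Fin k → ℂ} (hx : x ∈ punctured k) :
    AnalyticAt ℂ (fun x => normalizedChar G q lam x) x := by
  have h1 : AnalyticAt ℂ (fun x : Fin k → ℂ => specialPoint G q N x) x := by
    rw [analyticAt_pi_iff]
    intro i
    simp only [specialPoint]
    split_ifs with h
    · exact (ContinuousLinearMap.proj (R := ℂ) (φ := fun _ : Fin k => ℂ) _).analyticAt x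
    · exact analyticAt_const
  exact (AnalyticAt.comp (g := chi G lam) (analyticAt_chi G lam (specialPoint_mem_punctured hx))
    h1).div_const

omit hq in
-- The factors with r ≥ k split into a function of X independent of n and a constant depending on n.
-- Both pull out of determinants and cancel from the two sides of the k × k identity.
lemma lag_range_eq_mul (hkN : k ≤ N) {n : ℕ} (hn : n < k) (X : ℂ) :
    lag G q (Finset.range N) n X = (∏ r ∈ Finset.Ico k N, num G q r X) *
      ((∏ r ∈ Finset.Ico k N, num G q r (node G q n))⁻¹ * lag G q (Finset.range k) n X) := by
  have h : (Finset.range N).erase n = (Finset.range k).erase n ∪ Finset.Ico k N := by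
    ext r; simp; omega
  have hd : Disjoint ((Finset.range k).erase n) (Finset.Ico k N) := by
    rw [Finset.disjoint_left]; intro r; simp; omega
  rw [lag_finset, lag_finset, h, Finset.prod_union hd, Finset.prod_div_distrib (s := Finset.Ico k N)]
  ring

/-- The finite-dimensional determinantal formula. -/
lemma normalizedChar_eq_altQuot (hkN : k ≤ N) {lam : Fin N → ℕ} (hlam : Antitone lam)
    {E : ℕ → Polynomial ℂ} (hE : ∀ n < k, ∀ X, hfun G q n (rowSet lam) X =
      (E n).eval X * lag G q (Finset.range N) n X)
    {x : Fin k → ℂ} (hx : x ∈ punctured k) {R : ℝ} (hR : ∀ i, ‖jk (x i)‖ < R) :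
    normalizedChar G q lam x = vdm (fun i : Fin k => node G q i) *
      altQuot R (fun n X => (E n).eval X * lag G q (Finset.range k) n X) (fun i => jk (x i)) := by
  -- Away from the first N nodes the common factors are nonzero and can be cancelled; the other
  -- points follow by density and continuity of both sides.
  set S : Finset ℂ := (Finset.range N).image (node G q)
  set A : Set (Fin k → ℂ) := {w | w ∈ punctured k ∧ (∀ i, jk (w i) ∉ S) ∧
      Function.Injective fun i => jk (w i)}
  have hlagE : ∀ n : ℕ, lag G q (Finset.range k) n = fun X =>
      (Lagrange.basis (Finset.range k) (node G q) n).eval X := fun n =>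
    funext fun X => lag_eq_eval _ _ _
  have hdiff : ∀ j : Fin k, Differentiable ℂ fun X =>
      (E j).eval X * lag G q (Finset.range k) j X := fun j => by
    rw [hlagE]
    exact (E j).differentiable.mul (Polynomial.differentiable _)
  have hcont : AnalyticAt ℂ (fun w : Fin k → ℂ => vdm (fun i : Fin k => node G q i) *
      altQuot R (fun n X => (E n).eval X * lag G q (Finset.range k) n X) (fun i => jk (w i))) x :=
    analyticAt_const.mul (AnalyticAt.comp (g := altQuot R _)
      (analyticAt_altQuot (fun j => (hdiff j).continuous) hR) (analyticAt_jk_comp hx))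
  have : (𝓝[A] x).NeBot := mem_closure_iff_nhdsWithin_neBot.1 (mem_closure_generic x S)
  have ht1 := (analyticAt_normalizedChar (G := G) (q := q) lam hx).continuousAt.tendsto.mono_left
    (nhdsWithin_le_nhds (s := A))
  have ht2 := hcont.continuousAt.tendsto.mono_left (nhdsWithin_le_nhds (s := A))
  refine tendsto_nhds_unique (ht1.congr' ?_) ht2
  filter_upwards [self_mem_nhdsWithin, nhdsWithin_le_nhds (eventually_norm_jk_lt hx hR)]
    with w hw hwR
  obtain ⟨hw0, hwS, hwi⟩ := hw
  have hwn : ∀ i, ∀ n < N, jk (w i) ≠ node G q n := fun i n hn h =>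
    hwS i (Finset.mem_image.2 ⟨n, Finset.mem_range.2 hn, h.symm⟩)
  have hinj : Function.Injective fun i => jk (specialPoint G q N w i) := by
    intro a b hab
    simp only [jk_specialPoint] at hab
    split_ifs at hab with ha hb hb
    · have := Fin.val_eq_of_eq (hwi hab); exact Fin.ext this
    · exact absurd hab (hwn _ _ b.isLt)
    · exact absurd hab.symm (hwn _ _ a.isLt)
    · exact Fin.ext (node_injective hab)
  have h1 := normalizedChar_mul_det (G := G) (q := q) hkN hlam hw0 hinj
  set U : ℂ → ℂ := fun X => ∏ r ∈ Finset.Ico k N, num G q r X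
  set V : ℕ → ℂ := fun n => (∏ r ∈ Finset.Ico k N, num G q r (node G q n))⁻¹
  have hU : ∀ j, U (jk (w j)) ≠ 0 := fun j => Finset.prod_ne_zero_iff.2 fun r hr => by
    rw [Ne, num_eq_zero_iff]; exact hwn j r (Finset.mem_Ico.1 hr).2
  have hV : ∀ n : Fin k, V n ≠ 0 := fun n => inv_ne_zero (Finset.prod_ne_zero_iff.2 fun r hr =>
    num_node_ne_zero (by have := (Finset.mem_Ico.1 hr).1; omega))
  have d : ∀ M : Matrix (Fin k) (Fin k) ℂ, (Matrix.of fun n j : Fin k =>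
      U (jk (w j)) * (V n * M n j)).det = (∏ j, U (jk (w j))) * ((∏ n : Fin k, V n) * M.det) := by
    intro M
    rw [← Matrix.det_mul_column, ← Matrix.det_mul_row]; rfl
  have e1 : (Matrix.of fun n j : Fin k => lag G q (Finset.range N) n (jk (w j))) =
      Matrix.of fun n j : Fin k => U (jk (w j)) * (V n *
        (Matrix.of fun n j : Fin k => lag G q (Finset.range k) n (jk (w j))) n j) := by
    ext n j; exact lag_range_eq_mul hkN n.isLt _
  have e2 : (Matrix.of fun n j : Fin k => hfun G q n (rowSet lam) (jk (w j))) =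
      Matrix.of fun n j : Fin k => U (jk (w j)) * (V n * (Matrix.of fun n j : Fin k =>
        (E n).eval (jk (w j)) * lag G q (Finset.range k) n (jk (w j))) n j) := by
    ext n j
    simp only [Matrix.of_apply]
    rw [hE n n.isLt, lag_range_eq_mul hkN n.isLt]; ring
  rw [e1, e2, d, d] at h1
  have hUV : (∏ j, U (jk (w j))) * (∏ n : Fin k, V n) ≠ 0 :=
    mul_ne_zero (Finset.prod_ne_zero_iff.2 fun j _ => hU j)
      (Finset.prod_ne_zero_iff.2 fun n _ => hV n)
  have h2 := altQuot_mul_vdm hdiff hwi hwR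
  have h3 := vandermonde_eq (G := G) (q := q) (fun i => jk (w i))
  have h4 := vdm_ne_zero_iff.2 hwi
  rw [← Matrix.det_transpose] at h2
  have h5 : (Matrix.of fun i j : Fin k => (E j).eval (jk (w i)) *
      lag G q (Finset.range k) j (jk (w i))).transpose = Matrix.of fun n j : Fin k =>
        (E n).eval (jk (w j)) * lag G q (Finset.range k) n (jk (w j)) := rfl
  rw [h5] at h2
  refine mul_right_cancel₀ h4 (mul_left_cancel₀ hUV ?_)
  rw [mul_assoc (vdm _), h2]
  conv_lhs => rw [h3]
  linear_combination vdm (fun i : Fin k => node G q i) * h1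

end

/-! ### Continuous convergence -/

section

variable {E : Type*} [TopologicalSpace E]

/-- Continuous convergence forces a continuous limit: closed neighbourhoods of f x retain the
pointwise limits at nearby points. -/
lemma continuousWithinAt_of_tendsto_prod {F : ℕ → E → ℂ} {f : E → ℂ} {K : Set E}
    (h : ∀ x ∈ K, Tendsto (fun p : ℕ × E => F p.1 p.2) (atTop ×ˢ 𝓝 x) (𝓝 (f x)))
    {x : E} (hx : x ∈ K) : ContinuousWithinAt f K x := by
  refine (closed_nhds_basis (f x)).tendsto_right_iff.2 fun V hV => ?_
  have h1 := (h x hx).eventually (p := fun y => y ∈ V) hV.1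
  have h2 : ∀ᶠ y in 𝓝 x, ∀ᶠ n in atTop, F n y ∈ V := (eventually_swap_iff.1 h1).curry
  filter_upwards [nhdsWithin_le_nhds h2, self_mem_nhdsWithin] with y hy hyK
  have h3 : Tendsto (fun n => F n y) atTop (𝓝 (f y)) :=
    (h y hyK).comp (tendsto_id.prodMk (tendsto_const_nhds (x := y)))
  exact hV.2.mem_of_tendsto h3 hy

lemma tendstoUniformlyOn_of_tendsto_prod {F : ℕ → E → ℂ} {f : E → ℂ} {K : Set E}
    (hK : IsCompact K)
    (h : ∀ x ∈ K, Tendsto (fun p : ℕ × E => F p.1 p.2) (atTop ×ˢ 𝓝 x) (𝓝 (f x))) :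
    TendstoUniformlyOn F f atTop K := by
  rw [← tendstoLocallyUniformlyOn_iff_tendstoUniformlyOn_of_compact hK,
    tendstoLocallyUniformlyOn_iff_forall_tendsto]
  intro x hx
  have h1 : Tendsto (fun p : ℕ × E => F p.1 p.2) (atTop ×ˢ 𝓝[K] x) (𝓝 (f x)) :=
    (h x hx).mono_left (Filter.prod_mono le_rfl nhdsWithin_le_nhds)
  have h2 : Tendsto (fun p : ℕ × E => f p.2) (atTop ×ˢ 𝓝[K] x) (𝓝 (f x)) :=
    (continuousWithinAt_of_tendsto_prod h hx).tendsto.comp tendsto_snd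
  have h3 := h2.prodMk_nhds h1
  exact h3.mono_right (nhds_prod_eq.trans_le (by rw [← nhds_prod_eq]; exact nhds_le_uniformity _))

lemma tendsto_prod_of_tendstoUniformlyOn {F : ℕ → E → ℂ} {f : E → ℂ} {K : Set E} {x : E}
    (h : TendstoUniformlyOn F f atTop K) (hK : K ∈ 𝓝 x) (hf : ContinuousAt f x) :
    Tendsto (fun p : ℕ × E => F p.1 p.2) (atTop ×ˢ 𝓝 x) (𝓝 (f x)) := by
  have h1 := tendstoUniformlyOn_iff_tendsto.1 h
  have h2 : Tendsto (fun p : ℕ × E => (f p.2, F p.1 p.2)) (atTop ×ˢ 𝓝 x) (uniformity ℂ) :=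
    h1.mono_left (Filter.prod_mono le_rfl (le_principal_iff.2 hK))
  exact (hf.tendsto.comp tendsto_snd).congr_uniformity h2

end

/-- Entire functions whose products with convergent sequences converge have an entire limit. -/
lemma exists_entire_limit {E L h : ℕ → ℂ → ℂ} {L' h' : ℂ → ℂ} (hE : ∀ n, Differentiable ℂ (E n))
    (hEL : ∀ᶠ n in atTop, ∀ X, h n X = E n X * L n X)
    (hL : ∀ X, Tendsto (fun p : ℕ × ℂ => L p.1 p.2) (atTop ×ˢ 𝓝 X) (𝓝 (L' X)))
    (hh : ∀ X, Tendsto (fun p : ℕ × ℂ => h p.1 p.2) (atTop ×ˢ 𝓝 X) (𝓝 (h' X)))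
    (hR : ∀ ρ : ℝ, ∃ R > ρ, ∀ w ∈ Metric.sphere (0 : ℂ) R, L' w ≠ 0) :
    ∃ E' : ℂ → ℂ, Differentiable ℂ E' ∧ (∀ X, h' X = E' X * L' X) ∧
      ∀ X, Tendsto (fun p : ℕ × ℂ => E p.1 p.2) (atTop ×ˢ 𝓝 X) (𝓝 (E' X)) := by
  have hcauchy : ∀ ρ : ℝ, ∃ R > ρ, UniformCauchySeqOn E atTop (Metric.closedBall 0 R) := by
    intro ρ
    obtain ⟨R, hRρ, hRL⟩ := hR (max ρ 0)
    have hR0 : 0 < R := (le_max_right _ _).trans_lt hRρ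
    refine ⟨R, (le_max_left _ _).trans_lt hRρ, ?_⟩
    -- Division by L is possible only where L' has no zeros. On such a sphere the quotient converges
    -- uniformly, and the maximum principle carries the Cauchy property of E_n into the ball, past
    -- the zeros of L'.
    have h1 : TendstoUniformlyOn E (fun w => h' w / L' w) atTop (Metric.sphere (0 : ℂ) R) := by
      refine tendstoUniformlyOn_of_tendsto_prod (isCompact_sphere 0 R) fun w hw => ?_
      refine ((hh w).div (hL w) (hRL w hw)).congr' ?_
      filter_upwards [(hL w).eventually_ne (hRL w hw), hEL.prod_inl (𝓝 w)] with p hp1 hp2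
      show h p.1 p.2 / L p.1 p.2 = E p.1 p.2
      rw [hp2, mul_div_cancel_right₀ _ hp1]
    have h2 := h1.uniformCauchySeqOn
    rw [Metric.uniformCauchySeqOn_iff] at h2 ⊢
    intro ε hε
    obtain ⟨n0, hn0⟩ := h2 (ε / 2) (by positivity)
    refine ⟨n0, fun m hm n hn x hx => ?_⟩
    have h3 := Complex.norm_le_of_forall_mem_frontier_norm_le (U := Metric.ball (0 : ℂ) R)
      (f := fun x => E m x - E n x) (C := ε / 2) Metric.isBounded_ball
      ((hE m).sub (hE n)).diffContOnCl (fun z hz => by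
        rw [frontier_ball _ hR0.ne'] at hz
        have := hn0 m hm n hn z hz
        rw [dist_eq_norm] at this
        exact this.le) (z := x) (by rwa [closure_ball _ hR0.ne'])
    rw [dist_eq_norm]
    linarith
  have hlim : ∀ X, ∃ c, Tendsto (fun n => E n X) atTop (𝓝 c) := by
    intro X
    obtain ⟨R, hR1, hR2⟩ := hcauchy ‖X‖
    exact cauchySeq_tendsto_of_complete (hR2.cauchySeq (by simpa using hR1.le))
  choose E' hE' using hlim
  have hunif : ∀ ρ : ℝ, ∃ R > ρ, TendstoUniformlyOn E E' atTop (Metric.closedBall 0 R) := by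
    intro ρ
    obtain ⟨R, hR1, hR2⟩ := hcauchy ρ
    exact ⟨R, hR1, hR2.tendstoUniformlyOn_of_tendsto fun x _ => hE' x⟩
  have hdiff : Differentiable ℂ E' := by
    intro X
    obtain ⟨R, hR1, hR2⟩ := hunif ‖X‖
    have h1 : TendstoLocallyUniformlyOn E E' atTop (Metric.ball (0 : ℂ) R) :=
      (hR2.mono Metric.ball_subset_closedBall).tendstoLocallyUniformlyOn
    exact (h1.differentiableOn (Eventually.of_forall fun n => (hE n).differentiableOn)
      Metric.isOpen_ball).differentiableAt (Metric.isOpen_ball.mem_nhds (by simpa using hR1))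
  have hcc : ∀ X, Tendsto (fun p : ℕ × ℂ => E p.1 p.2) (atTop ×ˢ 𝓝 X) (𝓝 (E' X)) := by
    intro X
    obtain ⟨R, hR1, hR2⟩ := hunif ‖X‖
    exact tendsto_prod_of_tendstoUniformlyOn hR2 (Metric.closedBall_mem_nhds_of_mem
      (by simpa using hR1)) (hdiff X).continuousAt
  refine ⟨E', hdiff, fun X => ?_, hcc⟩
  refine tendsto_nhds_unique (hh X) (((hcc X).mul (hL X)).congr' ?_)
  filter_upwards [hEL.prod_inl (𝓝 X)] with p hp
  rw [hp]


/-! ### Limit functions attached to a limiting set of exponents. -/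

/-- The limit of the sets of exponents of signatures stabilizing to `y`. -/
def charSet (y : ℕ → ℕ) : Set ℕ := Set.range fun i => y i + i

lemma charSet_infinite (y : ℕ → ℕ) : (charSet y).Infinite := by
  refine Set.infinite_of_not_bddAbove fun ⟨M, hM⟩ => ?_
  have := hM ⟨M + 1, rfl⟩
  simp only at this
  omega

/-- The i-th exponent from the bottom, counted from 0, is at least i. Whether r is an exponent
therefore depends only on the lowest r + 1 rows, which are eventually constant. -/
lemma eventually_mem_rowSet_iff {lam : (N : ℕ) → Fin N → ℕ} {y : ℕ → ℕ} (h : Stabilizes lam y)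
    (r : ℕ) : ∀ᶠ N in atTop, (r ∈ rowSet (lam N) ↔ r ∈ charSet y) := by
  have h1 : ∀ᶠ N in atTop, ∀ i ∈ Finset.range (r + 1),
      (if h : i < N then lam N ⟨N - 1 - i, by omega⟩ else 0) = y i := by
    rw [Filter.eventually_all_finset]
    intro i _
    have := h i
    rw [nhds_discrete, tendsto_pure] at this
    exact this
  filter_upwards [h1, eventually_gt_atTop r] with N hN hr
  simp only [rowSet, Finset.mem_image, Finset.mem_univ, true_and, charSet, Set.mem_range, rows]
  constructor
  · rintro ⟨i, hi⟩
    have := i.isLt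
    have h2 := hN (N - 1 - i) (Finset.mem_range.2 (by omega))
    rw [dif_pos (by omega)] at h2
    refine ⟨N - 1 - i, ?_⟩
    have h3 : (⟨N - 1 - (N - 1 - (i : ℕ)), by omega⟩ : Fin N) = i := by
      ext; simp only; omega
    rw [← h2, h3, hi]
  · rintro ⟨i, hi⟩
    have h2 := hN i (Finset.mem_range.2 (by omega))
    rw [dif_pos (by omega)] at h2
    refine ⟨⟨N - 1 - i, by omega⟩, ?_⟩
    rw [h2]
    simp only
    omega

section

variable {R R' : ℝ} {k : ℕ} {X : Fin k → ℂ}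

lemma divDiff_congr_radius {g : ℂ → ℂ} (hg : Differentiable ℂ g) (hX : ∀ r, ‖X r‖ < R)
    (hR : R ≤ R') (i : Fin k) : divDiff R' g X i = divDiff R g X i := by
  have hR0 : 0 < R := (norm_nonneg _).trans_lt (hX i)
  have hd : ∀ w ∉ Metric.ball (0 : ℂ) R,
      DifferentiableAt ℂ (fun w => g w * ∏ r ∈ Finset.Iic i, (w - X r)⁻¹) w := by
    intro w hw
    refine (hg w).mul (DifferentiableAt.fun_finsetProd fun r _ => ?_)
    refine (differentiableAt_id.sub_const _).inv fun h => ?_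
    have h' : w = X r := sub_eq_zero.1 h
    exact hw (by simpa [h'] using hX r)
  rw [divDiff, divDiff, Complex.circleIntegral_eq_of_differentiable_on_annulus_off_countable hR0 hR
    Set.countable_empty]
  · exact fun w hw => (hd w hw.2).continuousAt.continuousWithinAt
  · exact fun w hw => hd w fun h => hw.1.2 (Metric.ball_subset_closedBall h)

lemma altQuot_congr_radius {p : Fin k → ℂ → ℂ} (hp : ∀ j, Differentiable ℂ (p j))
    (hX : ∀ r, ‖X r‖ < R) (hX' : ∀ r, ‖X r‖ < R') : altQuot R p X = altQuot R' p X := by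
  rcases le_total R R' with h | h
  · simp only [altQuot, divDiff_congr_radius (hp _) hX h]
  · simp only [altQuot, divDiff_congr_radius (hp _) hX' h]

end

section

variable {G : ClassicalType} {q : ℝ} [hq : Fact (0 < q ∧ q < 1)]

lemma exists_sphere_disjoint_nodes (G : ClassicalType) (q ρ : ℝ) :
    ∃ R > ρ, ∀ w ∈ Metric.sphere (0 : ℂ) R, ∀ r, w ≠ node G q r := by
  have h := (Set.countable_range fun r => ‖node G q r‖).dense_compl ℝ
  obtain ⟨R, hR, hR1, hR2⟩ := h.exists_between (lt_add_one ρ)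
  refine ⟨R, hR1, fun w hw r hr => hR ⟨r, ?_⟩⟩
  rw [mem_sphere_zero_iff_norm] at hw
  simp only
  rw [← hr, hw]

lemma eq_of_mul_lag_eq {E₁ E₂ : ℂ → ℂ} (h₁ : Continuous E₁) (h₂ : Continuous E₂) {m : ℕ}
    (h : ∀ X, E₁ X * lag G q univ m X = E₂ X * lag G q univ m X) : E₁ = E₂ := by
  refine h₁.ext_on ((Set.countable_range (node G q)).dense_compl ℂ) h₂ fun X hX => ?_
  refine mul_right_cancel₀ (lag_ne_zero fun r _ _ hr => hX ⟨r, hr.symm⟩) (h X)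

/-- The polynomials in the finite-dimensional determinantal formula converge. -/
lemma exists_limit_polynomials {lam : (N : ℕ) → Fin N → ℕ} (hlam : ∀ N, Antitone (lam N))
    {B : Set ℕ} (hB : B.Infinite) (hs : ∀ r, ∀ᶠ N in atTop, (r ∈ rowSet (lam N) ↔ r ∈ B)) :
    ∃ (P : ℕ → ℕ → Polynomial ℂ) (E : ℕ → ℂ → ℂ),
      (∀ N, ∀ m < N, ∀ X, hfun G q m (rowSet (lam N)) X =
        (P N m).eval X * lag G q (Finset.range N) m X) ∧
      (∀ m, Differentiable ℂ (E m)) ∧ (∀ m X, hfun G q m B X = E m X * lag G q univ m X) ∧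
      ∀ m X, Tendsto (fun p : ℕ × ℂ => (P p.1 m).eval p.2) (atTop ×ˢ 𝓝 X) (𝓝 (E m X)) := by
  have h1 : ∀ N m, ∃ P : Polynomial ℂ, m < N → ∀ X, hfun G q m (rowSet (lam N)) X =
      P.eval X * lag G q (Finset.range N) m X := by
    intro N m
    by_cases h : m < N
    · obtain ⟨P, hP⟩ := exists_hfun_eq_eval_mul (G := G) (q := q) (rows_injective (hlam N)) ⟨m, h⟩
      exact ⟨P, fun _ => hP⟩
    · exact ⟨0, fun h' => absurd h' h⟩
  choose P hP using h1
  have h2 : ∀ m, ∃ E' : ℂ → ℂ, Differentiable ℂ E' ∧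
      (∀ X, hfun G q m B X = E' X * lag G q univ m X) ∧
      ∀ X, Tendsto (fun p : ℕ × ℂ => (P p.1 m).eval p.2) (atTop ×ˢ 𝓝 X) (𝓝 (E' X)) := by
    intro m
    refine exists_entire_limit (L := fun N => lag G q (Finset.range N) m)
      (h := fun N => hfun G q m (rowSet (lam N))) (fun N => (P N m).differentiable) ?_ ?_ ?_ ?_
    · filter_upwards [eventually_gt_atTop m] with N hN using hP N m hN
    · intro X
      refine tendsto_lag (B := fun p : ℕ × ℂ => ((Finset.range p.1 : Finset ℕ) : Set ℕ)) ?_ m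
        tendsto_snd
      intro r
      filter_upwards [(eventually_gt_atTop r).prod_inl (𝓝 X)] with p hp
      simpa using hp
    · intro X
      exact tendsto_hfun (s := fun p : ℕ × ℂ => rowSet (lam p.1))
        (fun r => (hs r).prod_inl (𝓝 X)) hB m tendsto_snd
    · intro ρ
      obtain ⟨R, hR, h⟩ := exists_sphere_disjoint_nodes G q ρ
      exact ⟨R, hR, fun w hw => lag_ne_zero fun r _ _ => h w hw r⟩
  choose E hE1 hE2 hE3 using h2
  exact ⟨P, E, fun N m hm => hP N m hm, hE1, hE2, hE3⟩

/-- Divisibility by the infinite Lagrange product is obtained as a limit of polynomial divisibility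
along the truncations of y, which form a sequence of signatures stabilizing to y. -/
lemma exists_entire (y : ℕ → ℕ) (hy : Monotone y) : ∃ E : ℕ → ℂ → ℂ,
    (∀ m, Differentiable ℂ (E m)) ∧
      ∀ m X, hfun G q m (charSet y) X = E m X * lag G q univ m X := by
  obtain ⟨P, E, -, h1, h2, -⟩ := exists_limit_polynomials (G := G) (q := q)
    (lam := fun N i => y (N - 1 - i)) (B := charSet y)
    (fun N i j hij => hy (by have : (i : ℕ) ≤ j := hij; omega)) (charSet_infinite y)
    (eventually_mem_rowSet_iff fun i => tendsto_const_nhds.congr' (by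
      filter_upwards [eventually_gt_atTop i] with N hN
      rw [dif_pos hN]
      congr 1
      omega))
  exact ⟨E, h1, h2⟩

/-- The multivariate limit function built from entire functions `E m`. -/
def phiLimit (G : ClassicalType) (q : ℝ) (k : ℕ) (E : ℕ → ℂ → ℂ) (x : Fin k → ℂ) : ℂ :=
  vdm (fun i : Fin k => node G q i) * altQuot (∑ i, ‖jk (x i)‖ + 1)
    (fun n X => E n X * lag G q (Finset.range k) n X) (fun i => jk (x i))

variable {k : ℕ} {E : ℕ → ℂ → ℂ}

lemma differentiable_mul_lag (hE : ∀ m, Differentiable ℂ (E m)) (n : ℕ) :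
    Differentiable ℂ fun X => E n X * lag G q (Finset.range k) n X := by
  simp only [lag_eq_eval]
  exact (hE n).mul (Polynomial.differentiable _)

/-- The radius in the definition varies with x; replacing it by a locally constant one is what makes
analyticity and convergence visible. -/
lemma phiLimit_eq (hE : ∀ m, Differentiable ℂ (E m)) {x : Fin k → ℂ} {R : ℝ}
    (hR : ∀ i, ‖jk (x i)‖ < R) :
    phiLimit G q k E x = vdm (fun i : Fin k => node G q i) * altQuot R
      (fun n X => E n X * lag G q (Finset.range k) n X) (fun i => jk (x i)) := by
  rw [phiLimit, altQuot_congr_radius (fun n => differentiable_mul_lag hE n) (fun i => ?_) hR]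
  have := Finset.single_le_sum (f := fun i => ‖jk (x i)‖) (fun _ _ => norm_nonneg _)
    (Finset.mem_univ i)
  linarith

lemma analyticOnNhd_phiLimit (hE : ∀ m, Differentiable ℂ (E m)) :
    AnalyticOnNhd ℂ (phiLimit G q k E) (punctured k) := by
  intro x hx
  obtain ⟨R, hR⟩ := exists_norm_jk_lt x
  have h : AnalyticAt ℂ (fun x : Fin k → ℂ => vdm (fun i : Fin k => node G q i) * altQuot R
      (fun n X => E n X * lag G q (Finset.range k) n X) (fun i => jk (x i))) x :=
    analyticAt_const.mul (AnalyticAt.comp (g := altQuot R _)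
      (analyticAt_altQuot (fun j => (differentiable_mul_lag hE j).continuous) hR)
      (analyticAt_jk_comp hx))
  refine h.congr ?_
  filter_upwards [eventually_norm_jk_lt hx hR] with w hw
  rw [phiLimit_eq hE hw]

lemma charsConvergeTo_phiLimit (hE : ∀ m, Differentiable ℂ (E m)) {B : Set ℕ} (hB : B.Infinite)
    (hEB : ∀ m X, hfun G q m B X = E m X * lag G q univ m X)
    {lam : (N : ℕ) → Fin N → ℕ} (hlam : ∀ N, Antitone (lam N))
    (hs : ∀ r, ∀ᶠ N in atTop, (r ∈ rowSet (lam N) ↔ r ∈ B)) (k : ℕ) :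
    CharsConvergeTo G q lam k (phiLimit G q k E) := by
  obtain ⟨P, E', hP, hE', hEB', hlim⟩ := exists_limit_polynomials (G := G) (q := q) hlam hB hs
  -- The entire limits depend only on B, so one family E serves every sequence of signatures with
  -- these limiting exponents.
  have hEE : E' = E := funext fun m => eq_of_mul_lag_eq (hE' m).continuous (hE m).continuous
    fun X => (hEB' m X).symm.trans (hEB m X)
  subst hEE
  intro K hK hKp
  refine tendstoUniformlyOn_of_tendsto_prod hK fun x hxK => ?_
  have hx := hKp hxK
  obtain ⟨R, hR⟩ := exists_norm_jk_lt x
  rw [phiLimit_eq hE hR]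
  have hunif : ∀ m, TendstoUniformlyOn (fun N X => (P N m).eval X) (E' m) atTop
      (Metric.sphere (0 : ℂ) R) := fun m =>
    tendstoUniformlyOn_of_tendsto_prod (isCompact_sphere 0 R) fun X _ => hlim m X
  have hbd : ∀ m, ∃ M, ∀ᶠ N in atTop, ∀ w ∈ Metric.sphere (0 : ℂ) R,
      ‖(P N m).eval w * lag G q (Finset.range k) m w‖ ≤ M := by
    intro m
    obtain ⟨C, hC⟩ := (isCompact_sphere (0 : ℂ) R).exists_bound_of_continuousOn
      (hE m).continuous.continuousOn
    obtain ⟨D, hD⟩ := (isCompact_sphere (0 : ℂ) R).exists_bound_of_continuousOn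
      (continuous_lag_finset (G := G) (q := q) (Finset.range k) m).continuousOn
    refine ⟨(C + 1) * D, ?_⟩
    filter_upwards [Metric.tendstoUniformlyOn_iff.1 (hunif m) 1 one_pos] with N hN w hw
    rw [norm_mul]
    have h1 := hN w hw
    rw [dist_comm, dist_eq_norm] at h1
    have h2 : ‖(P N m).eval w‖ ≤ C + 1 := by
      have := norm_le_norm_add_norm_sub' ((P N m).eval w) (E' m w)
      linarith [hC w hw]
    exact mul_le_mul h2 (hD w hw) (norm_nonneg _) ((norm_nonneg _).trans h2)
  choose M hM using hbd
  refine Tendsto.congr' ?_ ((tendsto_altQuot (l := (atTop : Filter ℕ) ×ˢ 𝓝 x)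
    (p := fun (a : ℕ × (Fin k → ℂ)) (n : Fin k) X =>
      (P a.1 n).eval X * lag G q (Finset.range k) n X)
    (Y := fun a i => jk (a.2 i)) (M := fun n => M n) ?_ ?_ ?_ ?_ hR).const_mul
      (vdm fun i : Fin k => node G q i))
  · filter_upwards [(eventually_ge_atTop k).prod_inl (𝓝 x),
      (eventually_norm_jk_lt hx hR).prod_inr atTop,
      ((isOpen_punctured k).eventually_mem hx).prod_inr atTop] with a h1 h2 h3
    exact (normalizedChar_eq_altQuot h1 (hlam a.1)
      (fun n hn => hP a.1 n (hn.trans_le h1)) h3 h2).symm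
  · exact fun a n => (P a.1 n).continuous.mul (continuous_lag_finset _ _)
  · exact fun n => (hM n).prod_inl _
  · intro n w _
    refine Tendsto.mul_const _ ?_
    exact (hlim n w).comp (tendsto_fst.prodMk tendsto_const_nhds)
  · exact (analyticAt_jk_comp hx).continuousAt.tendsto.comp tendsto_snd

/-! ### Identification with the determinantal formula. -/

lemma cpow_mul_pow (a : ℂ) (i : ℕ) : (q : ℂ) ^ a * (q : ℂ) ^ i = (q : ℂ) ^ (a + i) := by
  rw [Complex.cpow_add _ _ (by exact_mod_cast (q_pos q).ne'), Complex.cpow_natCast]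

omit hq in
lemma num_jk (r : ℕ) {x : ℂ} (hx : x ≠ 0) :
    num G q r (jk x) = (1 - qe G q r * x) * (1 - qe G q r / x) := by
  rw [num, jk]; field_simp; ring

lemma poch_mul_poch_div (n j : ℕ) {x : ℂ} (hx : x ≠ 0) :
    poch q ((q : ℂ) ^ ((n : ℂ) + eps G) * x) j * poch q ((q : ℂ) ^ ((n : ℂ) + eps G) / x) j =
      ∏ t ∈ Finset.range j, num G q (n + t) (jk x) := by
  rw [poch, poch, ← Finset.prod_mul_distrib]
  refine Finset.prod_congr rfl fun t _ => ?_
  rw [num_jk _ hx, ← cpow_eq_qe, Nat.cast_add, add_right_comm, ← cpow_mul_pow]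
  ring

omit hq in
lemma prod_range_erase {M : Type*} [CommMonoid M] (f : ℕ → M) {k j : ℕ} (hj : j < k) :
    ∏ r ∈ (Finset.range k).erase j, f r =
      (∏ r ∈ Finset.range j, f r) * ∏ t ∈ Finset.range (k - 1 - j), f (j + 1 + t) := by
  have h : (Finset.range k).erase j = Finset.range j ∪ Finset.Ico (j + 1) k := by
    ext r; simp; omega
  rw [h, Finset.prod_union, Finset.prod_Ico_eq_prod_range, Nat.sub_sub, add_comm 1 j]
  rw [Finset.disjoint_left]; intro r; simp; omega

lemma num_node_cpow (r n : ℕ) : num G q r (node G q n) =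
    (1 - (q : ℂ) ^ ((r : ℂ) + n + 2 * eps G)) * (1 - (q : ℂ) ^ ((r : ℂ) - n)) := by
  have hq0 : (q : ℂ) ≠ 0 := by exact_mod_cast (q_pos q).ne'
  rw [num_node]
  push_cast
  rw [← cpow_eq_qe, ← cpow_eq_qe, ← Complex.cpow_add _ _ hq0, ← Complex.cpow_sub _ _ hq0]
  ring_nf

/-- For each j the product over r ≠ j splits into r < j and r > j. The first part gives two of the
Pochhammer symbols at index j, the second the other two at index k - 1 - j; reflecting the outer
product aligns the indices. -/
lemma cConst_eq (k : ℕ) : cConst G q k =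
    ∏ j ∈ Finset.range k, (∏ r ∈ (Finset.range k).erase j, num G q r (node G q j))⁻¹ := by
  rw [cConst, one_div, Finset.prod_inv_distrib]
  congr 1
  have h : ∀ j ∈ Finset.range k, ∏ r ∈ (Finset.range k).erase j, num G q r (node G q j) =
      (poch q ((q : ℂ) ^ ((j : ℂ) + 2 * eps G)) j * poch q ((q : ℂ) ^ (-(j : ℂ))) j) *
      (fun i => poch q q i * poch q ((q : ℂ) ^ (2 * (k : ℂ) - 2 * i - 1 + 2 * eps G)) i)
        (k - 1 - j) := by
    intro j hj
    have hjk := Finset.mem_range.1 hj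
    rw [prod_range_erase _ hjk]
    simp only [poch]
    rw [← Finset.prod_mul_distrib, ← Finset.prod_mul_distrib]
    congr 1
    · refine Finset.prod_congr rfl fun t _ => ?_
      rw [num_node_cpow, cpow_mul_pow, cpow_mul_pow]
      ring_nf
    · refine Finset.prod_congr rfl fun t _ => ?_
      have e : ((k - 1 - j : ℕ) : ℂ) = k - 1 - j := by
        rw [Nat.sub_sub, Nat.cast_sub (by omega)]; push_cast; ring
      have e1 : (q : ℂ) = (q : ℂ) ^ (1 : ℂ) := (Complex.cpow_one _).symm
      rw [num_node_cpow, cpow_mul_pow, e]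
      nth_rewrite 3 [e1]
      rw [cpow_mul_pow]
      push_cast
      ring_nf
  rw [Finset.prod_congr rfl h, Finset.prod_mul_distrib (s := Finset.range k) (g := fun j =>
    (fun i => poch q q i * poch q ((q : ℂ) ^ (2 * (k : ℂ) - 2 * i - 1 + 2 * eps G)) i)
        (k - 1 - j)), Finset.prod_range_reflect (fun i : ℕ => poch q q i *
      poch q ((q : ℂ) ^ (2 * (k : ℂ) - 2 * i - 1 + 2 * eps G)) i), ← Finset.prod_mul_distrib]
  exact Finset.prod_congr rfl fun i _ => by ring

/-- The Pochhammer symbols in column j are the unnormalized numerator of the Lagrange basis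
polynomial, and `cConst` supplies all the normalizations at once. -/
lemma phiLimit_eq_phiDet (hE : ∀ m, Differentiable ℂ (E m)) {x : Fin k → ℂ}
    (hx : x ∈ punctured k) (hV : Vs x ≠ 0) :
    phiLimit G q k E x = phiDet G q (fun m z => E m (jk z)) x := by
  have hinj := Vs_ne_zero_iff.1 hV
  obtain ⟨R, hR⟩ := exists_norm_jk_lt x
  have h1 := altQuot_mul_vdm (fun n : Fin k => differentiable_mul_lag (G := G) (q := q) (k := k)
    hE n) hinj hR
  have h2 : ∀ i j : Fin k, E j (jk (x i)) *
      (poch q ((q : ℂ) ^ (eps G : ℂ) * x i) j * poch q ((q : ℂ) ^ (eps G : ℂ) / x i) j) *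
        (poch q ((q : ℂ) ^ (((j : ℕ) : ℂ) + 1 + eps G) * x i) (k - 1 - j) *
          poch q ((q : ℂ) ^ (((j : ℕ) : ℂ) + 1 + eps G) / x i) (k - 1 - j)) =
      (∏ r ∈ (Finset.range k).erase j, num G q r (node G q j)) *
        (E j (jk (x i)) * lag G q (Finset.range k) j (jk (x i))) := by
    intro i j
    have e1 := poch_mul_poch_div (G := G) (q := q) 0 j (hx i)
    have e2 := poch_mul_poch_div (G := G) (q := q) (j + 1) (k - 1 - j) (hx i)
    simp only [Nat.cast_zero, zero_add] at e1
    push_cast at e2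
    have e3 : ∏ r ∈ (Finset.range k).erase j, num G q r (node G q j) ≠ 0 :=
      Finset.prod_ne_zero_iff.2 fun r hr => num_node_ne_zero (Finset.ne_of_mem_erase hr)
    rw [e1, e2, lag_finset, Finset.prod_div_distrib, prod_range_erase (fun r => num G q r (jk (x i)))
      j.isLt]
    field_simp
  have h3 : ∏ j ∈ Finset.range k, (∏ r ∈ (Finset.range k).erase j, num G q r (node G q j)) ≠ 0 :=
    Finset.prod_ne_zero_iff.2 fun j _ => Finset.prod_ne_zero_iff.2 fun r hr =>
      num_node_ne_zero (Finset.ne_of_mem_erase hr)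
  rw [phiLimit_eq hE hR, phiDet]
  simp only [h2]
  have h4 := Matrix.det_mul_row
    (fun j : Fin k => ∏ r ∈ (Finset.range k).erase j, num G q r (node G q j))
    (Matrix.of fun i j : Fin k => E j (jk (x i)) * lag G q (Finset.range k) j (jk (x i)))
  simp only [Matrix.of_apply] at h4
  rw [h4, ← h1, cConst_eq, Finset.prod_inv_distrib, Vs_eq, Vs_eq x,
    Fin.prod_univ_eq_prod_range
      (fun j => ∏ r ∈ (Finset.range k).erase j, num G q r (node G q j)) k]
  simp only [jk_cpow]
  have h5 := vdm_ne_zero_iff.2 hinj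
  have h6 := vsSign_ne_zero k
  field_simp

end


/-! ### A residue theorem for horizontal strips. -/

open MeasureTheory

/-- The real logarithm and arctangent give a primitive without choosing a branch of the complex
logarithm; over [-R, R] the logarithmic part cancels. -/
lemma integral_inv_add_mul_I {d : ℝ} (hd : d ≠ 0) (R : ℝ) :
    ∫ s in (-R)..R, ((s : ℂ) + d * Complex.I)⁻¹ = -2 * Complex.I * Real.arctan (R / d) := by
  have hne : ∀ s : ℝ, (s : ℂ) + d * Complex.I ≠ 0 := fun s h => hd (by
    have := congrArg Complex.im h; simpa using this)
  have hpos : ∀ s : ℝ, s ^ 2 + d ^ 2 ≠ 0 := fun s => by positivity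
  have h1 : ∀ s : ℝ, HasDerivAt (fun s : ℝ => ((Real.log (s ^ 2 + d ^ 2) / 2 : ℝ) : ℂ) -
      Complex.I * (Real.arctan (s / d) : ℝ)) ((s : ℂ) + d * Complex.I)⁻¹ s := by
    intro s
    have e1 : HasDerivAt (fun s : ℝ => Real.log (s ^ 2 + d ^ 2) / 2) (s / (s ^ 2 + d ^ 2)) s := by
      have := (((hasDerivAt_pow 2 s).add_const (d ^ 2)).log (hpos s)).div_const 2
      refine this.congr_deriv ?_
      have := hpos s
      push_cast
      field_simp
    have e2 : HasDerivAt (fun s : ℝ => Real.arctan (s / d)) (d / (s ^ 2 + d ^ 2)) s := by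
      have := ((hasDerivAt_id s).div_const d).arctan
      refine this.congr_deriv ?_
      have := hpos s
      have h3 : d ^ 2 + s ^ 2 ≠ 0 := by rwa [add_comm]
      simp only [id]
      field_simp
      ring
    refine ((e1.ofReal_comp).sub ((e2.ofReal_comp).const_mul Complex.I)).congr_deriv ?_
    symm
    have h2 : ((s : ℂ) ^ 2 + (d : ℂ) ^ 2) ≠ 0 := by exact_mod_cast hpos s
    push_cast
    rw [inv_eq_iff_eq_inv, ← sub_eq_zero]
    have h3 : (s : ℂ) / (s ^ 2 + d ^ 2) - Complex.I * (d / (s ^ 2 + d ^ 2)) =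
      (s - d * Complex.I) / (s ^ 2 + d ^ 2) := by ring
    have h4 : (s : ℂ) ^ 2 + d ^ 2 = (s + d * Complex.I) * (s - d * Complex.I) := by
      linear_combination (d : ℂ) ^ 2 * Complex.I_sq
    have h5 : (s : ℂ) - d * Complex.I ≠ 0 := fun h => h2 (by rw [h4, h, mul_zero])
    rw [h3, h4, inv_div, mul_div_assoc, div_self h5, mul_one, sub_self]
  rw [intervalIntegral.integral_eq_sub_of_hasDerivAt (fun s _ => h1 s)]
  · rw [neg_div, Real.arctan_neg, neg_sq]
    push_cast
    ring
  · exact (Continuous.inv₀ (by fun_prop) hne).intervalIntegrable _ _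

lemma tendsto_arctan_div {d : ℝ} (hd : d ≠ 0) :
    Tendsto (fun R : ℝ => Real.arctan (R / d)) atTop
      (𝓝 (if 0 < d then Real.pi / 2 else -(Real.pi / 2))) := by
  split_ifs with h
  · exact (Real.tendsto_arctan_atTop.mono_right nhdsWithin_le_nhds).comp
      (tendsto_id.atTop_div_const h)
  · have h' : 0 < -d := by
      rcases lt_or_gt_of_ne hd with h1 | h1
      · linarith
      · exact absurd h1 h
    have := ((Real.tendsto_arctan_atTop.mono_right nhdsWithin_le_nhds).comp
      (tendsto_id.atTop_div_const h')).neg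
    refine this.congr fun R => ?_
    simp only [Function.comp, id, div_neg, Real.arctan_neg, neg_neg]

/-- The residue theorem for a horizontal strip and a function with one simple pole. -/
lemma integral_strip {h : ℝ} (hh : 0 < h) {g ψ : ℂ → ℂ} {p κ : ℂ} (hp : |p.im| ≠ h)
    (hψ : ∀ u : ℂ, |u.im| ≤ h → DifferentiableAt ℂ ψ u)
    (hg : ∀ u : ℂ, |u.im| ≤ h → u ≠ p → g u = ψ u + κ / (u - p))
    {B : ℝ → ℝ} (hB : Tendsto B atTop (𝓝 0))
    (hgB : ∀ u : ℂ, |u.im| ≤ h → u.re ≠ p.re → ‖g u‖ ≤ B |u.re - p.re|)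
    (hi₁ : Integrable fun s : ℝ => g (s - h * Complex.I))
    (hi₂ : Integrable fun s : ℝ => g (s + h * Complex.I)) :
    (∫ s : ℝ, g (s - h * Complex.I)) - (∫ s : ℝ, g (s + h * Complex.I)) =
      if |p.im| < h then 2 * Real.pi * Complex.I * κ else 0 := by
  set a := p.re
  have hd₁ : -h - p.im ≠ 0 := fun e => hp (by
    rw [show p.im = -h by linarith, abs_neg, abs_of_pos hh])
  have hd₂ : h - p.im ≠ 0 := fun e => hp (by
    rw [show p.im = h by linarith, abs_of_pos hh])
  -- The pole is subtracted: its part is integrated explicitly, while the holomorphic remainder ψ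
  -- obeys Cauchy's theorem on rectangles centred at Re p.
  have key : ∀ (d : ℝ), d - p.im ≠ 0 → |d| ≤ h → ∀ R : ℝ,
      ∫ s in (a - R)..(a + R), g (s + d * Complex.I) =
        (∫ s in (a - R)..(a + R), ψ (s + d * Complex.I)) +
          κ * (-2 * Complex.I * Real.arctan (R / (d - p.im))) := by
    intro d hd hdh R
    have him : ∀ s : ℝ, ((s : ℂ) + d * Complex.I).im = d := fun s => by simp
    have hsub : ∀ s : ℝ, (s : ℂ) + d * Complex.I - p =
        ((s - a : ℝ) : ℂ) + ((d - p.im : ℝ) : ℂ) * Complex.I := fun s => by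
      apply Complex.ext <;> simp [a]
    have hne : ∀ s : ℝ, (s : ℂ) + d * Complex.I - p ≠ 0 := fun s e => hd (by
      have := congrArg Complex.im e; simpa using this)
    have h1 : ∀ s : ℝ, g (s + d * Complex.I) = ψ (s + d * Complex.I) +
        κ * ((s : ℂ) + d * Complex.I - p)⁻¹ := fun s => by
      rw [hg _ (by rw [him]; exact hdh) (fun e => hne s (by rw [e, sub_self])), div_eq_mul_inv]
    have hc : Continuous fun s : ℝ => ψ (s + d * Complex.I) :=
      continuous_iff_continuousAt.2 fun s => ContinuousAt.comp (g := ψ)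
        (hψ _ (by rw [him]; exact hdh)).continuousAt (by fun_prop)
    have hc2 : Continuous fun s : ℝ => κ * ((s : ℂ) + d * Complex.I - p)⁻¹ :=
      continuous_const.mul (Continuous.inv₀ (by fun_prop) hne)
    simp only [h1]
    rw [intervalIntegral.integral_add (hc.intervalIntegrable _ _) (hc2.intervalIntegrable _ _),
      intervalIntegral.integral_const_mul]
    congr 2
    simp only [hsub]
    rw [intervalIntegral.integral_comp_sub_right
      (fun s : ℝ => ((s : ℂ) + ((d - p.im : ℝ) : ℂ) * Complex.I)⁻¹) a]
    rw [← integral_inv_add_mul_I hd R]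
    ring_nf
  set S : ℝ → ℂ := fun R =>
    (∫ y in (-h)..h, ψ ((a + R : ℝ) + y * Complex.I)) -
      ∫ y in (-h)..h, ψ ((a - R : ℝ) + y * Complex.I) with hS
  have hrect : ∀ R : ℝ, (∫ s in (a - R)..(a + R), ψ (s + (-h : ℝ) * Complex.I)) -
      (∫ s in (a - R)..(a + R), ψ (s + h * Complex.I)) = -Complex.I * S R := by
    intro R
    have := Complex.integral_boundary_rect_eq_zero_of_differentiableOn ψ
      ⟨a - R, -h⟩ ⟨a + R, h⟩ (fun u hu => (hψ u (by
        have := hu.2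
        simp only [mem_preimage] at this
        rw [uIcc_of_le (by linarith)] at this
        exact abs_le.2 this)).differentiableWithinAt)
    simp only [smul_eq_mul] at this
    simp only [hS]
    linear_combination this
  -- On the vertical sides ψ = g - κ/(u - p), and both terms tend to zero.
  have hside : ∀ (R : ℝ), 0 < R → ‖S R‖ ≤ 4 * h * (B R + ‖κ‖ / R) := by
    intro R hR
    have hb : ∀ ε : ℝ, |ε| = R → ∀ y ∈ Set.uIoc (-h) h,
        ‖ψ ((a + ε : ℝ) + y * Complex.I)‖ ≤ B R + ‖κ‖ / R := by
      intro ε hε y hy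
      rw [uIoc_of_le (by linarith)] at hy
      set u : ℂ := ((a + ε : ℝ) : ℂ) + y * Complex.I with hu
      have hre : u.re - a = ε := by simp [hu]
      have him : |u.im| ≤ h := abs_le.2 (by simp [hu]; exact ⟨hy.1.le, hy.2⟩)
      have hε0 : ε ≠ 0 := fun e => by rw [e, abs_zero] at hε; exact hR.ne hε
      have hrne : u.re ≠ p.re := fun e => hε0 (by rw [← hre, e, sub_self])
      have hune : u ≠ p := fun e => hrne (by rw [e])
      have h1 := hgB u him hrne
      rw [hre, hε] at h1
      have h2 : R ≤ ‖u - p‖ := by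
        have := Complex.abs_re_le_norm (u - p)
        rw [Complex.sub_re, hre, hε] at this
        exact this
      have h3 : ψ u = g u - κ / (u - p) := by rw [hg u him hune]; ring
      rw [h3]
      refine (norm_sub_le _ _).trans (add_le_add h1 ?_)
      rw [norm_div]
      gcongr
    have i1 := intervalIntegral.norm_integral_le_of_norm_le_const (hb R (abs_of_pos hR))
    have i2 := intervalIntegral.norm_integral_le_of_norm_le_const
      (hb (-R) (by rw [abs_neg, abs_of_pos hR]))
    rw [show |h - -h| = 2 * h by rw [sub_neg_eq_add, ← two_mul, abs_of_pos (by linarith)]] at i1 i2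
    simp only [hS]
    refine (norm_sub_le _ _).trans ?_
    simp only [← sub_eq_add_neg] at i2
    linarith
  have hS0 : Tendsto S atTop (𝓝 0) := by
    have h1 : Tendsto (fun R : ℝ => 4 * h * (B R + ‖κ‖ / R)) atTop (𝓝 0) := by
      have := (hB.add (tendsto_const_nhds (x := ‖κ‖).div_atTop tendsto_id)).const_mul (4 * h)
      simpa using this
    refine squeeze_zero_norm' ?_ h1
    filter_upwards [eventually_gt_atTop 0] with R hR using hside R hR
  have hL : Tendsto (fun R : ℝ => -Complex.I * S R +
      (κ * (-2 * Complex.I * Real.arctan (R / (-h - p.im))) -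
        κ * (-2 * Complex.I * Real.arctan (R / (h - p.im))))) atTop
      (𝓝 ((∫ s : ℝ, g (s - h * Complex.I)) - ∫ s : ℝ, g (s + h * Complex.I))) := by
    have h1 : Tendsto (fun R : ℝ => a - R) atTop atBot :=
      tendsto_atBot_add_const_left _ a tendsto_neg_atTop_atBot
    have h2 : Tendsto (fun R : ℝ => a + R) atTop atTop :=
      tendsto_atTop_add_const_left _ a tendsto_id
    refine ((intervalIntegral_tendsto_integral hi₁ h1 h2).sub
      (intervalIntegral_tendsto_integral hi₂ h1 h2)).congr fun R => ?_
    have k1 := key (-h) hd₁ (by rw [abs_neg, abs_of_pos hh]) R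
    have k2 := key h hd₂ (abs_of_pos hh).le R
    have k3 := hrect R
    have e : ∀ s : ℝ, (s : ℂ) - h * Complex.I = s + (-h : ℝ) * Complex.I := fun s => by
      push_cast; ring
    simp only [e]
    rw [k1, k2]
    linear_combination k3
  have hR : Tendsto (fun R : ℝ => -Complex.I * S R +
      (κ * (-2 * Complex.I * Real.arctan (R / (-h - p.im))) -
        κ * (-2 * Complex.I * Real.arctan (R / (h - p.im))))) atTop
      (𝓝 (-Complex.I * 0 +
      (κ * (-2 * Complex.I * ((if 0 < -h - p.im then Real.pi / 2 else -(Real.pi / 2) : ℝ) : ℂ)) -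
        κ * (-2 * Complex.I * ((if 0 < h - p.im then Real.pi / 2 else -(Real.pi / 2) : ℝ) : ℂ))))) :=
    (hS0.const_mul _).add ((((Complex.continuous_ofReal.tendsto _).comp
      (tendsto_arctan_div hd₁)).const_mul _).const_mul _ |>.sub
      ((((Complex.continuous_ofReal.tendsto _).comp
        (tendsto_arctan_div hd₂)).const_mul _).const_mul _))
  rw [tendsto_nhds_unique hL hR]
  -- The arctangents on the two lines have limits of opposite sign exactly when p lies between the
  -- lines; otherwise the two contributions cancel.
  by_cases h1 : |p.im| < h
  · have := abs_lt.1 h1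
    rw [if_pos h1, if_neg (by linarith), if_pos (by linarith)]
    push_cast; ring
  · rw [if_neg h1]
    have h2 : h < |p.im| := lt_of_le_of_ne (not_lt.1 h1) (Ne.symm hp)
    rcases lt_abs.1 h2 with h3 | h3
    · rw [if_neg (by linarith), if_neg (by linarith)]; ring
    · rw [if_pos (by linarith), if_pos (by linarith)]; ring

/-- Integrability of an even function. -/
lemma integrable_comp_abs {f : ℝ → ℝ} (hf : IntegrableOn f (Ioi 0)) :
    Integrable fun s : ℝ => f |s| := by
  have h1 : IntegrableOn (fun s : ℝ => f |s|) (Ioi 0) :=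
    hf.congr_fun (fun s hs => by simp only [abs_of_pos (mem_Ioi.1 hs)]) measurableSet_Ioi
  rw [← integrableOn_univ, ← Iio_union_Ici (a := (0 : ℝ)), integrableOn_union,
    integrableOn_Ici_iff_integrableOn_Ioi]
  refine ⟨?_, h1⟩
  rw [← (Measure.measurePreserving_neg (volume : Measure ℝ)).integrableOn_comp_preimage
      (Homeomorph.neg ℝ).measurableEmbedding]
  simpa [Function.comp_def] using h1

lemma integrable_exp_neg_mul_abs {b : ℝ} (hb : 0 < b) :
    Integrable fun s : ℝ => Real.exp (-b * |s|) :=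
  integrable_comp_abs (f := fun s => Real.exp (-b * s)) (integrableOn_exp_mul_Ioi (by linarith) 0)

lemma integrable_rpow_abs_mul_exp {b : ℝ} (hb : 0 < b) :
    Integrable fun s : ℝ => |s| ^ (-(1 / 2) : ℝ) * Real.exp (-b * |s|) :=
  integrable_comp_abs (f := fun s => s ^ (-(1 / 2) : ℝ) * Real.exp (-b * s)) (by
    simpa using integrableOn_rpow_mul_exp_neg_mul_rpow (s := -(1 / 2)) (p := 1) (by norm_num)
      one_pos hb)


/-! ### Contour integrals regularized by a Gaussian factor. -/

open MeasureTheory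

/-- Rotating by e^(-i Im w) makes the first term real, so the imaginary part comes from the second
alone. -/
lemma abs_sin_le_norm_exp_sub_one (w : ℂ) : |Real.sin w.im| ≤ ‖Complex.exp w - 1‖ := by
  have h1 : ‖Complex.exp w - 1‖ =
      ‖(Complex.exp w - 1) * Complex.exp ((-w.im : ℝ) * Complex.I)‖ := by
    rw [norm_mul, Complex.norm_exp_ofReal_mul_I, mul_one]
  have h2 : (Complex.exp w - 1) * Complex.exp ((-w.im : ℝ) * Complex.I) =
      (Real.exp w.re : ℝ) - Complex.exp ((-w.im : ℝ) * Complex.I) := by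
    rw [sub_mul, one_mul, ← Complex.exp_add, Complex.ofReal_exp]
    congr 2
    apply Complex.ext <;> simp
  rw [h1, h2]
  refine le_trans (le_of_eq ?_) (Complex.abs_im_le_norm _)
  rw [Complex.sub_im, Complex.ofReal_im, Complex.exp_ofReal_mul_I_im, Real.sin_neg]
  simp

lemma abs_exp_re_sub_one_le (w : ℂ) : |Real.exp w.re - 1| ≤ ‖Complex.exp w - 1‖ := by
  have := abs_norm_sub_norm_le (Complex.exp w) 1
  rwa [Complex.norm_exp, norm_one] at this

lemma one_sub_exp_neg_abs_le (x : ℝ) : 1 - Real.exp (-|x|) ≤ |Real.exp x - 1| := by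
  rcases le_total 0 x with h | h
  · rw [abs_of_nonneg h, abs_of_nonneg (by linarith [Real.add_one_le_exp x])]
    have := Real.exp_pos x
    have h2 : Real.exp x * Real.exp (-x) = 1 := by rw [← Real.exp_add]; simp
    nlinarith [sq_nonneg (Real.exp x - 1), Real.exp_pos (-x)]
  · rw [abs_of_nonpos h, neg_neg, abs_sub_comm]
    exact le_abs_self _

/-- Completing the square in (‖c‖ + 1)|Re u| - δ|Re u|²; the extra 1 leaves the decaying
exponential. -/
lemma norm_gauss_le (c : ℂ) {δ : ℝ} (hδ : 0 < δ) (h : ℝ) : ∃ C > 0, ∀ u : ℂ, |u.im| ≤ h →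
    ‖Complex.exp (c * u - δ * u ^ 2)‖ ≤ C * Real.exp (-|u.re|) := by
  refine ⟨Real.exp (‖c‖ * h + δ * h ^ 2 + (‖c‖ + 1) ^ 2 / (4 * δ)), Real.exp_pos _, fun u hu => ?_⟩
  rw [Complex.norm_exp, ← Real.exp_add, Real.exp_le_exp]
  have h1 : (c * u).re ≤ ‖c‖ * (|u.re| + h) := by
    refine (Complex.re_le_norm _).trans ?_
    rw [norm_mul]
    have := Complex.norm_le_abs_re_add_abs_im u
    gcongr
    linarith
  have h2 : ((δ : ℂ) * u ^ 2).re = δ * (|u.re| ^ 2 - |u.im| ^ 2) := by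
    rw [sq_abs, sq_abs, Complex.re_ofReal_mul]
    congr 1
    rw [pow_two, Complex.mul_re]; ring
  have h3 : |u.im| ^ 2 ≤ h ^ 2 := pow_le_pow_left₀ (abs_nonneg _) hu 2
  have h4 : 0 ≤ δ * (|u.re| - (‖c‖ + 1) / (2 * δ)) ^ 2 := by positivity
  have h5 : δ * (|u.re| - (‖c‖ + 1) / (2 * δ)) ^ 2 =
      δ * |u.re| ^ 2 - (‖c‖ + 1) * |u.re| + (‖c‖ + 1) ^ 2 / (4 * δ) := by
    field_simp; ring
  rw [Complex.sub_re, h2]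
  nlinarith

/-- Integrability along the two lines of `contourIntegral`. -/
def LineIntegrable (q : ℝ) (f : ℂ → ℂ) : Prop :=
  (Integrable fun s : ℝ => f (s + (Real.pi / (2 * Real.log q) : ℝ) * Complex.I)) ∧
    Integrable fun s : ℝ => f (s - (Real.pi / (2 * Real.log q) : ℝ) * Complex.I)

/-- The points of the two lines of `contourIntegral`. -/
def onLines (q : ℝ) (u : ℂ) : Prop :=
  u.im = Real.pi / (2 * Real.log q) ∨ u.im = -(Real.pi / (2 * Real.log q))

lemma re_add_ofReal_mul_I (s d : ℝ) : ((s : ℂ) + (d : ℝ) * Complex.I).re = s := by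
  rw [Complex.add_re, Complex.ofReal_re, Complex.re_ofReal_mul, Complex.I_re, mul_zero, add_zero]

lemma re_sub_ofReal_mul_I (s d : ℝ) : ((s : ℂ) - (d : ℝ) * Complex.I).re = s := by
  rw [Complex.sub_re, Complex.ofReal_re, Complex.re_ofReal_mul, Complex.I_re, mul_zero, sub_zero]

lemma onLines_add (q s : ℝ) :
    onLines q (s + (Real.pi / (2 * Real.log q) : ℝ) * Complex.I) := by
  left; simp only [Complex.add_im, Complex.ofReal_im, Complex.im_ofReal_mul, Complex.I_im]; ring

lemma onLines_sub (q s : ℝ) :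
    onLines q (s - (Real.pi / (2 * Real.log q) : ℝ) * Complex.I) := by
  right; simp only [Complex.sub_im, Complex.ofReal_im, Complex.im_ofReal_mul, Complex.I_im]; ring

section

variable {q : ℝ} {f g : ℂ → ℂ}

lemma LineIntegrable.add (hf : LineIntegrable q f) (hg : LineIntegrable q g) :
    LineIntegrable q fun u => f u + g u := ⟨hf.1.add hg.1, hf.2.add hg.2⟩

lemma LineIntegrable.const_mul (c : ℂ) (hf : LineIntegrable q f) :
    LineIntegrable q fun u => c * f u := ⟨hf.1.const_mul c, hf.2.const_mul c⟩

lemma LineIntegrable.sum {ι : Type*} (s : Finset ι) {f : ι → ℂ → ℂ}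
    (hf : ∀ i ∈ s, LineIntegrable q (f i)) : LineIntegrable q fun u => ∑ i ∈ s, f i u :=
  ⟨integrable_finsetSum s fun i hi => (hf i hi).1, integrable_finsetSum s fun i hi => (hf i hi).2⟩

lemma contourIntegral_congr (h : ∀ u, onLines q u → f u = g u) :
    contourIntegral q f = contourIntegral q g := by
  simp only [contourIntegral, h _ (onLines_add q _), h _ (onLines_sub q _)]

lemma LineIntegrable.congr (hf : LineIntegrable q f) (h : ∀ u, onLines q u → f u = g u) :
    LineIntegrable q g := by
  refine ⟨hf.1.congr (Eventually.of_forall fun s => ?_),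
    hf.2.congr (Eventually.of_forall fun s => ?_)⟩
  · exact h _ (onLines_add q s)
  · exact h _ (onLines_sub q s)

lemma contourIntegral_add (hf : LineIntegrable q f) (hg : LineIntegrable q g) :
    contourIntegral q (fun u => f u + g u) = contourIntegral q f + contourIntegral q g := by
  rw [contourIntegral, integral_add hf.1 hg.1, integral_add hf.2 hg.2, contourIntegral,
    contourIntegral]
  ring

lemma contourIntegral_sub (hf : LineIntegrable q f) (hg : LineIntegrable q g) :
    contourIntegral q (fun u => f u - g u) = contourIntegral q f - contourIntegral q g := by
  rw [contourIntegral, integral_sub hf.1 hg.1, integral_sub hf.2 hg.2, contourIntegral,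
    contourIntegral]
  ring

lemma contourIntegral_const_mul (c : ℂ) (f : ℂ → ℂ) :
    contourIntegral q (fun u => c * f u) = c * contourIntegral q f := by
  rw [contourIntegral, integral_const_mul, integral_const_mul, contourIntegral]
  ring

lemma contourIntegral_sum {ι : Type*} (s : Finset ι) {f : ι → ℂ → ℂ}
    (hf : ∀ i ∈ s, LineIntegrable q (f i)) :
    contourIntegral q (fun u => ∑ i ∈ s, f i u) = ∑ i ∈ s, contourIntegral q (f i) := by
  simp only [contourIntegral]
  rw [integral_finsetSum s fun i hi => (hf i hi).1, integral_finsetSum s fun i hi => (hf i hi).2,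
    ← Finset.sum_sub_distrib, Finset.mul_sum]

end

section

variable {q : ℝ} [hq : Fact (0 < q ∧ q < 1)]

/-- On the two lines ln q · Im u = ±π/2, which turns the sine into a cosine of p alone: the bound is
uniform in Re u. -/
lemma abs_cos_le_norm_exp_sub_one {u : ℂ} (hu : onLines q u) (p : ℂ) :
    |Real.cos (Real.log q * p.im)| ≤ ‖Complex.exp (Real.log q * (u - p)) - 1‖ := by
  have hL := (log_q_neg q).ne
  refine le_trans (le_of_eq ?_) (abs_sin_le_norm_exp_sub_one _)
  rw [Complex.im_ofReal_mul, Complex.sub_im, mul_sub]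
  rcases hu with h | h
  · rw [h, show Real.log q * (Real.pi / (2 * Real.log q)) = Real.pi / 2 by field_simp,
      Real.sin_pi_div_two_sub]
  · rw [h, show Real.log q * -(Real.pi / (2 * Real.log q)) = -(Real.pi / 2) by field_simp,
      show -(Real.pi / 2) - Real.log q * p.im = -(Real.pi / 2 + Real.log q * p.im) by ring,
      Real.sin_neg, add_comm, Real.sin_add_pi_div_two, abs_neg]

lemma abs_im_of_onLines {u : ℂ} (hu : onLines q u) : |u.im| = -(Real.pi / (2 * Real.log q)) := by
  have h1 : Real.pi / (2 * Real.log q) ≤ 0 :=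
    div_nonpos_of_nonneg_of_nonpos Real.pi_pos.le (by linarith [log_q_neg q])
  rcases hu with h | h
  · rw [h, abs_of_nonpos h1]
  · rw [h, abs_neg, abs_of_nonpos h1]

lemma lineIntegrable_gauss (c p : ℂ) {δ : ℝ} (hδ : 0 < δ)
    (hp : Real.cos (Real.log q * p.im) ≠ 0) :
    LineIntegrable q fun u => Complex.exp (c * u - δ * u ^ 2) /
      (Complex.exp (Real.log q * (u - p)) - 1) := by
  obtain ⟨C, hC, hgauss⟩ := norm_gauss_le c hδ (-(Real.pi / (2 * Real.log q)))
  have hb : ∀ u, onLines q u → ‖Complex.exp (c * u - δ * u ^ 2) /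
      (Complex.exp (Real.log q * (u - p)) - 1)‖ ≤
        C / |Real.cos (Real.log q * p.im)| * Real.exp (-1 * |u.re|) := by
    intro u hu
    have h1 := hgauss u (abs_im_of_onLines hu).le
    have h2 := abs_cos_le_norm_exp_sub_one hu p
    have h3 : 0 < |Real.cos (Real.log q * p.im)| := abs_pos.2 hp
    rw [norm_div, neg_one_mul, div_mul_eq_mul_div]
    gcongr
  have hne : ∀ u, onLines q u → Complex.exp (Real.log q * (u - p)) - 1 ≠ 0 := fun u hu =>
    norm_pos_iff.1 ((abs_pos.2 hp).trans_le (abs_cos_le_norm_exp_sub_one hu p))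
  have hint := (integrable_exp_neg_mul_abs one_pos).const_mul (C / |Real.cos (Real.log q * p.im)|)
  constructor
  · refine hint.mono' (Continuous.div (by fun_prop) (by fun_prop)
      fun s => hne _ (onLines_add q s)).aestronglyMeasurable (Eventually.of_forall fun s => ?_)
    have := hb _ (onLines_add q s)
    rwa [re_add_ofReal_mul_I] at this
  · refine hint.mono' (Continuous.div (by fun_prop) (by fun_prop)
      fun s => hne _ (onLines_sub q s)).aestronglyMeasurable (Eventually.of_forall fun s => ?_)
    have := hb _ (onLines_sub q s)
    rwa [re_sub_ofReal_mul_I] at this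

/-- Since ln q < 0, the line directed to the right is the lower one, so the contour is positively
oriented. The poles are the translates of p by the period of q^u; the hypotheses exclude poles on
the lines and leave p as the only candidate inside. -/
lemma contourIntegral_gauss (c p : ℂ) {δ : ℝ} (hδ : 0 < δ)
    (hp : Real.cos (Real.log q * p.im) ≠ 0) (hp2 : |Real.log q * p.im| ≤ Real.pi) :
    contourIntegral q (fun u => Complex.exp (c * u - δ * u ^ 2) /
      (Complex.exp (Real.log q * (u - p)) - 1)) =
        if |Real.log q * p.im| < Real.pi / 2 then
          Complex.exp (c * p - δ * p ^ 2) / Real.log q else 0 := by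
  have hL := log_q_neg q
  have hLc : (Real.log q : ℂ) ≠ 0 := by exact_mod_cast hL.ne
  have hpi := Real.pi_pos
  set h : ℝ := -(Real.pi / (2 * Real.log q)) with hh
  have hh0 : 0 < h := by
    rw [hh, Left.neg_pos_iff]
    exact div_neg_of_pos_of_neg hpi (by linarith)
  have hLh : |Real.log q| * h = Real.pi / 2 := by
    rw [abs_of_neg hL, hh]; have := hL.ne; field_simp
  have hL0 : 0 < |Real.log q| := abs_pos.2 hL.ne
  have hiff : |Real.log q * p.im| < Real.pi / 2 ↔ |p.im| < h := by
    rw [abs_mul, ← hLh]; exact mul_lt_mul_iff_right₀ hL0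
  have hpne : |p.im| ≠ h := by
    intro e
    apply hp
    rw [← Real.cos_abs, abs_mul, e, hLh, Real.cos_pi_div_two]
  have hp2' : |p.im| ≤ 2 * h := by
    rw [abs_mul] at hp2
    refine le_of_mul_le_mul_left (hp2.trans ?_) hL0
    linarith
  set E : ℂ → ℂ := fun u => Complex.exp (c * u - δ * u ^ 2) with hE
  -- The period has length 4h, so p is the only pole in S. As |Im p| ≤ 2h, S contains the whole
  -- closed strip.
  set S : Set ℂ := {u | |(u - p).im| < 4 * h} with hS
  have hSo : IsOpen S := isOpen_lt (by fun_prop) continuous_const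
  have hpS : p ∈ S := by simp [hS, hh0]
  set D : ℂ → ℂ := dslope (fun u => Complex.exp (Real.log q * (u - p))) p with hD
  have hDne : ∀ u, u ≠ p → D u = (Complex.exp (Real.log q * (u - p)) - 1) / (u - p) := by
    intro u hu
    rw [hD, dslope_of_ne _ hu, slope_def_field]
    simp
  have hDp : D p = Real.log q := by
    rw [hD, dslope_same]
    have : HasDerivAt (fun u => Complex.exp (Real.log q * (u - p)))
        (Complex.exp (Real.log q * (p - p)) * (Real.log q * 1)) p :=
      (((hasDerivAt_id p).sub_const p).const_mul (Real.log q : ℂ)).cexp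
    rw [this.deriv]; simp
  have hexp : ∀ u ∈ S, u ≠ p → Complex.exp (Real.log q * (u - p)) - 1 ≠ 0 := by
    intro u hu hup e
    obtain ⟨n, hn⟩ := Complex.exp_eq_one_iff.1 (sub_eq_zero.1 e)
    have h1 : Real.log q * (u - p).im = n * (2 * Real.pi) := by
      have := congrArg Complex.im hn
      simpa using this
    have h2 : |Real.log q * (u - p).im| < 2 * Real.pi := by
      rw [abs_mul]
      calc _ < |Real.log q| * (4 * h) := mul_lt_mul_of_pos_left hu hL0
        _ = 2 * Real.pi := by linarith
    rw [h1, abs_mul, abs_of_pos (by linarith : 0 < 2 * Real.pi)] at h2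
    have h3 : |(n : ℝ)| < 1 := by
      by_contra h3
      have := mul_le_mul_of_nonneg_right (not_lt.1 h3) (by linarith : 0 ≤ 2 * Real.pi)
      linarith
    have h4 : n = 0 := by
      rw [← Int.abs_lt_one_iff]; exact_mod_cast h3
    rw [h4] at hn
    simp [hLc, sub_eq_zero, hup] at hn
  have hD0 : ∀ u ∈ S, D u ≠ 0 := by
    intro u hu
    by_cases hup : u = p
    · rw [hup, hDp]; exact hLc
    · rw [hDne u hup]; exact div_ne_zero (hexp u hu hup) (sub_ne_zero.2 hup)
  have hDd : DifferentiableOn ℂ D S :=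
    (Complex.differentiableOn_dslope (hSo.mem_nhds hpS)).2 (by fun_prop)
  have hψd : DifferentiableOn ℂ (dslope (fun u => E u / D u) p) S :=
    (Complex.differentiableOn_dslope (hSo.mem_nhds hpS)).2
      (DifferentiableOn.div (by simp only [hE]; fun_prop) hDd hD0)
  have hstripS : ∀ u : ℂ, |u.im| ≤ h → u ∈ S := fun u hu => by
    have := abs_sub u.im p.im
    simp only [hS, mem_ofPred_eq, Complex.sub_im]
    linarith
  obtain ⟨C, hC, hgauss⟩ := norm_gauss_le c hδ h
  have hLI := lineIntegrable_gauss c p hδ hp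
  have key := integral_strip hh0 (g := fun u => E u / (Complex.exp (Real.log q * (u - p)) - 1))
    (ψ := dslope (fun u => E u / D u) p) (p := p) (κ := E p / Real.log q)
    (B := fun R => C * Real.exp |p.re| * Real.exp (-R) / (1 - Real.exp (Real.log q * R))) hpne
    (fun u hu => (hψd u (hstripS u hu)).differentiableAt (hSo.mem_nhds (hstripS u hu)))
    (fun u hu hup => by
      have h1 := hexp u (hstripS u hu) hup
      have h2 := sub_ne_zero.2 hup
      rw [dslope_of_ne _ hup, slope_def_field, hDne u hup, hDp]
      field_simp
      ring)
    (by
      have h1 : Tendsto (fun R : ℝ => Real.exp (-R)) atTop (𝓝 0) :=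
        Real.tendsto_exp_atBot.comp tendsto_neg_atTop_atBot
      have h2 : Tendsto (fun R : ℝ => Real.exp (Real.log q * R)) atTop (𝓝 0) :=
        Real.tendsto_exp_atBot.comp (tendsto_id.const_mul_atTop_of_neg hL)
      have := (h1.const_mul (C * Real.exp |p.re|)).div
        ((tendsto_const_nhds (x := (1 : ℝ))).sub h2) (by norm_num)
      rw [mul_zero, zero_div] at this
      exact this)
    (fun u hu hre => by
      have h1 := hgauss u hu
      have hR : 0 < |u.re - p.re| := abs_pos.2 (sub_ne_zero.2 hre)
      have h2 : 1 - Real.exp (Real.log q * |u.re - p.re|) ≤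
          ‖Complex.exp (Real.log q * (u - p)) - 1‖ := by
        refine le_trans ?_ ((one_sub_exp_neg_abs_le _).trans (abs_exp_re_sub_one_le _))
        rw [Complex.re_ofReal_mul, Complex.sub_re, abs_mul, abs_of_neg hL, neg_mul, neg_neg]
      have h3 : 0 < 1 - Real.exp (Real.log q * |u.re - p.re|) := by
        rw [sub_pos, Real.exp_lt_one_iff]; exact mul_neg_of_neg_of_pos hL hR
      have h4 : Real.exp (-|u.re|) ≤ Real.exp |p.re| * Real.exp (-|u.re - p.re|) := by
        rw [← Real.exp_add, Real.exp_le_exp]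
        linarith [abs_sub u.re p.re]
      rw [norm_div]
      gcongr
      rw [mul_assoc]
      exact h1.trans (mul_le_mul_of_nonneg_left h4 hC.le))
    (hLI.1.congr (Eventually.of_forall fun s => by simp only [hh, hE]; push_cast; ring_nf))
    (hLI.2.congr (Eventually.of_forall fun s => by simp only [hh, hE]; push_cast; ring_nf))
  have e1 : ∀ s : ℝ, (s : ℂ) + (Real.pi / (2 * Real.log q) : ℝ) * Complex.I = s - h * Complex.I :=
    fun s => by rw [hh]; push_cast; ring
  have e2 : ∀ s : ℝ, (s : ℂ) - (Real.pi / (2 * Real.log q) : ℝ) * Complex.I = s + h * Complex.I :=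
    fun s => by rw [hh]; push_cast; ring
  rw [contourIntegral]
  simp only [e1, e2]
  rw [key]
  simp only [hiff]
  have hpic : (Real.pi : ℂ) ≠ 0 := by exact_mod_cast hpi.ne'
  have hI := Complex.I_ne_zero
  split_ifs
  · simp only [hE]; field_simp
  · simp

end


/-! ### The symmetrized kernel and its partial fractions. -/

open MeasureTheory

/-- The numerator of the symmetrized kernel. -/
def kap (G : ClassicalType) (c : ℂ) : ℂ :=
  match G with
  | .B => Complex.exp (c / 2) + Complex.exp (-(c / 2))
  | .C => 1
  | .D => Complex.exp c - Complex.exp (-c)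

/-- Exponents in the partial fraction decomposition of the symmetrized kernel. -/
def pfExp : ClassicalType → ℂ × ℂ
  | .B => (1 / 2, 1 / 2)
  | .C => (0, 0)
  | .D => (1, 0)

lemma ch_sub_ch (w p : ℂ) : ch w - ch p =
    Complex.exp (-w) * ((Complex.exp (w - p) - 1) * (Complex.exp (w + p) - 1)) := by
  have hw := Complex.exp_ne_zero w
  have hp := Complex.exp_ne_zero p
  simp only [ch, Complex.exp_neg, Complex.exp_sub, Complex.exp_add]
  field_simp
  ring

lemma ch_sub_ch_ne_zero {w p : ℂ} (h₁ : Complex.exp (w - p) - 1 ≠ 0)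
    (h₂ : Complex.exp (w + p) - 1 ≠ 0) : ch w - ch p ≠ 0 := by
  rw [ch_sub_ch]
  exact mul_ne_zero (Complex.exp_ne_zero _) (mul_ne_zero h₁ h₂)

/-- Partial fractions separating the poles w = p and w = -p, in the exponential form to which
`contourIntegral_gauss` applies term by term. -/
lemma den_mul_kap_div (G : ClassicalType) {w p : ℂ} (h₁ : Complex.exp (w - p) - 1 ≠ 0)
    (h₂ : Complex.exp (w + p) - 1 ≠ 0) :
    den G p * (kap G w / (ch w - ch p)) =
      Complex.exp ((pfExp G).1 * (w - p)) / (Complex.exp (w - p) - 1) +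
        sgn G * (Complex.exp ((pfExp G).2 * (w + p)) / (Complex.exp (w + p) - 1)) := by
  rw [ch_sub_ch]
  have e1 : w - p = w / 2 + w / 2 - (p / 2 + p / 2) := by ring
  have e2 : w + p = w / 2 + w / 2 + (p / 2 + p / 2) := by ring
  have e3 : w = w / 2 + w / 2 := by ring
  have e4 : p = p / 2 + p / 2 := by ring
  have hx := Complex.exp_ne_zero (w / 2)
  have hy := Complex.exp_ne_zero (p / 2)
  cases G
  · have e5 : (1 : ℂ) / 2 * (w - p) = w / 2 - p / 2 := by ring
    have e6 : (1 : ℂ) / 2 * (w + p) = w / 2 + p / 2 := by ring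
    simp only [den, kap, pfExp, sgn, e5, e6]
    simp only [e1, e2, Complex.exp_neg, Complex.exp_sub, Complex.exp_add] at h₁ h₂ ⊢
    rw [e3]
    simp only [Complex.exp_add]
    rw [show (w / 2 + w / 2) / 2 = w / 2 by ring]
    set x := Complex.exp (w / 2)
    set y := Complex.exp (p / 2)
    obtain ⟨d₁, hd₁⟩ : ∃ d, d = x * x - y * y := ⟨_, rfl⟩
    obtain ⟨d₂, hd₂⟩ : ∃ d, d = x * x * (y * y) - 1 := ⟨_, rfl⟩
    rw [show x * x / (y * y) - 1 = d₁ / (y * y) by rw [hd₁]; field_simp] at h₁ ⊢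
    rw [← hd₂] at h₂ ⊢
    have g1 : d₁ ≠ 0 := fun h => h₁ (by rw [h, zero_div])
    field_simp
    rw [hd₁, hd₂]
    ring
  · simp only [den, kap, pfExp, sgn, zero_mul, Complex.exp_zero]
    rw [e3, e4]
    simp only [e1, e2, Complex.exp_neg, Complex.exp_sub, Complex.exp_add] at h₁ h₂ ⊢
    set x := Complex.exp (w / 2)
    set y := Complex.exp (p / 2)
    obtain ⟨d₁, hd₁⟩ : ∃ d, d = x * x - y * y := ⟨_, rfl⟩
    obtain ⟨d₂, hd₂⟩ : ∃ d, d = x * x * (y * y) - 1 := ⟨_, rfl⟩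
    rw [show x * x / (y * y) - 1 = d₁ / (y * y) by rw [hd₁]; field_simp] at h₁ ⊢
    rw [← hd₂] at h₂ ⊢
    have g1 : d₁ ≠ 0 := fun h => h₁ (by rw [h, zero_div])
    field_simp
    rw [hd₁, hd₂]
    ring
  · simp only [den, kap, pfExp, sgn, zero_mul, Complex.exp_zero, one_mul]
    rw [e3, e4]
    simp only [e1, e2, Complex.exp_neg, Complex.exp_sub, Complex.exp_add] at h₁ h₂ ⊢
    set x := Complex.exp (w / 2)
    set y := Complex.exp (p / 2)
    obtain ⟨d₁, hd₁⟩ : ∃ d, d = x * x - y * y := ⟨_, rfl⟩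
    obtain ⟨d₂, hd₂⟩ : ∃ d, d = x * x * (y * y) - 1 := ⟨_, rfl⟩
    rw [show x * x / (y * y) - 1 = d₁ / (y * y) by rw [hd₁]; field_simp] at h₁ ⊢
    rw [← hd₂] at h₂ ⊢
    have g1 : d₁ ≠ 0 := fun h => h₁ (by rw [h, zero_div])
    field_simp
    rw [hd₁, hd₂]
    ring

section

variable {G : ClassicalType} {q : ℝ} [hq : Fact (0 < q ∧ q < 1)]

lemma cpow_eq_exp (a : ℂ) : (q : ℂ) ^ a = Complex.exp (Real.log q * a) := by
  rw [Complex.cpow_def_of_ne_zero (by exact_mod_cast (q_pos q).ne'), ← Complex.ofReal_log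
    (q_pos q).le]

lemma exp_sub_one_ne_zero {u p : ℂ} (hu : onLines q u) (hp : Real.cos (Real.log q * p.im) ≠ 0) :
    Complex.exp (Real.log q * (u - p)) - 1 ≠ 0 :=
  norm_pos_iff.1 ((abs_pos.2 hp).trans_le (abs_cos_le_norm_exp_sub_one hu p))

lemma exp_log_sub_ne_zero {u p : ℂ} (hu : onLines q u)
    (hp : Real.cos (Real.log q * p.im) ≠ 0) :
    Complex.exp (Real.log q * u - Real.log q * p) - 1 ≠ 0 := by
  rw [← mul_sub]; exact exp_sub_one_ne_zero hu hp

lemma exp_log_add_ne_zero {u p : ℂ} (hu : onLines q u)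
    (hp : Real.cos (Real.log q * p.im) ≠ 0) :
    Complex.exp (Real.log q * u + Real.log q * p) - 1 ≠ 0 := by
  have := exp_log_sub_ne_zero (p := -p) hu (by simpa using hp)
  simpa using this

/-- The poles p and -p lie inside the contour together or not at all. Their residues combine into
the numerator of Weyl's formula, which for p = β + ε is the Weyl denominator times W_β. -/
lemma lineIntegrable_contourIntegral_kap (G : ClassicalType) (c p : ℂ) {δ : ℝ} (hδ : 0 < δ)
    (hp : Real.cos (Real.log q * p.im) ≠ 0) (hp2 : |Real.log q * p.im| ≤ Real.pi) :
    (LineIntegrable q fun u => Complex.exp (c * u - δ * u ^ 2) *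
      (den G (Real.log q * p) * (kap G (Real.log q * u) /
        (ch (Real.log q * u) - ch (Real.log q * p))))) ∧
    contourIntegral q (fun u => Complex.exp (c * u - δ * u ^ 2) *
      (den G (Real.log q * p) * (kap G (Real.log q * u) /
        (ch (Real.log q * u) - ch (Real.log q * p))))) =
      if |Real.log q * p.im| < Real.pi / 2 then
        (Complex.exp (c * p) + sgn G * Complex.exp (-(c * p))) * Complex.exp (-δ * p ^ 2) /
          Real.log q else 0 := by
  set L : ℂ := ((Real.log q : ℝ) : ℂ)
  set a := (pfExp G).1
  set b := (pfExp G).2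
  have hpn : Real.cos (Real.log q * (-p).im) ≠ 0 := by simpa using hp
  have hpn2 : |Real.log q * (-p).im| ≤ Real.pi := by simpa using hp2
  set f : ℂ → ℂ := fun u => Complex.exp (-(a * L * p)) *
    (Complex.exp ((c + a * L) * u - δ * u ^ 2) / (Complex.exp (L * (u - p)) - 1)) with hf
  set g : ℂ → ℂ := fun u => sgn G * Complex.exp (b * L * p) *
    (Complex.exp ((c + b * L) * u - δ * u ^ 2) / (Complex.exp (L * (u - -p)) - 1)) with hg
  have hfi : LineIntegrable q f := (lineIntegrable_gauss _ p hδ hp).const_mul _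
  have hgi : LineIntegrable q g := (lineIntegrable_gauss _ (-p) hδ hpn).const_mul _
  have hfg : ∀ u, onLines q u → f u + g u = Complex.exp (c * u - δ * u ^ 2) *
      (den G (L * p) * (kap G (L * u) / (ch (L * u) - ch (L * p)))) := by
    intro u hu
    rw [den_mul_kap_div G (exp_log_sub_ne_zero hu hp) (exp_log_add_ne_zero hu hp)]
    simp only [hf, hg]
    rw [show (c + a * L) * u - δ * u ^ 2 = (c * u - δ * u ^ 2) + a * L * u by ring,
      show (c + b * L) * u - δ * u ^ 2 = (c * u - δ * u ^ 2) + b * L * u by ring,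
      show L * (u - p) = L * u - L * p by ring, show L * (u - -p) = L * u + L * p by ring,
      show (pfExp G).1 * (L * u - L * p) = a * L * u + -(a * L * p) by ring,
      show (pfExp G).2 * (L * u + L * p) = b * L * u + b * L * p by ring]
    simp only [Complex.exp_add]
    ring
  refine ⟨(hfi.add hgi).congr hfg, ?_⟩
  rw [← contourIntegral_congr hfg, contourIntegral_add hfi hgi, contourIntegral_const_mul,
    contourIntegral_const_mul, contourIntegral_gauss _ p hδ hp hp2,
    contourIntegral_gauss _ (-p) hδ hpn hpn2]
  rw [show |Real.log q * (-p).im| = |Real.log q * p.im| by simp]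
  split_ifs with h
  · rw [show (c + a * L) * p - δ * p ^ 2 = c * p + a * L * p + -δ * p ^ 2 by ring,
      show (c + b * L) * -p - δ * (-p) ^ 2 = -(c * p) + -(b * L * p) + -δ * p ^ 2 by ring]
    simp only [Complex.exp_add]
    have h1 : Complex.exp (-(a * L * p)) * Complex.exp (a * L * p) = 1 := by
      rw [← Complex.exp_add]; simp
    have h2 : Complex.exp (-(b * L * p)) * Complex.exp (b * L * p) = 1 := by
      rw [← Complex.exp_add]; simp
    linear_combination (Complex.exp (c * p) * Complex.exp (-δ * p ^ 2) / L) * h1 +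
      (sgn G * Complex.exp (-(c * p)) * Complex.exp (-δ * p ^ 2) / L) * h2
  · simp

/-- `∏_r num_r(Z) / num_r(S)`. -/
def numRatio (G : ClassicalType) (q : ℝ) (s : Finset ℕ) (S Z : ℂ) : ℂ :=
  ∏ r ∈ s, num G q r Z / num G q r S

/-- Partial fractions in S: the residue at S = Z is 1, and at S = node β it is minus the Lagrange
basis polynomial at Z. This is how interpolation enters the integral formula. -/
lemma numRatio_div_sub {s : Finset ℕ} (hs : s.Nonempty) {S Z : ℂ} (hS : ∀ r ∈ s, S ≠ node G q r)
    (hZ : ∀ r ∈ s, Z ≠ node G q r) (hSZ : S - Z ≠ 0) :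
    numRatio G q s S Z / (S - Z) = 1 / (S - Z) - ∑ β ∈ s, lag G q s β Z / (S - node G q β) := by
  have hinj := (node_injective (G := G) (q := q)).injOn (s := (s : Set ℕ))
  set w := Lagrange.nodalWeight s (node G q)
  have h1 : ∀ X, (∀ r ∈ s, X ≠ node G q r) →
      (Lagrange.nodal s (node G q)).eval X * ∑ i ∈ s, w i * (X - node G q i)⁻¹ = 1 := by
    intro X hX
    have := Lagrange.eval_interpolate_not_at_node (s := s) (v := node G q) 1 hX
    rw [Lagrange.interpolate_one hinj hs, Polynomial.eval_one] at this
    simpa using this.symm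
  have hn : ∀ X, (∀ r ∈ s, X ≠ node G q r) → (Lagrange.nodal s (node G q)).eval X ≠ 0 :=
    fun X hX => left_ne_zero_of_mul_eq_one (h1 X hX)
  have h2 : numRatio G q s S Z = (Lagrange.nodal s (node G q)).eval Z /
      (Lagrange.nodal s (node G q)).eval S := by
    rw [numRatio, Lagrange.eval_nodal, Lagrange.eval_nodal, ← Finset.prod_div_distrib]
    refine Finset.prod_congr rfl fun r hr => ?_
    have h3 := qe_ne_zero (G := G) (q := q) r
    have h4 := sub_ne_zero.2 (hS r hr)
    rw [num_eq, num_eq]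
    field_simp
  have h3 : ∑ β ∈ s, lag G q s β Z / (S - node G q β) =
      (Lagrange.nodal s (node G q)).eval Z * ((∑ β ∈ s, w β * (Z - node G q β)⁻¹ -
        ∑ β ∈ s, w β * (S - node G q β)⁻¹) / (S - Z)) := by
    rw [← Finset.sum_sub_distrib, Finset.sum_div, Finset.mul_sum]
    refine Finset.sum_congr rfl fun β hβ => ?_
    have h4 := sub_ne_zero.2 (hS β hβ)
    have h5 := sub_ne_zero.2 (hZ β hβ)
    rw [lag_eq_eval, Lagrange.eval_basis_not_at_node hβ (hZ β hβ)]
    field_simp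
    ring
  have h4 := hn S hS
  have h5 := hn Z hZ
  have h6 := h1 S hS
  have h7 := h1 Z hZ
  rw [h2, h3, eq_inv_of_mul_eq_one_right h6, eq_inv_of_mul_eq_one_right h7]
  field_simp
  ring

/-- Symmetrization of the kernel. -/
lemma kernel_add_kernel_neg (m : ℕ) {u v : ℂ} (hu : onLines q u)
    (hv : Real.cos (Real.log q * v.im) ≠ 0) :
    kernel G q m u v + kernel G q m u (-v) =
      (weylPoly G m).eval (ch (Real.log q * v)) * rho G (ch (Real.log q * v)) *
        (kap G (Real.log q * u) / (ch (Real.log q * u) - ch (Real.log q * v))) := by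
  set L : ℂ := ((Real.log q : ℝ) : ℂ) with hL
  have h1 := exp_log_sub_ne_zero hu hv
  have h2 := exp_log_add_ne_zero hu hv
  have h0 := exp_log_sub_ne_zero (p := 0) hu (by simp)
  rw [rho_ch]
  have e1 : (weylPoly G m).eval (ch (L * v)) * (-sgn G * den G (L * v) ^ 2) *
      (kap G (L * u) / (ch (L * u) - ch (L * v))) = -sgn G *
      (den G (L * v) * (weylPoly G m).eval (ch (L * v))) *
      (den G (L * v) * (kap G (L * u) / (ch (L * u) - ch (L * v)))) := by ring
  rw [e1, ← exp_add_eq_den_mul, den_mul_kap_div G h1 h2]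
  have hx := Complex.exp_ne_zero (L * u / 2)
  have hy := Complex.exp_ne_zero (L * v / 2)
  have hM := Complex.exp_ne_zero (L * (m * v))
  have f1 : Complex.exp (L * u - L * v) = Complex.exp (L * u / 2) ^ 2 / Complex.exp (L * v / 2) ^ 2 := by
    rw [← Complex.exp_nat_mul, ← Complex.exp_nat_mul, ← Complex.exp_sub]; push_cast; ring_nf
  have f2 : Complex.exp (L * u + L * v) = Complex.exp (L * u / 2) ^ 2 * Complex.exp (L * v / 2) ^ 2 := by
    rw [← Complex.exp_nat_mul, ← Complex.exp_nat_mul, ← Complex.exp_add]; push_cast; ring_nf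
  have f0 : Complex.exp (L * u - L * 0) = Complex.exp (L * u / 2) ^ 2 := by
    rw [← Complex.exp_nat_mul]; push_cast; ring_nf
  rw [f1] at h1
  rw [f2] at h2
  rw [f0] at h0
  cases G
  · simp only [kernel, eps, sgn, pfExp, cpow_eq_exp]
    rw [← hL, show L * (u / 2 - (m + 1) * v) = L * u / 2 - (L * (m * v) + L * v / 2 + L * v / 2) by ring,
      show L * (-(u / 2) + (m + 1) * v) = -(L * u / 2) + (L * (m * v) + L * v / 2 + L * v / 2) by ring,
      show L * (u / 2 - (m + 1) * -v) = L * u / 2 + (L * (m * v) + L * v / 2 + L * v / 2) by ring,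
      show L * (-(u / 2) + (m + 1) * -v) = -(L * u / 2) - (L * (m * v) + L * v / 2 + L * v / 2) by ring,
      show L * (v / 2) = L * v / 2 by ring, show L * -(v / 2) = -(L * v / 2) by ring,
      show L * (-v / 2) = -(L * v / 2) by ring, show L * -(-v / 2) = L * v / 2 by ring,
      show L * ((v - u) / 2) = L * v / 2 - L * u / 2 by ring,
      show L * ((u - v) / 2) = L * u / 2 - L * v / 2 by ring,
      show L * ((-v - u) / 2) = -(L * v / 2) - L * u / 2 by ring,
      show L * ((u - -v) / 2) = L * u / 2 + L * v / 2 by ring,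
      show L * (u / 2) = L * u / 2 by ring, show L * -(u / 2) = -(L * u / 2) by ring,
      show L * v * (m + ((1 / 2 : ℝ) : ℂ)) = L * (m * v) + L * v / 2 by push_cast; ring,
      show (1 / 2 : ℂ) * (L * u - L * v) = L * u / 2 - L * v / 2 by ring,
      show (1 / 2 : ℂ) * (L * u + L * v) = L * u / 2 + L * v / 2 by ring, f1, f2]
    simp only [Complex.exp_add, Complex.exp_sub, Complex.exp_neg]
    set x := Complex.exp (L * u / 2)
    set y := Complex.exp (L * v / 2)
    set M := Complex.exp (L * (m * v))
    obtain ⟨d₁, hd₁⟩ : ∃ d, d = x ^ 2 - y ^ 2 := ⟨_, rfl⟩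
    obtain ⟨d₂, hd₂⟩ : ∃ d, d = x ^ 2 * y ^ 2 - 1 := ⟨_, rfl⟩
    obtain ⟨d₀, hd₀⟩ : ∃ d, d = x ^ 2 - 1 := ⟨_, rfl⟩
    rw [← hd₂] at h2
    rw [← hd₀] at h0
    have g1 : d₁ ≠ 0 := by
      intro h; apply h1; rw [hd₁] at h; rw [sub_eq_zero.1 h, div_self (pow_ne_zero 2 hy), sub_self]
    rw [show x ^ 2 / y ^ 2 - 1 = d₁ / y ^ 2 by rw [hd₁]; field_simp, ← hd₂,
      show y / x - x / y = -d₁ / (x * y) by rw [hd₁]; field_simp; ring,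
      show y⁻¹ / x - x * y = -d₂ / (x * y) by rw [hd₂]; field_simp; ring,
      show x - x⁻¹ = d₀ / x by rw [hd₀]; field_simp]
    field_simp
    rw [hd₁, hd₂, hd₀]
    ring
  · simp only [kernel, eps, sgn, pfExp, cpow_eq_exp]
    rw [← hL, show L * ((m + 1) * v) = L * (m * v) + L * v / 2 + L * v / 2 by ring,
      show L * (-((m + 1) * v)) = -(L * (m * v) + L * v / 2 + L * v / 2) by ring,
      show L * ((m + 1) * -v) = -(L * (m * v) + L * v / 2 + L * v / 2) by ring,
      show L * (-((m + 1) * -v)) = L * (m * v) + L * v / 2 + L * v / 2 by ring,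
      show L * (u - v) = L * u - L * v by ring, show L * (u - -v) = L * u + L * v by ring,
      show L * v * (m + ((1 : ℝ) : ℂ)) = L * (m * v) + L * v / 2 + L * v / 2 by push_cast; ring,
      f1, f2]
    simp only [Complex.exp_add, Complex.exp_neg, zero_mul, Complex.exp_zero]
    ring
  · simp only [kernel, eps, sgn, pfExp, cpow_eq_exp]
    rw [← hL, show L * (u / 2 - (m + 1 / 2) * v) = L * u / 2 - (L * (m * v) + L * v / 2) by ring,
      show L * (-(u / 2) + (m + 1 / 2) * v) = -(L * u / 2) + (L * (m * v) + L * v / 2) by ring,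
      show L * (u / 2 - (m + 1 / 2) * -v) = L * u / 2 + (L * (m * v) + L * v / 2) by ring,
      show L * (-(u / 2) + (m + 1 / 2) * -v) = -(L * u / 2) - (L * (m * v) + L * v / 2) by ring,
      show L * ((v - u) / 2) = L * v / 2 - L * u / 2 by ring,
      show L * ((u - v) / 2) = L * u / 2 - L * v / 2 by ring,
      show L * ((-v - u) / 2) = -(L * v / 2) - L * u / 2 by ring,
      show L * ((u - -v) / 2) = L * u / 2 + L * v / 2 by ring,
      show L * v * (m + ((0 : ℝ) : ℂ)) = L * (m * v) by push_cast; ring]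
    simp only [one_mul, zero_mul, Complex.exp_zero, f1, f2]
    simp only [Complex.exp_add, Complex.exp_sub, Complex.exp_neg]
    set x := Complex.exp (L * u / 2)
    set y := Complex.exp (L * v / 2)
    set M := Complex.exp (L * (m * v))
    obtain ⟨d₁, hd₁⟩ : ∃ d, d = x ^ 2 - y ^ 2 := ⟨_, rfl⟩
    obtain ⟨d₂, hd₂⟩ : ∃ d, d = x ^ 2 * y ^ 2 - 1 := ⟨_, rfl⟩
    rw [← hd₂] at h2
    have g1 : d₁ ≠ 0 := by
      intro h; apply h1; rw [hd₁] at h; rw [sub_eq_zero.1 h, div_self (pow_ne_zero 2 hy), sub_self]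
    rw [show x ^ 2 / y ^ 2 - 1 = d₁ / y ^ 2 by rw [hd₁]; field_simp, ← hd₂,
      show y / x - x / y = -d₁ / (x * y) by rw [hd₁]; field_simp; ring,
      show y⁻¹ / x - x * y = -d₂ / (x * y) by rw [hd₂]; field_simp; ring]
    field_simp
    rw [hd₁, hd₂]
    ring

end


/-! ### Dominating the double integral. -/

open MeasureTheory

lemma one_le_norm_one_sub {a : ℂ} (ha : a.re = 0) : 1 ≤ ‖1 - a‖ := by
  have := Complex.abs_re_le_norm (1 - a)
  simpa [ha] using this

lemma norm_le_norm_one_sub {a : ℂ} (ha : a.re = 0) : ‖a‖ ≤ ‖1 - a‖ := by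
  have := Complex.abs_im_le_norm (1 - a)
  rw [← Complex.abs_im_eq_norm.2 ha]
  simpa using this

section

variable {G : ClassicalType} {q : ℝ} [hq : Fact (0 < q ∧ q < 1)]

lemma re_exp_of_onLines {u : ℂ} (hu : onLines q u) : (Complex.exp (Real.log q * u)).re = 0 ∧
    (Complex.exp (-(Real.log q * u))).re = 0 := by
  have hL := (log_q_neg q).ne
  have h1 : Real.cos (Real.log q * u.im) = 0 := by
    rcases hu with h | h
    · rw [h, show Real.log q * (Real.pi / (2 * Real.log q)) = Real.pi / 2 by field_simp,
        Real.cos_pi_div_two]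
    · rw [h, show Real.log q * -(Real.pi / (2 * Real.log q)) = -(Real.pi / 2) by field_simp,
        Real.cos_neg, Real.cos_pi_div_two]
  constructor
  · rw [Complex.exp_re, Complex.im_ofReal_mul, h1, mul_zero]
  · rw [Complex.exp_re, Complex.neg_im, Complex.im_ofReal_mul, Real.cos_neg, h1, mul_zero]

/-- On the lines q^u and q^(-u) are purely imaginary, and |1 - a| ≥ max(1, |a|) for imaginary a. Of
the two factors, the one with the growing exponential gives the second bound. -/
lemma le_norm_num_of_onLines (r : ℕ) {u : ℂ} (hu : onLines q u) :
    1 ≤ ‖num G q r (ch (Real.log q * u))‖ ∧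
      qe G q r * Real.exp (|Real.log q| * |u.re|) ≤ ‖num G q r (ch (Real.log q * u))‖ := by
  obtain ⟨h1, h2⟩ := re_exp_of_onLines hu
  have k1 : ((qe G q r : ℂ) * Complex.exp (Real.log q * u)).re = 0 := by
    rw [Complex.re_ofReal_mul, h1, mul_zero]
  have k2 : ((qe G q r : ℂ) * Complex.exp (-(Real.log q * u))).re = 0 := by
    rw [Complex.re_ofReal_mul, h2, mul_zero]
  have a1 := one_le_norm_one_sub k1
  have a2 := one_le_norm_one_sub k2
  have b1 := norm_le_norm_one_sub k1
  have b2 := norm_le_norm_one_sub k2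
  rw [norm_mul, Complex.norm_exp, Complex.norm_real, Real.norm_eq_abs, abs_of_pos (qe_pos r),
    Complex.re_ofReal_mul] at b1
  rw [norm_mul, Complex.norm_exp, Complex.norm_real, Real.norm_eq_abs, abs_of_pos (qe_pos r),
    Complex.neg_re, Complex.re_ofReal_mul] at b2
  rw [num_ch, norm_mul, ← abs_mul]
  refine ⟨by nlinarith, ?_⟩
  rcases abs_cases (Real.log q * u.re) with ⟨h, -⟩ | ⟨h, -⟩
  · rw [h]; nlinarith
  · rw [h]; nlinarith

lemma num_ne_zero_of_onLines (r : ℕ) {u : ℂ} (hu : onLines q u) :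
    num G q r (ch (Real.log q * u)) ≠ 0 :=
  norm_pos_iff.1 (one_pos.trans_le (le_norm_num_of_onLines r hu).1)

/-- Each index in S contributes one exponential of decay in |Re u|; the remaining denominators are
at least 1 in modulus, so the bound is uniform over all s containing S. -/
lemma norm_numRatio_le {S s : Finset ℕ} (hS : S ⊆ s) {u Z : ℂ} (hu : onLines q u) (hZ : ‖Z‖ ≤ 2) :
    ‖numRatio G q s (ch (Real.log q * u)) Z‖ ≤ Real.exp (3 * (1 - q)⁻¹) *
      ((∏ r ∈ S, (qe G q r)⁻¹) * Real.exp (-(S.card * (|Real.log q| * |u.re|)))) := by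
  have hq1 : 0 < (1 - q)⁻¹ := inv_pos.2 (by linarith [q_lt_one q])
  have h1 : ∏ r ∈ s, ‖num G q r Z‖ ≤ Real.exp (3 * (1 - q)⁻¹) := by
    refine (prod_norm_num_le s Z).trans (Real.exp_le_exp.2 ?_)
    have : ‖Z‖ + 1 ≤ 3 := by linarith
    gcongr
  have h2 : ∏ r ∈ s, ‖num G q r (ch (Real.log q * u))‖⁻¹ ≤
      (∏ r ∈ S, (qe G q r)⁻¹) * Real.exp (-(S.card * (|Real.log q| * |u.re|))) := by
    rw [← Finset.prod_sdiff hS]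
    have e : (∏ r ∈ S, (qe G q r)⁻¹) * Real.exp (-(S.card * (|Real.log q| * |u.re|))) =
        1 * ∏ r ∈ S, ((qe G q r)⁻¹ * Real.exp (-(|Real.log q| * |u.re|))) := by
      rw [Finset.prod_mul_distrib, Finset.prod_const, ← Real.exp_nat_mul, one_mul, mul_neg]
    rw [e]
    refine mul_le_mul ?_ ?_ (Finset.prod_nonneg fun _ _ => by positivity) zero_le_one
    · exact Finset.prod_le_one (fun _ _ => by positivity)
        fun r _ => inv_le_one_of_one_le₀ (le_norm_num_of_onLines r hu).1
    · refine Finset.prod_le_prod (fun _ _ => by positivity) fun r _ => ?_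
      rw [Real.exp_neg, ← mul_inv]
      exact inv_anti₀ (mul_pos (qe_pos r) (Real.exp_pos _)) (le_norm_num_of_onLines r hu).2
  rw [numRatio, norm_prod]
  simp only [norm_div, div_eq_mul_inv (‖num G q _ _‖), Finset.prod_mul_distrib]
  exact mul_le_mul h1 h2 (Finset.prod_nonneg fun _ _ => by positivity) (Real.exp_pos _).le

lemma norm_exp_mul_I (a : ℝ) {z : ℂ} (hz : z = a * Complex.I) : ‖Complex.exp z‖ = 1 := by
  rw [hz, Complex.norm_exp_ofReal_mul_I]

lemma norm_kernel_le (m : ℕ) {u : ℂ} (hu : onLines q u) {t : ℝ}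
    (ht : Real.cos (Real.log q * t) ≠ 0) :
    ‖kernel G q m u (t * Complex.I)‖ ≤ 4 * Real.exp (2 * (|Real.log q| * |u.re|)) *
      ‖Complex.exp (Real.log q * (u - t * Complex.I)) - 1‖⁻¹ := by
  set v : ℂ := t * Complex.I with hv
  set L : ℂ := ((Real.log q : ℝ) : ℂ) with hL
  have hvim : v.im = t := by simp [hv]
  have h1 : Complex.exp (L * (u - v)) - 1 ≠ 0 := exp_sub_one_ne_zero hu (by rwa [hvim])
  have h0 : Complex.exp (L * u) - 1 ≠ 0 := by
    simpa using exp_sub_one_ne_zero (p := 0) hu (by simp)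
  set E := Real.exp (|Real.log q| * |u.re|) with hE
  have hE1 : 1 ≤ E := Real.one_le_exp (by positivity)
  have hEE : Real.exp (2 * (|Real.log q| * |u.re|)) = E * E := by
    rw [hE, ← Real.exp_add]; ring_nf
  have hre : (L * u).re = Real.log q * u.re := Complex.re_ofReal_mul _ _
  have hz : ‖Complex.exp (L * u)‖ ≤ E := by
    rw [Complex.norm_exp, hre, hE, ← abs_mul]
    exact Real.exp_le_exp.2 (le_abs_self _)
  have hz2 : ‖Complex.exp (L * u / 2)‖ ≤ E := by
    rw [Complex.norm_exp, hE, ← abs_mul, show (L * u / 2).re = Real.log q * u.re / 2 by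
      rw [← hre]; simp]
    refine Real.exp_le_exp.2 ?_
    linarith [le_abs_self (Real.log q * u.re), abs_nonneg (Real.log q * u.re)]
  have hn : ∀ a : ℝ, ‖Complex.exp (a * (L * v))‖ = 1 := fun a =>
    norm_exp_mul_I (a * (Real.log q * t)) (by rw [hv, hL]; push_cast; ring)
  have hI : 0 ≤ ‖Complex.exp (L * (u - v)) - 1‖⁻¹ := by positivity
  rw [hEE]
  cases G
  · have e : kernel .B q m u v = -((Complex.exp (L * u) * Complex.exp ((-(m + 1) : ℝ) * (L * v)) -
        Complex.exp ((m + 1 : ℝ) * (L * v))) *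
        (Complex.exp ((1 / 2 : ℝ) * (L * v)) - Complex.exp ((-(1 / 2) : ℝ) * (L * v))) *
        (Complex.exp (L * u / 2) * Complex.exp ((-(1 / 2) : ℝ) * (L * v)))) *
        (Complex.exp (L * u) - 1)⁻¹ * (Complex.exp (L * (u - v)) - 1)⁻¹ := by
      simp only [kernel, cpow_eq_exp]
      rw [← hL]
      have hx := Complex.exp_ne_zero (L * u / 2)
      have hy := Complex.exp_ne_zero (L * v / 2)
      have hM := Complex.exp_ne_zero (L * (m * v))
      have f0 : Complex.exp (L * u) = Complex.exp (L * u / 2) ^ 2 := by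
        rw [← Complex.exp_nat_mul]; push_cast; ring_nf
      have f1 : Complex.exp (L * (u - v)) =
          Complex.exp (L * u / 2) ^ 2 / Complex.exp (L * v / 2) ^ 2 := by
        rw [← Complex.exp_nat_mul, ← Complex.exp_nat_mul, ← Complex.exp_sub]; push_cast; ring_nf
      rw [f0] at h0
      rw [f1] at h1
      rw [f0, f1,
        show L * (u / 2 - (m + 1) * v) = L * u / 2 - (L * (m * v) + L * v / 2 + L * v / 2) by ring,
        show L * (-(u / 2) + (m + 1) * v) =
          -(L * u / 2) + (L * (m * v) + L * v / 2 + L * v / 2) by ring,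
        show L * (v / 2) = L * v / 2 by ring, show L * -(v / 2) = -(L * v / 2) by ring,
        show L * ((v - u) / 2) = L * v / 2 - L * u / 2 by ring,
        show L * ((u - v) / 2) = L * u / 2 - L * v / 2 by ring,
        show L * (u / 2) = L * u / 2 by ring, show L * -(u / 2) = -(L * u / 2) by ring,
        show ((-(m + 1) : ℝ) : ℂ) * (L * v) = -(L * (m * v) + L * v / 2 + L * v / 2) by
          push_cast; ring,
        show ((m + 1 : ℝ) : ℂ) * (L * v) = L * (m * v) + L * v / 2 + L * v / 2 by push_cast; ring,
        show ((1 / 2 : ℝ) : ℂ) * (L * v) = L * v / 2 by push_cast; ring,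
        show ((-(1 / 2) : ℝ) : ℂ) * (L * v) = -(L * v / 2) by push_cast; ring]
      simp only [Complex.exp_add, Complex.exp_sub, Complex.exp_neg]
      set x := Complex.exp (L * u / 2)
      set y := Complex.exp (L * v / 2)
      set M := Complex.exp (L * (m * v))
      obtain ⟨d₁, hd₁⟩ : ∃ d, d = x ^ 2 - y ^ 2 := ⟨_, rfl⟩
      obtain ⟨d₀, hd₀⟩ : ∃ d, d = x ^ 2 - 1 := ⟨_, rfl⟩
      rw [← hd₀] at h0
      have g1 : d₁ ≠ 0 := by
        intro h; apply h1; rw [hd₁] at h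
        rw [sub_eq_zero.1 h, div_self (pow_ne_zero 2 hy), sub_self]
      rw [show x ^ 2 / y ^ 2 - 1 = d₁ / y ^ 2 by rw [hd₁]; field_simp,
        show y / x - x / y = -d₁ / (x * y) by rw [hd₁]; field_simp; ring,
        show x - x⁻¹ = d₀ / x by rw [hd₀]; field_simp, ← hd₀]
      field_simp
    have b0 : ‖(Complex.exp (L * u) - 1)⁻¹‖ ≤ 1 := by
      rw [norm_inv]
      refine inv_le_one_of_one_le₀ ?_
      rw [norm_sub_rev]
      exact one_le_norm_one_sub (re_exp_of_onLines hu).1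
    have b1 : ‖Complex.exp (L * u) * Complex.exp ((-(m + 1) : ℝ) * (L * v)) -
        Complex.exp ((m + 1 : ℝ) * (L * v))‖ ≤ E + 1 := by
      refine (norm_sub_le _ _).trans ?_
      rw [norm_mul, hn, hn, mul_one]; linarith
    have b2 : ‖Complex.exp ((1 / 2 : ℝ) * (L * v)) - Complex.exp ((-(1 / 2) : ℝ) * (L * v))‖ ≤ 2 := by
      refine (norm_sub_le _ _).trans ?_
      rw [hn, hn]; norm_num
    have b3 : ‖Complex.exp (L * u / 2) * Complex.exp ((-(1 / 2) : ℝ) * (L * v))‖ ≤ E := by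
      rw [norm_mul, hn, mul_one]; exact hz2
    rw [e, norm_mul, norm_mul, norm_neg, norm_mul, norm_mul, norm_inv (Complex.exp (L * (u - v)) - 1)]
    refine mul_le_mul_of_nonneg_right ?_ hI
    calc _ ≤ (E + 1) * 2 * E * 1 := by gcongr
      _ ≤ 4 * (E * E) := by nlinarith
  · have e : kernel .C q m u v = (Complex.exp ((m + 1 : ℝ) * (L * v)) -
        Complex.exp ((-(m + 1) : ℝ) * (L * v))) * (Complex.exp (L * (u - v)) - 1)⁻¹ := by
      simp only [kernel, cpow_eq_exp]
      rw [← hL, div_eq_mul_inv]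
      push_cast
      ring_nf
    rw [e, norm_mul, norm_inv]
    refine mul_le_mul_of_nonneg_right ?_ hI
    refine (norm_sub_le _ _).trans ?_
    rw [hn, hn]; nlinarith
  · have e : kernel .D q m u v = -(Complex.exp (L * u) * Complex.exp ((-(m + 1) : ℝ) * (L * v)) +
        Complex.exp ((m : ℝ) * (L * v))) * (Complex.exp (L * (u - v)) - 1)⁻¹ := by
      simp only [kernel, cpow_eq_exp]
      rw [← hL]
      have hx := Complex.exp_ne_zero (L * u / 2)
      have hy := Complex.exp_ne_zero (L * v / 2)
      have hM := Complex.exp_ne_zero (L * (m * v))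
      have f0 : Complex.exp (L * u) = Complex.exp (L * u / 2) ^ 2 := by
        rw [← Complex.exp_nat_mul]; push_cast; ring_nf
      have f1 : Complex.exp (L * (u - v)) =
          Complex.exp (L * u / 2) ^ 2 / Complex.exp (L * v / 2) ^ 2 := by
        rw [← Complex.exp_nat_mul, ← Complex.exp_nat_mul, ← Complex.exp_sub]; push_cast; ring_nf
      rw [f1] at h1
      rw [f0, f1,
        show L * (u / 2 - (m + 1 / 2) * v) = L * u / 2 - (L * (m * v) + L * v / 2) by ring,
        show L * (-(u / 2) + (m + 1 / 2) * v) = -(L * u / 2) + (L * (m * v) + L * v / 2) by ring,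
        show L * ((v - u) / 2) = L * v / 2 - L * u / 2 by ring,
        show L * ((u - v) / 2) = L * u / 2 - L * v / 2 by ring,
        show ((-(m + 1) : ℝ) : ℂ) * (L * v) = -(L * (m * v) + L * v / 2 + L * v / 2) by
          push_cast; ring,
        show ((m : ℝ) : ℂ) * (L * v) = L * (m * v) by push_cast; ring]
      simp only [Complex.exp_add, Complex.exp_sub, Complex.exp_neg]
      set x := Complex.exp (L * u / 2)
      set y := Complex.exp (L * v / 2)
      set M := Complex.exp (L * (m * v))
      obtain ⟨d₁, hd₁⟩ : ∃ d, d = x ^ 2 - y ^ 2 := ⟨_, rfl⟩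
      have g1 : d₁ ≠ 0 := by
        intro h; apply h1; rw [hd₁] at h
        rw [sub_eq_zero.1 h, div_self (pow_ne_zero 2 hy), sub_self]
      rw [show x ^ 2 / y ^ 2 - 1 = d₁ / y ^ 2 by rw [hd₁]; field_simp,
        show y / x - x / y = -d₁ / (x * y) by rw [hd₁]; field_simp; ring]
      field_simp
    rw [e, norm_mul, norm_neg, norm_inv]
    refine mul_le_mul_of_nonneg_right ?_ hI
    refine (norm_add_le _ _).trans ?_
    rw [norm_mul, hn, hn]; nlinarith

lemma abs_mul_exp_neg_le (x : ℝ) : |x| * Real.exp (-|x|) ≤ |Real.exp x - 1| := by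
  rcases le_total 0 x with h | h
  · rw [abs_of_nonneg h, abs_of_nonneg (by linarith [Real.add_one_le_exp x])]
    have h1 : Real.exp (-x) ≤ 1 := Real.exp_le_one_iff.2 (by linarith)
    nlinarith [Real.add_one_le_exp x, Real.exp_pos (-x)]
  · rw [abs_of_nonpos h, neg_neg, abs_sub_comm]
    have h1 := Real.add_one_le_exp (-x)
    have h2 : Real.exp x * Real.exp (-x) = 1 := by rw [← Real.exp_add]; simp
    refine le_trans ?_ (le_abs_self _)
    nlinarith [Real.exp_pos x]

/-- The kernel blows up where the v-segment meets the lines. The modulus has one lower bound in t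
and another in Re u; using each for half of the power gives a product of one-variable inverse square
roots, both integrable. -/
lemma inv_norm_exp_sub_one_le {u : ℂ} (hu : onLines q u) (hre : u.re ≠ 0) {t : ℝ}
    (ht : Real.cos (Real.log q * t) ≠ 0) :
    ‖Complex.exp (Real.log q * (u - t * Complex.I)) - 1‖⁻¹ ≤
      |Real.cos (Real.log q * t)| ^ (-(1 / 2) : ℝ) * ((|Real.log q| * |u.re|) ^ (-(1 / 2) : ℝ) *
        Real.exp (|Real.log q| * |u.re|)) := by
  have hL := (log_q_neg q).ne
  set D := ‖Complex.exp (Real.log q * (u - t * Complex.I)) - 1‖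
  set a := |Real.log q| * |u.re| with ha
  have ha0 : 0 < a := mul_pos (abs_pos.2 hL) (abs_pos.2 hre)
  have hc : 0 < |Real.cos (Real.log q * t)| := abs_pos.2 ht
  have h1 : |Real.cos (Real.log q * t)| ≤ D := by
    have := abs_cos_le_norm_exp_sub_one hu (t * Complex.I)
    simpa using this
  have h2 : a * Real.exp (-a) ≤ D := by
    refine le_trans ?_ ((abs_mul_exp_neg_le _).trans (abs_exp_re_sub_one_le _))
    rw [Complex.re_ofReal_mul]
    simp [ha, abs_mul]
  have hD : 0 < D := hc.trans_le h1
  have e1 : D⁻¹ = D ^ (-(1 / 2) : ℝ) * D ^ (-(1 / 2) : ℝ) := by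
    rw [← Real.rpow_add hD, ← Real.rpow_neg_one]; norm_num
  rw [e1]
  have k1 : D ^ (-(1 / 2) : ℝ) ≤ |Real.cos (Real.log q * t)| ^ (-(1 / 2) : ℝ) :=
    Real.rpow_le_rpow_of_nonpos hc h1 (by norm_num)
  have k2 : D ^ (-(1 / 2) : ℝ) ≤ a ^ (-(1 / 2) : ℝ) * Real.exp a := by
    refine (Real.rpow_le_rpow_of_nonpos (by positivity) h2 (by norm_num)).trans ?_
    rw [Real.mul_rpow ha0.le (Real.exp_pos _).le, ← Real.exp_mul]
    have : Real.exp (-a * -(1 / 2)) ≤ Real.exp a := Real.exp_le_exp.2 (by linarith)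
    gcongr
  exact mul_le_mul k1 k2 (by positivity) (by positivity)

/-- The integrand of the double integral for a finite set of exponents. -/
def dblIntegrand (G : ClassicalType) (q : ℝ) (m : ℕ) (c : ℂ) (s : Finset ℕ) (u v : ℂ) : ℂ :=
  Complex.exp (c * u) * kernel G q m u v * numRatio G q s (ch (Real.log q * u)) (ch (Real.log q * v))

/-- The size required of S pays for the growth rates ‖c‖ of x^u, 2|ln q| of the kernel and |ln q| of
the bound near the pole, with rate 1 left over for decay. -/
lemma norm_dblIntegrand_le (G : ClassicalType) (m : ℕ) (c : ℂ) {S : Finset ℕ}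
    (hS : ‖c‖ + 3 * |Real.log q| + 1 ≤ S.card * |Real.log q|) : ∃ C : ℝ, 0 ≤ C ∧
      ∀ s : Finset ℕ, S ⊆ s → ∀ u : ℂ, onLines q u → u.re ≠ 0 → ∀ t : ℝ,
        Real.cos (Real.log q * t) ≠ 0 → ‖dblIntegrand G q m c s u (t * Complex.I)‖ ≤
          C * |Real.cos (Real.log q * t)| ^ (-(1 / 2) : ℝ) *
            (|u.re| ^ (-(1 / 2) : ℝ) * Real.exp (-1 * |u.re|)) := by
  set h : ℝ := -(Real.pi / (2 * Real.log q))
  set P : ℝ := ∏ r ∈ S, (qe G q r)⁻¹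
  have hP : 0 ≤ P := Finset.prod_nonneg fun r _ => (inv_pos.2 (qe_pos r)).le
  refine ⟨Real.exp (‖c‖ * h) * 4 * |Real.log q| ^ (-(1 / 2) : ℝ) *
    (Real.exp (3 * (1 - q)⁻¹) * P), by positivity, fun s hSs u hu hre t ht => ?_⟩
  have h1 : ‖Complex.exp (c * u)‖ ≤ Real.exp (‖c‖ * h) * Real.exp (‖c‖ * |u.re|) := by
    rw [Complex.norm_exp, ← Real.exp_add, Real.exp_le_exp]
    refine (Complex.re_le_norm _).trans ?_
    rw [norm_mul]
    have := Complex.norm_le_abs_re_add_abs_im u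
    rw [abs_im_of_onLines hu] at this
    rw [← mul_add]
    gcongr
    linarith
  have h2 := norm_kernel_le (G := G) m hu ht
  have h3 := inv_norm_exp_sub_one_le hu hre ht
  have h4 := norm_numRatio_le (G := G) hSs hu (norm_ch_mul_I_le (Real.log q) t)
  rw [Real.mul_rpow (abs_nonneg _) (abs_nonneg _)] at h3
  rw [dblIntegrand, norm_mul, norm_mul]
  set cs := |Real.cos (Real.log q * t)| ^ (-(1 / 2) : ℝ)
  set x := |u.re|
  set l := |Real.log q|
  have hx : 0 ≤ x := abs_nonneg _
  have hexp : Real.exp (‖c‖ * x) * Real.exp (2 * (l * x)) * Real.exp (l * x) *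
      Real.exp (-(S.card * (l * x))) ≤ Real.exp (-1 * x) := by
    rw [← Real.exp_add, ← Real.exp_add, ← Real.exp_add, Real.exp_le_exp]
    have := mul_le_mul_of_nonneg_right hS hx
    nlinarith
  calc _ ≤ (Real.exp (‖c‖ * h) * Real.exp (‖c‖ * x)) *
        (4 * Real.exp (2 * (l * x)) * (cs * (l ^ (-(1 / 2) : ℝ) * x ^ (-(1 / 2) : ℝ) *
          Real.exp (l * x)))) *
        (Real.exp (3 * (1 - q)⁻¹) * (P * Real.exp (-(S.card * (l * x))))) := by
        have := h2.trans (mul_le_mul_of_nonneg_left h3 (by positivity))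
        gcongr
    _ = (Real.exp (‖c‖ * h) * 4 * l ^ (-(1 / 2) : ℝ) * (Real.exp (3 * (1 - q)⁻¹) * P)) * cs *
        (x ^ (-(1 / 2) : ℝ) * (Real.exp (‖c‖ * x) * Real.exp (2 * (l * x)) * Real.exp (l * x) *
          Real.exp (-(S.card * (l * x))))) := by ring
    _ ≤ _ := by gcongr

end


/-! ### Evaluation of the inner integral and removal of the Gaussian factor. -/

open MeasureTheory

section

variable {G : ClassicalType} {q : ℝ} [hq : Fact (0 < q ∧ q < 1)]

lemma measurable_kernel (G : ClassicalType) (m : ℕ) :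
    Measurable fun p : ℂ × ℂ => kernel G q m p.1 p.2 := by
  cases G <;> simp only [kernel, cpow_eq_exp] <;> fun_prop

lemma measurable_dblIntegrand (G : ClassicalType) (m : ℕ) (c : ℂ) (s : Finset ℕ) :
    Measurable fun p : ℂ × ℂ => dblIntegrand G q m c s p.1 p.2 := by
  have h1 : Measurable fun p : ℂ × ℂ =>
      numRatio G q s (ch (Real.log q * p.1)) (ch (Real.log q * p.2)) := by
    simp only [numRatio, num, ch]
    refine Finset.measurable_fun_prod _ fun r _ => ?_
    fun_prop
  have h2 := measurable_kernel (q := q) G m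
  simp only [dblIntegrand]
  fun_prop

omit hq in
lemma countable_sin_eq_zero {a : ℝ} (ha : a ≠ 0) : {t : ℝ | Real.sin (a * t) = 0}.Countable := by
  refine (Set.countable_range fun n : ℤ => n * Real.pi / a).mono fun t ht => ?_
  obtain ⟨n, hn⟩ := Real.sin_eq_zero_iff.1 ht
  exact ⟨n, by simp only; rw [hn]; field_simp⟩

lemma ae_sin_ne_zero : ∀ᵐ t : ℝ, Real.sin (2 * Real.log q * t) ≠ 0 := by
  have := (countable_sin_eq_zero (a := 2 * Real.log q) (by
    have := (log_q_neg q).ne; positivity)).ae_notMem volume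
  filter_upwards [this] with t ht using ht

omit hq in
lemma cos_ne_zero_of_sin_two {x : ℝ} (h : Real.sin (2 * x) ≠ 0) : Real.cos x ≠ 0 := fun e => h (by
  rw [Real.sin_two_mul, e, mul_zero])

omit hq in
lemma sin_ne_zero_of_sin_two {x : ℝ} (h : Real.sin (2 * x) ≠ 0) : Real.sin x ≠ 0 := fun e => h (by
  rw [Real.sin_two_mul, e, mul_zero, zero_mul])

/-- On this interval the cosine has simple zeros at ±h only; Jordan's inequality compares it with
the distance to the nearer one. -/
lemma integrable_rpow_abs_cos : Integrable (fun t : ℝ =>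
    |Real.cos (Real.log q * t)| ^ (-(1 / 2) : ℝ))
      (volume.restrict (Ioc (Real.pi / Real.log q) (-(Real.pi / Real.log q)))) := by
  have hL := log_q_neg q
  have hpi := Real.pi_pos
  have hL0 : 0 < |Real.log q| := abs_pos.2 hL.ne
  set h : ℝ := -(Real.pi / (2 * Real.log q)) with hh
  have hh0 : 0 < h := by
    rw [hh, Left.neg_pos_iff]; exact div_neg_of_pos_of_neg hpi (by linarith)
  have hLh : |Real.log q| * h = Real.pi / 2 := by
    rw [abs_of_neg hL, hh]; have := hL.ne; field_simp
  have hT : -(Real.pi / Real.log q) = 2 * h := by rw [hh]; field_simp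
  have hT' : Real.pi / Real.log q = -(2 * h) := by rw [← hT, neg_neg]
  set φ : ℝ → ℝ := fun s => |s| ^ (-(1 / 2) : ℝ) * Real.exp (-1 * |s|) with hφ
  have hφi : Integrable φ := integrable_rpow_abs_mul_exp one_pos
  set C : ℝ := (2 / Real.pi * |Real.log q|) ^ (-(1 / 2) : ℝ) * Real.exp (3 * h) with hC
  have hint : Integrable (fun t => C * (φ (t - h) + φ (t - -h))) :=
    ((hφi.comp_sub_right h).add (hφi.comp_sub_right (-h))).const_mul C
  refine (hint.mono_measure Measure.restrict_le_self).mono'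
    (by fun_prop : Measurable _).aestronglyMeasurable ?_
  filter_upwards [ae_restrict_mem measurableSet_Ioc] with t ht
  rw [hT, hT'] at ht
  have htabs : |t| ≤ 2 * h := abs_le.2 ⟨ht.1.le, ht.2⟩
  rw [Real.norm_of_nonneg (by positivity)]
  have hφ0 : ∀ s, 0 ≤ φ s := fun s => by simp only [hφ]; positivity
  by_cases hcos : Real.cos (Real.log q * t) = 0
  · rw [hcos, abs_zero, Real.zero_rpow (by norm_num)]
    have := hφ0 (t - h); have := hφ0 (t - -h)
    positivity
  have hb : ∀ a : ℝ, |a| ≤ 3 * h → a ≠ 0 →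
      2 / Real.pi * |Real.log q| * |a| ≤ |Real.cos (Real.log q * t)| →
      |Real.cos (Real.log q * t)| ^ (-(1 / 2) : ℝ) ≤ C * φ a := by
    intro a ha ha0 hle
    have ha1 : 0 < |a| := abs_pos.2 ha0
    refine (Real.rpow_le_rpow_of_nonpos (by positivity) hle (by norm_num)).trans ?_
    rw [Real.mul_rpow (by positivity) ha1.le]
    have e : C * φ a = (2 / Real.pi * |Real.log q|) ^ (-(1 / 2) : ℝ) * |a| ^ (-(1 / 2) : ℝ) *
        Real.exp (3 * h + -1 * |a|) := by
      rw [Real.exp_add]; simp only [hC, hφ]; ring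
    rw [e]
    exact le_mul_of_one_le_right (by positivity) (Real.one_le_exp (by linarith))
  have hsin : |Real.cos (Real.log q * t)| = |Real.sin (|Real.log q| * (h - |t|))| := by
    rw [← Real.cos_abs (Real.log q * t), abs_mul, mul_sub, hLh, Real.sin_pi_div_two_sub]
  have hle := Real.mul_abs_le_abs_sin (x := |Real.log q| * (h - |t|)) (by
    rw [abs_mul, abs_abs, ← hLh]
    refine mul_le_mul_of_nonneg_left (abs_le.2 ⟨?_, ?_⟩) hL0.le
    · linarith
    · linarith [abs_nonneg t])
  rw [← hsin, abs_mul, abs_abs, ← mul_assoc] at hle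
  have hne : h - |t| ≠ 0 := fun e => hcos (by
    rw [← abs_eq_zero, hsin, e, mul_zero, Real.sin_zero, abs_zero])
  rcases le_total 0 t with h0 | h0
  · rw [abs_of_nonneg h0] at hle hne htabs
    have := hb (t - h) (abs_le.2 ⟨by linarith, by linarith⟩) (fun e => hne (by linarith))
      (by rwa [abs_sub_comm])
    have h3 := hφ0 (t - -h)
    have h4 : 0 ≤ C := by positivity
    nlinarith
  · rw [abs_of_nonpos h0] at hle hne htabs
    have := hb (t - -h) (abs_le.2 ⟨by linarith, by linarith⟩) (fun e => hne (by linarith))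
      (by rwa [show t - -h = h - -t by ring])
    have h3 := hφ0 (t - h)
    have h4 : 0 ≤ C := by positivity
    nlinarith

omit hq in
lemma ae_ne_zero : ∀ᵐ s : ℝ, s ≠ 0 := by
  have := (Set.countable_singleton (0 : ℝ)).ae_notMem volume
  simpa using this

lemma lineIntegrable_dblIntegrand (G : ClassicalType) (m : ℕ) (c : ℂ) {S s : Finset ℕ}
    (hS : ‖c‖ + 3 * |Real.log q| + 1 ≤ S.card * |Real.log q|) (hSs : S ⊆ s) {t : ℝ}
    (ht : Real.cos (Real.log q * t) ≠ 0) :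
    LineIntegrable q fun u => dblIntegrand G q m c s u (t * Complex.I) := by
  obtain ⟨C, hC, hb⟩ := norm_dblIntegrand_le (q := q) G m c hS
  have hm : ∀ v : ℂ, Measurable fun u : ℂ => dblIntegrand G q m c s u v := fun v =>
    Measurable.of_uncurry_right (f := dblIntegrand G q m c s) (measurable_dblIntegrand G m c s)
  have hint := (integrable_rpow_abs_mul_exp one_pos).const_mul
    (C * |Real.cos (Real.log q * t)| ^ (-(1 / 2) : ℝ))
  have key : ∀ z : ℂ, (∀ x : ℝ, onLines q (x + z)) → z.re = 0 →
      Integrable fun x : ℝ => dblIntegrand G q m c s (x + z) (t * Complex.I) := by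
    intro z hz hz0
    have hadd : Measurable fun x : ℝ => (x : ℂ) + z := by fun_prop
    refine hint.mono' ((hm (t * Complex.I)).comp hadd).aestronglyMeasurable ?_
    filter_upwards [ae_ne_zero] with x hx
    have hre : ((x : ℂ) + z).re = x := by rw [Complex.add_re, hz0, Complex.ofReal_re, add_zero]
    have := hb s hSs _ (hz x) (by rwa [hre]) t ht
    rwa [hre] at this
  refine ⟨key _ (onLines_add q) (by simp [-Complex.ofReal_div]), ?_⟩
  simp only [sub_eq_add_neg]
  exact key _ (fun x => by rw [← sub_eq_add_neg]; exact onLines_sub q x)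
    (by simp [-Complex.ofReal_div])

omit hq in
lemma norm_exp_neg_mul_sq_le {δ : ℝ} (h0 : 0 ≤ δ) (h1 : δ ≤ 1) (u : ℂ) :
    ‖Complex.exp (-δ * u ^ 2)‖ ≤ Real.exp (u.im ^ 2) := by
  rw [Complex.norm_exp, Real.exp_le_exp]
  have : (-(δ : ℂ) * u ^ 2).re = -δ * (u.re ^ 2 - u.im ^ 2) := by
    rw [← Complex.ofReal_neg, Complex.re_ofReal_mul, pow_two, Complex.mul_re]; ring
  rw [this]
  nlinarith [sq_nonneg u.re, sq_nonneg u.im]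

omit hq in
-- On a line with Im u = d the Gaussian factor is bounded by e^(d²) uniformly in δ ≤ 1, so dominated
-- convergence applies.
lemma tendsto_contourIntegral_gauss {f : ℂ → ℂ} (hf : LineIntegrable q f) :
    Tendsto (fun n : ℕ => contourIntegral q fun u =>
      Complex.exp (-((1 / ((n : ℝ) + 1) : ℝ) : ℂ) * u ^ 2) * f u) atTop
        (𝓝 (contourIntegral q f)) := by
  have key : ∀ d : ℝ, Integrable (fun x : ℝ => f (x + d * Complex.I)) →
      Tendsto (fun n : ℕ => ∫ x : ℝ, Complex.exp (-((1 / ((n : ℝ) + 1) : ℝ) : ℂ) *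
        (x + d * Complex.I) ^ 2) * f (x + d * Complex.I)) atTop
        (𝓝 (∫ x : ℝ, f (x + d * Complex.I))) := by
    intro d hi
    refine tendsto_integral_of_dominated_convergence
      (fun x => Real.exp (d ^ 2) * ‖f (x + d * Complex.I)‖) (fun n => ?_)
      (hi.norm.const_mul _) (fun n => Eventually.of_forall fun x => ?_)
      (Eventually.of_forall fun x => ?_)
    · exact (Continuous.aestronglyMeasurable (by fun_prop)).mul hi.aestronglyMeasurable
    · rw [norm_mul]
      refine mul_le_mul_of_nonneg_right ?_ (norm_nonneg _)
      refine (norm_exp_neg_mul_sq_le (by positivity) ?_ _).trans (le_of_eq ?_)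
      · rw [div_le_one (by positivity)]; linarith [Nat.cast_nonneg (α := ℝ) n]
      · simp
    · have h1 : Tendsto (fun n : ℕ => ((1 / ((n : ℝ) + 1) : ℝ) : ℂ)) atTop (𝓝 ((0 : ℝ) : ℂ)) :=
        (Complex.continuous_ofReal.tendsto _).comp tendsto_one_div_add_atTop_nhds_zero_nat
      have h2 := ((h1.neg.mul_const ((x + d * Complex.I : ℂ) ^ 2)).cexp).mul_const
        (f (x + d * Complex.I))
      simpa using h2
  simp only [contourIntegral]
  refine ((key _ hf.1).sub ?_).const_mul _
  have e : ∀ x : ℝ, (x : ℂ) - (Real.pi / (2 * Real.log q) : ℝ) * Complex.I =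
      x + (-(Real.pi / (2 * Real.log q)) : ℝ) * Complex.I := fun x => by push_cast; ring
  have h2 := hf.2
  simp only [e] at h2 ⊢
  exact key _ h2

/-- Points of the unit circle give 2 cos ≤ 2, while every node is at least 2; the case of equality
is excluded by the sine. -/
lemma ch_mul_I_ne_node (r : ℕ) {t : ℝ} (ht : Real.sin (Real.log q * t) ≠ 0) :
    ch (Real.log q * (t * Complex.I)) ≠ node G q r := by
  rw [ch_mul_I, node_eq_ofReal]
  intro h
  have h1 : 2 * Real.cos (Real.log q * t) = qe G q r + (qe G q r)⁻¹ := by exact_mod_cast h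
  have h2 := qe_pos (G := G) (q := q) r
  have h3 : 2 ≤ qe G q r + (qe G q r)⁻¹ := by
    have : qe G q r + (qe G q r)⁻¹ - 2 = (qe G q r - 1) ^ 2 / qe G q r := by field_simp; ring
    have := div_nonneg (sq_nonneg (qe G q r - 1)) h2.le
    linarith
  have h4 : Real.cos (Real.log q * t) = 1 := by linarith [Real.cos_le_one (Real.log q * t)]
  have h5 := Real.sin_sq_add_cos_sq (Real.log q * t)
  rw [h4] at h5
  exact ht (by nlinarith)

omit hq in
lemma den_mul_I_ne_zero (G : ClassicalType) {t : ℝ} (ht : Real.sin (Real.log q * t) ≠ 0) :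
    den G (Real.log q * (t * Complex.I)) ≠ 0 := by
  have h1 : Complex.exp (Real.log q * (t * Complex.I)) -
      Complex.exp (-(Real.log q * (t * Complex.I))) ≠ 0 := by
    have e : Complex.exp (Real.log q * (t * Complex.I)) -
        Complex.exp (-(Real.log q * (t * Complex.I))) =
          2 * Complex.I * (Real.sin (Real.log q * t) : ℝ) := by
      rw [show (Real.log q : ℂ) * (t * Complex.I) = ((Real.log q * t : ℝ) : ℂ) * Complex.I by
        push_cast; ring, ← neg_mul, Complex.exp_mul_I, Complex.exp_mul_I, Complex.cos_neg,
        Complex.sin_neg, Complex.ofReal_sin]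
      ring
    rw [e]
    exact mul_ne_zero (mul_ne_zero two_ne_zero Complex.I_ne_zero) (by exact_mod_cast ht)
  cases G
  · intro h
    simp only [den] at h
    apply h1
    set w := Real.log q * (t * Complex.I)
    have e1 : w = w / 2 + w / 2 := by ring
    have e2 : -w = -(w / 2) + -(w / 2) := by ring
    rw [e2, Complex.exp_add (-(w / 2)), ← sub_eq_zero.1 h, ← Complex.exp_add, ← e1, sub_self]
  · exact h1
  · exact one_ne_zero

/-- The symmetrized contour integral for a finite set of exponents. -/
lemma contourIntegral_dblIntegrand_add (G : ClassicalType) (m : ℕ) (c : ℂ) {S s : Finset ℕ}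
    (hS : ‖c‖ + 3 * |Real.log q| + 1 ≤ S.card * |Real.log q|) (hSs : S ⊆ s) (hs : s.Nonempty)
    {t : ℝ} (ht : Real.sin (2 * (Real.log q * t)) ≠ 0) (ht2 : |Real.log q * t| ≤ Real.pi) :
    contourIntegral q (fun u => dblIntegrand G q m c s u (t * Complex.I)) +
      contourIntegral q (fun u => dblIntegrand G q m c s u (-(t * Complex.I))) =
    (weylPoly G m).eval (ch (Real.log q * (t * Complex.I))) *
        rho G (ch (Real.log q * (t * Complex.I))) *
      ((den G (Real.log q * (t * Complex.I)))⁻¹ * (if |Real.log q * t| < Real.pi / 2 then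
        (Complex.exp (c * (t * Complex.I)) + sgn G * Complex.exp (-(c * (t * Complex.I)))) /
          Real.log q else 0) -
        ∑ β ∈ s, lag G q s β (ch (Real.log q * (t * Complex.I))) / dn G q β *
          ((Complex.exp (c * (β + eps G)) + sgn G * Complex.exp (-(c * (β + eps G)))) /
            Real.log q)) := by
  have hcos := cos_ne_zero_of_sin_two ht
  have hsin := sin_ne_zero_of_sin_two ht
  have hcos' : Real.cos (Real.log q * (-t)) ≠ 0 := by rwa [mul_neg, Real.cos_neg]
  set v : ℂ := t * Complex.I with hv
  have hvim : v.im = t := by simp [hv]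
  have hcv : Real.cos (Real.log q * v.im) ≠ 0 := by rwa [hvim]
  set Z := ch (Real.log q * v) with hZ
  set W := (weylPoly G m).eval Z * rho G Z
  have hi1 : LineIntegrable q fun u => dblIntegrand G q m c s u v :=
    lineIntegrable_dblIntegrand G m c hS hSs hcos
  have hi2 : LineIntegrable q fun u => dblIntegrand G q m c s u (-v) := by
    have := lineIntegrable_dblIntegrand G m c hS hSs hcos'
    simpa [hv] using this
  rw [← contourIntegral_add hi1 hi2]
  -- One partial fraction term with its Gaussian factor. The full integrand is integrable without
  -- this factor, but a single term need not be; hence the evaluation at δ > 0 followed by δ → 0.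
  set g : ℝ → ℂ → ℂ → ℂ := fun δ p u => Complex.exp (c * u - δ * u ^ 2) *
      (den G (Real.log q * p) * (kap G (Real.log q * u) /
        (ch (Real.log q * u) - ch (Real.log q * p)))) with hg
  have hdv := den_mul_I_ne_zero G hsin
  rw [← hv] at hdv
  have him : ∀ β : ℕ, ((β : ℂ) + eps G).im = 0 := fun β => by simp
  have e1 : ∀ δ : ℝ, ∀ u, onLines q u → Complex.exp (-δ * u ^ 2) *
      (dblIntegrand G q m c s u v + dblIntegrand G q m c s u (-v)) =
      W * ((den G (Real.log q * v))⁻¹ * g δ v u -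
        ∑ β ∈ s, lag G q s β Z / dn G q β * g δ (β + eps G) u) := by
    intro δ u hu
    have hSZ := ch_sub_ch_ne_zero (exp_log_sub_ne_zero hu hcv) (exp_log_add_ne_zero hu hcv)
    have h1 := numRatio_div_sub (G := G) (q := q) hs (S := ch (Real.log q * u)) (Z := Z)
      (fun r _ h => num_ne_zero_of_onLines (G := G) r hu ((num_eq_zero_iff r _).2 h))
      (fun r _ => ch_mul_I_ne_node r hsin) hSZ
    have h2 := kernel_add_kernel_neg (G := G) m hu hcv
    have h3 : ch (Real.log q * -v) = Z := by rw [mul_neg, ch_neg]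
    rw [dblIntegrand, dblIntegrand, h3, ← hZ]
    have h4 : Complex.exp (-δ * u ^ 2) * (Complex.exp (c * u) * kernel G q m u v *
          numRatio G q s (ch (Real.log q * u)) Z + Complex.exp (c * u) * kernel G q m u (-v) *
          numRatio G q s (ch (Real.log q * u)) Z) =
        (Complex.exp (c * u) * Complex.exp (-δ * u ^ 2)) *
          (kernel G q m u v + kernel G q m u (-v)) * numRatio G q s (ch (Real.log q * u)) Z := by
      ring
    rw [h4, h2, ← Complex.exp_add, ← hZ]
    have h5 : kap G (Real.log q * u) / (ch (Real.log q * u) - Z) *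
        numRatio G q s (ch (Real.log q * u)) Z = kap G (Real.log q * u) *
          (numRatio G q s (ch (Real.log q * u)) Z / (ch (Real.log q * u) - Z)) := by ring
    have h6 : ∑ β ∈ s, lag G q s β Z / dn G q β * g δ (β + eps G) u =
        Complex.exp (c * u - δ * u ^ 2) * (kap G (Real.log q * u) *
          ∑ β ∈ s, lag G q s β Z / (ch (Real.log q * u) - node G q β)) := by
      rw [Finset.mul_sum, Finset.mul_sum]
      refine Finset.sum_congr rfl fun β _ => ?_
      have h7 := dn_ne_zero (G := G) (q := q) β
      simp only [hg]
      rw [← node, ← dn]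
      field_simp
    rw [mul_assoc, mul_assoc, mul_assoc, h5, h1, h6]
    simp only [hg]
    rw [← hZ, show c * u + -δ * u ^ 2 = c * u - δ * u ^ 2 by ring]
    field_simp
    simp only [W]
    ring
  have hlim := tendsto_contourIntegral_gauss (hi1.add hi2)
  have hval : ∀ n : ℕ, contourIntegral q (fun u =>
      Complex.exp (-((1 / ((n : ℝ) + 1) : ℝ) : ℂ) * u ^ 2) *
        (dblIntegrand G q m c s u v + dblIntegrand G q m c s u (-v))) =
      W * ((den G (Real.log q * v))⁻¹ * (if |Real.log q * t| < Real.pi / 2 then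
        (Complex.exp (c * v) + sgn G * Complex.exp (-(c * v))) *
          Complex.exp (-((1 / ((n : ℝ) + 1) : ℝ) : ℂ) * v ^ 2) / Real.log q else 0) -
        ∑ β ∈ s, lag G q s β Z / dn G q β *
          ((Complex.exp (c * (β + eps G)) + sgn G * Complex.exp (-(c * (β + eps G)))) *
            Complex.exp (-((1 / ((n : ℝ) + 1) : ℝ) : ℂ) * (β + eps G) ^ 2) / Real.log q)) := by
    intro n
    set δ : ℝ := 1 / ((n : ℝ) + 1)
    have hδ : 0 < δ := by positivity
    have hgv := lineIntegrable_contourIntegral_kap G c v hδ hcv (by rwa [hvim])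
    have hgb : ∀ β : ℕ, _ := fun β : ℕ => lineIntegrable_contourIntegral_kap (q := q) G c
      ((β : ℂ) + eps G) hδ (by rw [him]; simp) (by rw [him]; simp [Real.pi_pos.le])
    rw [contourIntegral_congr (e1 δ), contourIntegral_const_mul, contourIntegral_sub
      (hgv.1.const_mul _) (LineIntegrable.sum s fun β _ => (hgb β).1.const_mul _),
      contourIntegral_sum s (fun β _ => (hgb β).1.const_mul _), contourIntegral_const_mul, hgv.2,
      hvim]
    congr 2
    refine Finset.sum_congr rfl fun β _ => ?_
    rw [contourIntegral_const_mul, (hgb β).2, him, mul_zero, abs_zero,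
      if_pos (by linarith [Real.pi_pos])]
  simp only [hval] at hlim
  refine tendsto_nhds_unique hlim ?_
  have h1 : Tendsto (fun n : ℕ => ((1 / ((n : ℝ) + 1) : ℝ) : ℂ)) atTop (𝓝 ((0 : ℝ) : ℂ)) :=
    (Complex.continuous_ofReal.tendsto _).comp tendsto_one_div_add_atTop_nhds_zero_nat
  have h2 : ∀ (A p : ℂ), Tendsto (fun n : ℕ => A *
      Complex.exp (-((1 / ((n : ℝ) + 1) : ℝ) : ℂ) * p ^ 2) / Real.log q) atTop
        (𝓝 (A / Real.log q)) := by
    intro A p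
    have := (((h1.neg.mul_const (p ^ 2)).cexp).const_mul A).div_const (Real.log q : ℂ)
    simpa using this
  refine Tendsto.const_mul _ (Tendsto.sub (Tendsto.const_mul _ ?_)
    (tendsto_finsetSum _ fun β _ => (h2 _ _).const_mul _))
  split_ifs
  · exact h2 _ _
  · exact tendsto_const_nhds

end


/-! ### Convergence of double integrals as the exponent set grows. -/

open MeasureTheory

lemma segmentIntegral_eq_setIntegral {T : ℝ} (hT : T ≤ 0) (f : ℂ → ℂ) :
    segmentIntegral T f = -(2 * Real.pi : ℂ)⁻¹ * ∫ t in Ioc T (-T), f (t * Complex.I) := by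
  rw [segmentIntegral, intervalIntegral.integral_mul_const, intervalIntegral.integral_symm,
    intervalIntegral.integral_of_le (by linarith), mul_inv]
  have := Complex.I_ne_zero
  field_simp

/-- Lebesgue measure on the parameter interval of the outer integral. -/
abbrev axisMeasure (q : ℝ) : Measure ℝ :=
  volume.restrict (Ioc (Real.pi / Real.log q) (-(Real.pi / Real.log q)))

section

variable {G : ClassicalType} {q : ℝ} [hq : Fact (0 < q ∧ q < 1)]

lemma pi_div_log_neg (q : ℝ) [hq : Fact (0 < q ∧ q < 1)] : Real.pi / Real.log q < 0 :=
  div_neg_of_pos_of_neg Real.pi_pos (log_q_neg q)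

lemma exists_integrable_bound (G : ClassicalType) (m : ℕ) (c : ℂ) {S : Finset ℕ}
    (hS : ‖c‖ + 3 * |Real.log q| + 1 ≤ S.card * |Real.log q|) {d : ℝ}
    (hd : ∀ x : ℝ, onLines q (x + d * Complex.I)) :
    ∃ b : ℝ × ℝ → ℝ, Integrable b ((axisMeasure q).prod volume) ∧ ∀ s : Finset ℕ, S ⊆ s →
      ∀ᵐ p : ℝ × ℝ ∂((axisMeasure q).prod volume),
        ‖dblIntegrand G q m c s (p.2 + d * Complex.I) (p.1 * Complex.I)‖ ≤ b p := by
  obtain ⟨C, hC, hb⟩ := norm_dblIntegrand_le (q := q) G m c hS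
  have h1 : Integrable (fun t : ℝ => C * |Real.cos (Real.log q * t)| ^ (-(1 / 2) : ℝ))
      (axisMeasure q) := integrable_rpow_abs_cos.const_mul C
  refine ⟨_, h1.mul_prod (integrable_rpow_abs_mul_exp one_pos), fun s hs => ?_⟩
  have a1 : ∀ᵐ t ∂(axisMeasure q), Real.sin (2 * Real.log q * t) ≠ 0 :=
    ae_restrict_of_ae ae_sin_ne_zero
  have b1 : ∀ᵐ p : ℝ × ℝ ∂((axisMeasure q).prod volume),
      Real.sin (2 * Real.log q * p.1) ≠ 0 := Measure.quasiMeasurePreserving_fst.ae a1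
  have b2 : ∀ᵐ p : ℝ × ℝ ∂((axisMeasure q).prod volume), p.2 ≠ 0 :=
    Measure.quasiMeasurePreserving_snd.ae ae_ne_zero
  filter_upwards [b1, b2] with p h1 h2
  have := hb s hs _ (hd p.2) (by rwa [re_add_ofReal_mul_I]) p.1
    (cos_ne_zero_of_sin_two (by rwa [mul_assoc] at h1))
  rwa [re_add_ofReal_mul_I] at this

lemma aestronglyMeasurable_dblIntegrand (G : ClassicalType) (m : ℕ) (c : ℂ) (s : Finset ℕ)
    (d : ℝ) : AEStronglyMeasurable (fun p : ℝ × ℝ =>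
      dblIntegrand G q m c s (p.2 + d * Complex.I) (p.1 * Complex.I))
        ((axisMeasure q).prod volume) := by
  have h : Measurable fun p : ℝ × ℝ =>
      (((p.2 : ℂ) + d * Complex.I, (p.1 : ℂ) * Complex.I) : ℂ × ℂ) := by fun_prop
  exact ((measurable_dblIntegrand (q := q) G m c s).comp h).aestronglyMeasurable

/-- Dominated convergence for the double integral along one of the two lines. -/
lemma tendsto_integral_line (G : ClassicalType) (m : ℕ) (c : ℂ) {S : Finset ℕ}
    (hS : ‖c‖ + 3 * |Real.log q| + 1 ≤ S.card * |Real.log q|) {d : ℝ}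
    (hd : ∀ x : ℝ, onLines q (x + d * Complex.I)) {s : ℕ → Finset ℕ}
    (hs : ∀ᶠ n in atTop, S ⊆ s n) {ψ : ℂ → ℂ → ℂ}
    (hψ : ∀ u, onLines q u → ∀ v, Tendsto (fun n => dblIntegrand G q m c (s n) u v) atTop
      (𝓝 (ψ u v))) :
    Integrable (fun t : ℝ => ∫ x : ℝ, ψ (x + d * Complex.I) (t * Complex.I)) (axisMeasure q) ∧
      Tendsto (fun n => ∫ t : ℝ, ∫ x : ℝ, dblIntegrand G q m c (s n) (x + d * Complex.I)
        (t * Complex.I) ∂volume ∂(axisMeasure q)) atTop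
          (𝓝 (∫ t : ℝ, ∫ x : ℝ, ψ (x + d * Complex.I) (t * Complex.I) ∂volume ∂(axisMeasure q))) := by
  obtain ⟨b, hb, hle⟩ := exists_integrable_bound (q := q) G m c hS hd
  have hm := fun n => aestronglyMeasurable_dblIntegrand (q := q) G m c (s n) d
  have hlim : ∀ p : ℝ × ℝ, Tendsto (fun n => dblIntegrand G q m c (s n) (p.2 + d * Complex.I)
      (p.1 * Complex.I)) atTop (𝓝 (ψ (p.2 + d * Complex.I) (p.1 * Complex.I))) :=
    fun p => hψ _ (hd p.2) _
  have hi : Integrable (fun p : ℝ × ℝ => ψ (p.2 + d * Complex.I) (p.1 * Complex.I))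
      ((axisMeasure q).prod volume) := by
    refine hb.mono' (aestronglyMeasurable_of_tendsto_ae atTop hm (Eventually.of_forall hlim)) ?_
    obtain ⟨n₀, hn₀⟩ := eventually_atTop.1 hs
    have : ∀ᵐ p : ℝ × ℝ ∂((axisMeasure q).prod volume), ∀ n : ℕ, n₀ ≤ n →
        ‖dblIntegrand G q m c (s n) (p.2 + d * Complex.I) (p.1 * Complex.I)‖ ≤ b p :=
      ae_all_iff.2 fun n => by
        by_cases h : n₀ ≤ n
        · filter_upwards [hle (s n) (hn₀ n h)] with p hp _ using hp
        · exact Eventually.of_forall fun p h' => absurd h' h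
    filter_upwards [this] with p hp
    refine le_of_tendsto (hlim p).norm ?_
    filter_upwards [eventually_ge_atTop n₀] with n hn using hp n hn
  refine ⟨hi.integral_prod_left, ?_⟩
  rw [← integral_prod _ hi]
  have := tendsto_integral_filter_of_dominated_convergence b (Eventually.of_forall hm)
    (hs.mono fun n hn => hle (s n) hn) hb (Eventually.of_forall hlim)
  refine this.congr' ?_
  filter_upwards [hs] with n hn
  exact integral_prod _ (hb.mono' (hm n) (hle _ hn))

/-- The two lines are treated separately and recombined. Integrability of the limiting inner
integral is recorded too; applied to a constant sequence it justifies splitting and symmetrizing for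
finite sets. -/
lemma tendsto_segmentIntegral_contourIntegral (G : ClassicalType) (m : ℕ) (c : ℂ) {S : Finset ℕ}
    (hS : ‖c‖ + 3 * |Real.log q| + 1 ≤ S.card * |Real.log q|) {s : ℕ → Finset ℕ}
    (hs : ∀ᶠ n in atTop, S ⊆ s n) {ψ : ℂ → ℂ → ℂ}
    (hψ : ∀ u, onLines q u → ∀ v, Tendsto (fun n => dblIntegrand G q m c (s n) u v) atTop
      (𝓝 (ψ u v))) :
    Integrable (fun t : ℝ => contourIntegral q fun u => ψ u (t * Complex.I)) (axisMeasure q) ∧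
      Tendsto (fun n => segmentIntegral (Real.pi / Real.log q) fun v =>
        contourIntegral q fun u => dblIntegrand G q m c (s n) u v) atTop
          (𝓝 (segmentIntegral (Real.pi / Real.log q) fun v => contourIntegral q fun u => ψ u v)) := by
  set d : ℝ := Real.pi / (2 * Real.log q) with hd
  have e : ∀ x : ℝ, (x : ℂ) - (d : ℝ) * Complex.I = x + (-d : ℝ) * Complex.I := fun x => by
    push_cast; ring
  have h2 : ∀ x : ℝ, onLines q (x + (-d : ℝ) * Complex.I) := fun x => by
    rw [← e]; exact onLines_sub q x
  obtain ⟨i1, t1⟩ := tendsto_integral_line G m c hS (onLines_add q) hs hψ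
  obtain ⟨i2, t2⟩ := tendsto_integral_line G m c hS h2 hs hψ
  have hc : ∀ (ψ : ℂ → ℂ → ℂ) (v : ℂ), (contourIntegral q fun u => ψ u v) =
      (2 * Real.pi * Complex.I)⁻¹ * ((∫ x : ℝ, ψ (x + d * Complex.I) v) -
        ∫ x : ℝ, ψ (x + (-d : ℝ) * Complex.I) v) := fun ψ v => by
    simp only [contourIntegral, ← hd, e]
  have hseg : ∀ ψ : ℂ → ℂ → ℂ,
      Integrable (fun t : ℝ => ∫ x : ℝ, ψ (x + d * Complex.I) (t * Complex.I)) (axisMeasure q) →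
      Integrable (fun t : ℝ => ∫ x : ℝ, ψ (x + (-d : ℝ) * Complex.I) (t * Complex.I))
        (axisMeasure q) →
      (segmentIntegral (Real.pi / Real.log q) fun v => contourIntegral q fun u => ψ u v) =
        -(2 * Real.pi : ℂ)⁻¹ * ((2 * Real.pi * Complex.I)⁻¹ *
          ((∫ t : ℝ, ∫ x : ℝ, ψ (x + d * Complex.I) (t * Complex.I) ∂volume ∂(axisMeasure q)) -
          ∫ t : ℝ, ∫ x : ℝ, ψ (x + (-d : ℝ) * Complex.I) (t * Complex.I) ∂volume
            ∂(axisMeasure q))) := fun ψ j1 j2 => by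
    rw [segmentIntegral_eq_setIntegral (pi_div_log_neg q).le]
    simp only [hc]
    rw [integral_const_mul, integral_sub j1 j2]
  refine ⟨by simp only [hc]; exact (i1.sub i2).const_mul _, ?_⟩
  rw [hseg ψ i1 i2]
  refine (((t1.sub t2).const_mul _).const_mul _).congr' ?_
  filter_upwards [hs] with n hn
  have k := fun {d : ℝ} (hd : ∀ x : ℝ, onLines q (x + d * Complex.I)) =>
    (tendsto_integral_line G m c hS hd (s := fun _ => s n) (Eventually.of_forall fun _ => hn)
      (fun u _ v => tendsto_const_nhds (x := dblIntegrand G q m c (s n) u v))).1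
  exact (hseg _ (k (onLines_add q)) (k h2)).symm

omit hq in
lemma segmentIntegral_symmetrize {T : ℝ} {f : ℂ → ℂ}
    (hf : IntervalIntegrable (fun t : ℝ => f (t * Complex.I)) volume (-T) T) :
    segmentIntegral T f = 1 / 2 * segmentIntegral T fun v => f v + f (-v) := by
  have h1 : IntervalIntegrable (fun t : ℝ => f (-(t * Complex.I))) volume (-T) T := by
    have := (IntervalIntegrable.iff_comp_neg (f := fun t : ℝ => f (t * Complex.I))).1 hf
    simpa using this.symm
  have h2 : ∫ t in (-T)..T, f (-(t * Complex.I)) = ∫ t in (-T)..T, f (t * Complex.I) := by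
    have := intervalIntegral.integral_comp_neg (a := -T) (b := T) fun t : ℝ => f (t * Complex.I)
    simpa using this
  simp only [segmentIntegral, intervalIntegral.integral_mul_const]
  rw [intervalIntegral.integral_add hf h1, h2]
  ring

end


/-! ### The expression in braces for finitely many exponents. -/

open MeasureTheory

lemma segmentIntegral_congr_ae {T : ℝ} (hT : T ≤ 0) {f g : ℂ → ℂ}
    (h : ∀ᵐ t : ℝ, t ∈ Ioc T (-T) → f (t * Complex.I) = g (t * Complex.I)) :
    segmentIntegral T f = segmentIntegral T g := by
  rw [segmentIntegral_eq_setIntegral hT, segmentIntegral_eq_setIntegral hT,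
    setIntegral_congr_ae measurableSet_Ioc h]

lemma segmentIntegral_sub {T : ℝ} {f g : ℂ → ℂ}
    (hf : IntervalIntegrable (fun t : ℝ => f (t * Complex.I)) volume (-T) T)
    (hg : IntervalIntegrable (fun t : ℝ => g (t * Complex.I)) volume (-T) T) :
    segmentIntegral T (fun v => f v - g v) = segmentIntegral T f - segmentIntegral T g := by
  simp only [segmentIntegral, intervalIntegral.integral_mul_const]
  rw [intervalIntegral.integral_sub hf hg]
  ring

section

variable {G : ClassicalType} {q : ℝ} [hq : Fact (0 < q ∧ q < 1)]

lemma singleFactor_eq (G : ClassicalType) (m : ℕ) (v : ℂ) :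
    singleFactor G q m v = sgn G * (Complex.exp (Real.log q * v * (m + eps G)) +
      sgn G * Complex.exp (-(Real.log q * v * (m + eps G)))) := by
  cases G <;> simp only [singleFactor, sgn, eps, cpow_eq_exp] <;> push_cast <;> ring_nf

omit hq in
lemma eval_weylPoly_mul_rho_mul_inv_den (m : ℕ) {w : ℂ} (hw : den G w ≠ 0) :
    (weylPoly G m).eval (ch w) * rho G (ch w) * (den G w)⁻¹ =
      -sgn G * (Complex.exp (w * (m + eps G)) + sgn G * Complex.exp (-(w * (m + eps G)))) := by
  rw [exp_add_eq_den_mul, rho_ch]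
  field_simp

/-- The integrand of the single integral, cut off at the ends of its segment. -/
def cutSingle (G : ClassicalType) (q : ℝ) (m : ℕ) (c v : ℂ) : ℂ :=
  if |Real.log q * v.im| < Real.pi / 2 then Complex.exp (c * v) * singleFactor G q m v else 0

lemma cutSingle_mul_I (m : ℕ) (c : ℂ) : (fun t : ℝ => cutSingle G q m c (t * Complex.I)) =
    indicator (Ioo (Real.pi / (2 * Real.log q)) (-(Real.pi / (2 * Real.log q))))
      fun t : ℝ => Complex.exp (c * (t * Complex.I)) * singleFactor G q m (t * Complex.I) := by
  have hL := log_q_neg q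
  funext t
  have h : |Real.log q * t| < Real.pi / 2 ↔
      t ∈ Ioo (Real.pi / (2 * Real.log q)) (-(Real.pi / (2 * Real.log q))) := by
    have e : Real.pi / (2 * Real.log q) = -(Real.pi / 2 / -Real.log q) := by
      have := hL.ne; field_simp
    rw [mem_Ioo, e, neg_neg, ← abs_lt, abs_mul, abs_of_neg hL]
    exact (lt_div_iff₀' (by linarith)).symm
  rw [cutSingle, show ((t : ℂ) * Complex.I).im = t by simp]
  by_cases ht : |Real.log q * t| < Real.pi / 2
  · rw [if_pos ht, indicator_of_mem (h.1 ht)]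
  · rw [if_neg ht, indicator_of_notMem (fun h' => ht (h.2 h'))]

lemma continuous_single (m : ℕ) (c : ℂ) : Continuous fun t : ℝ =>
    Complex.exp (c * (t * Complex.I)) * singleFactor G q m (t * Complex.I) := by
  simp only [singleFactor_eq]
  fun_prop

lemma intervalIntegrable_cutSingle (m : ℕ) (c : ℂ) (a b : ℝ) :
    IntervalIntegrable (fun t : ℝ => cutSingle G q m c (t * Complex.I)) volume a b := by
  rw [cutSingle_mul_I, intervalIntegrable_iff]
  exact (((continuous_single m c).intervalIntegrable a b).def').indicator measurableSet_Ioo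

lemma segmentIntegral_cutSingle (m : ℕ) (c : ℂ) :
    segmentIntegral (Real.pi / Real.log q) (cutSingle G q m c) =
      segmentIntegral (Real.pi / (2 * Real.log q)) fun v =>
        Complex.exp (c * v) * singleFactor G q m v := by
  have h0 := pi_div_log_neg q
  have h1 : Real.pi / (2 * Real.log q) = Real.pi / Real.log q / 2 := by
    rw [mul_comm, div_div]
  rw [segmentIntegral_eq_setIntegral h0.le, segmentIntegral_eq_setIntegral (by linarith),
    cutSingle_mul_I, setIntegral_indicator measurableSet_Ioo,
    inter_eq_right.2 (Ioo_subset_Ioc_self.trans (Ioc_subset_Ioc (by linarith) (by linarith))),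
    integral_Ioc_eq_integral_Ioo]

/-- The contribution of the poles u = ±v is -1/ln q times the symmetrization of the integrand of the
single integral. The cutoff records whether these poles are inside the contour. -/
lemma eval_weylPoly_mul_rho_mul_ite (m : ℕ) (c : ℂ) {t : ℝ} (ht : Real.sin (Real.log q * t) ≠ 0) :
    (weylPoly G m).eval (ch (Real.log q * (t * Complex.I))) *
        rho G (ch (Real.log q * (t * Complex.I))) *
      ((den G (Real.log q * (t * Complex.I)))⁻¹ * (if |Real.log q * t| < Real.pi / 2 then
        (Complex.exp (c * (t * Complex.I)) + sgn G * Complex.exp (-(c * (t * Complex.I)))) /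
          Real.log q else 0)) =
    -(1 / (Real.log q : ℂ)) * (cutSingle G q m c (t * Complex.I) +
      cutSingle G q m c (-(t * Complex.I))) := by
  rw [← mul_assoc, eval_weylPoly_mul_rho_mul_inv_den m (den_mul_I_ne_zero G ht), cutSingle,
    cutSingle, show ((t : ℂ) * Complex.I).im = t by simp,
    show (-((t : ℂ) * Complex.I)).im = -t by simp, mul_neg, abs_neg]
  split_ifs
  · rw [singleFactor_eq, singleFactor_eq, mul_neg c, mul_neg (Real.log q : ℂ),
      neg_mul (Real.log q * (t * Complex.I) : ℂ), neg_neg (Real.log q * (t * Complex.I) * _ : ℂ)]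
    have := sgn_mul_self G
    linear_combination (-sgn G * Complex.exp (-(Real.log q * (t * Complex.I) * (m + eps G))) *
      Complex.exp (-(c * (t * Complex.I))) / Real.log q) * this
  · ring

/-- The expression in braces for a finite set of exponents. -/
lemma brace_finset (G : ClassicalType) (m : ℕ) (c : ℂ) {S s : Finset ℕ}
    (hS : ‖c‖ + 3 * |Real.log q| + 1 ≤ S.card * |Real.log q|) (hSs : S ⊆ s) (hs : s.Nonempty) :
    segmentIntegral (Real.pi / Real.log q) (fun v =>
        contourIntegral q fun u => dblIntegrand G q m c s u v) +
      1 / (Real.log q : ℂ) * segmentIntegral (Real.pi / (2 * Real.log q)) (fun v =>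
        Complex.exp (c * v) * singleFactor G q m v) =
    wnorm G m / (Real.log q : ℂ) ^ 2 * (den G c / dn G q m) * hfun G q m s (ch c) := by
  have hL := log_q_neg q
  have hLc : (Real.log q : ℂ) ≠ 0 := by exact_mod_cast hL.ne
  have hT := pi_div_log_neg q
  set T := Real.pi / Real.log q with hTdef
  set J : ℂ → ℂ := fun v => contourIntegral q fun u => dblIntegrand G q m c s u v with hJ
  set k : ℕ → ℂ := fun β => (Complex.exp (c * (β + eps G)) +
    sgn G * Complex.exp (-(c * (β + eps G)))) / Real.log q / dn G q β with hk
  set w : ℕ → ℂ → ℂ := fun β v => (weylPoly G m).eval (ch (Real.log q * v)) *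
    rho G (ch (Real.log q * v)) * lag G q s β (ch (Real.log q * v)) with hw
  have hwc : ∀ β, Continuous fun t : ℝ => w β (t * Complex.I) := fun β =>
    continuous_coef_integrand m (continuous_lag_finset s β)
  have hJi : IntervalIntegrable (fun t : ℝ => J (t * Complex.I)) volume (-T) T := by
    have := (tendsto_segmentIntegral_contourIntegral G m c hS (s := fun _ => s)
      (Eventually.of_forall fun _ => hSs)
      (fun u _ v => tendsto_const_nhds (x := dblIntegrand G q m c s u v))).1
    exact ((intervalIntegrable_iff_integrableOn_Ioc_of_le (by linarith)).2 this).symm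
  -- After symmetrization the first term comes from the poles u = ±v and the sum from the nodes; the
  -- excluded values of t form a null set.
  have h1 : segmentIntegral T (fun v => J v + J (-v)) = segmentIntegral T fun v =>
      -(1 / (Real.log q : ℂ)) * (cutSingle G q m c v + cutSingle G q m c (-v)) -
        ∑ β ∈ s, k β * w β v := by
    refine segmentIntegral_congr_ae hT.le ?_
    filter_upwards [ae_sin_ne_zero (q := q)] with t ht htm
    rw [mul_assoc] at ht
    have habs : |Real.log q * t| ≤ Real.pi := by
      have : |t| ≤ -T := abs_le.2 ⟨by linarith [htm.1], htm.2⟩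
      rw [abs_mul, abs_of_neg hL]
      calc -Real.log q * |t| ≤ -Real.log q * -T := by gcongr; linarith
        _ = Real.pi := by rw [hTdef]; have := hL.ne; field_simp
    have := contourIntegral_dblIntegrand_add G m c hS hSs hs ht habs
    simp only [hJ]
    rw [this, mul_sub, eval_weylPoly_mul_rho_mul_ite m c (sin_ne_zero_of_sin_two ht),
      Finset.mul_sum]
    congr 1
    refine Finset.sum_congr rfl fun β _ => ?_
    simp only [hk, hw]
    ring
  have hneg : IntervalIntegrable (fun t : ℝ => cutSingle G q m c (-(t * Complex.I)))
      volume (-T) T := by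
    have := (IntervalIntegrable.iff_comp_neg
      (f := fun t : ℝ => cutSingle G q m c (t * Complex.I))).1
        (intervalIntegrable_cutSingle m c (-T) T)
    simpa using this.symm
  have h2 : segmentIntegral T (fun v =>
      -(1 / (Real.log q : ℂ)) * (cutSingle G q m c v + cutSingle G q m c (-v)) -
        ∑ β ∈ s, k β * w β v) = -(1 / (Real.log q : ℂ)) * (2 * segmentIntegral T
          (cutSingle G q m c)) - ∑ β ∈ s, k β * segmentIntegral T (w β) := by
    rw [segmentIntegral_sub (((intervalIntegrable_cutSingle m c _ _).add hneg).const_mul _)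
      ((continuous_finsetSum s fun β _ =>
        continuous_const.mul (hwc β)).intervalIntegrable _ _), segmentIntegral_const_mul,
      segmentIntegral_sum T s (f := fun β v => k β * w β v)
        fun β _ => continuous_const.mul (hwc β),
      segmentIntegral_symmetrize (intervalIntegrable_cutSingle m c _ _)]
    simp only [segmentIntegral_const_mul]
    ring
  have h3 : ∀ β, segmentIntegral T (w β) =
      -(2 * wnorm G m / Real.log q) * coef G q m (lag G q s β) := fun β => by
    have := wnorm_ne_zero G m
    rw [coef, ← hTdef]
    simp only [hw]
    field_simp
  rw [segmentIntegral_symmetrize hJi, h1, h2, segmentIntegral_cutSingle, hfun_finset]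
  simp only [h3, hk, exp_add_eq_den_mul]
  have hd := dn_ne_zero (G := G) (q := q) m
  rw [← mul_assoc (wnorm G m / (Real.log q : ℂ) ^ 2 * (den G c / dn G q m)), Finset.mul_sum,
    mul_sub, sub_eq_add_neg, Finset.mul_sum, ← Finset.sum_neg_distrib]
  -- The pole contribution cancels the single integral, leaving the sum over nodes.
  have h4 : ∀ a b : ℂ, ∀ Y Z : ℂ, Y = Z → 1 / 2 * (-(1 / a) * (2 * b)) + Y + 1 / a * b = Z := by
    intro a b Y Z h; rw [h]; ring
  refine h4 _ _ _ _ (Finset.sum_congr rfl fun β _ => ?_)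
  have hd2 := dn_ne_zero (G := G) (q := q) β
  field_simp

end


/-! ### The expression in braces for the infinite set of exponents. -/

open MeasureTheory

section

variable {G : ClassicalType} {q : ℝ} [hq : Fact (0 < q ∧ q < 1)]

lemma strictMono_add_self {y : ℕ → ℕ} (hy : Monotone y) : StrictMono fun i => y i + i :=
  hy.add_strictMono strictMono_id

/-- The first `n` elements of `charSet y`. -/
def charFinset (y : ℕ → ℕ) (n : ℕ) : Finset ℕ := (Finset.range n).image fun i => y i + i

omit hq in
lemma charFinset_mono (y : ℕ → ℕ) : Monotone (charFinset y) := fun _ _ h =>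
  Finset.image_subset_image (Finset.range_mono h)

omit hq in
lemma card_charFinset {y : ℕ → ℕ} (hy : Monotone y) (n : ℕ) : (charFinset y n).card = n := by
  rw [charFinset, Finset.card_image_of_injective _ (strictMono_add_self hy).injective,
    Finset.card_range]

omit hq in
lemma eventually_mem_charFinset_iff (y : ℕ → ℕ) (r : ℕ) :
    ∀ᶠ n in atTop, (r ∈ charFinset y n ↔ r ∈ charSet y) := by
  by_cases h : r ∈ charSet y
  · obtain ⟨i, hi⟩ := h
    filter_upwards [eventually_gt_atTop i] with n hn
    exact ⟨fun _ => ⟨i, hi⟩, fun _ => Finset.mem_image.2 ⟨i, Finset.mem_range.2 hn, hi⟩⟩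
  · refine Eventually.of_forall fun n => ⟨fun h' => ?_, fun h' => absurd h' h⟩
    obtain ⟨i, -, hi⟩ := Finset.mem_image.1 h'
    exact ⟨i, hi⟩

lemma one_sub_cpow_mul (r : ℕ) (y i : ℕ) (hr : r = y + i) (v : ℂ) :
    (1 - (q : ℂ) ^ ((y : ℂ) + i + eps G - v)) * (1 - (q : ℂ) ^ ((y : ℂ) + i + eps G + v)) =
      num G q r (ch (Real.log q * v)) := by
  have h : (y : ℂ) + i = (r : ℂ) := by rw [hr]; push_cast; rfl
  rw [num_ch, cpow_eq_exp, cpow_eq_exp, ← exp_log_mul, h, ← Complex.exp_add, ← Complex.exp_add]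
  ring_nf

/-- The factors are 1 + O(q^i), since the denominators are at least 1 in modulus on the lines, so
the infinite product is the limit of its partial products. -/
lemma tendsto_numRatio {y : ℕ → ℕ} (hy : Monotone y) {u : ℂ} (hu : onLines q u) (v : ℂ) :
    Tendsto (fun n => numRatio G q (charFinset y n) (ch (Real.log q * u)) (ch (Real.log q * v)))
      atTop (𝓝 (yProduct G q y u v)) := by
  set S := ch (Real.log q * u)
  set Z := ch (Real.log q * v)
  set f : ℕ → ℂ := fun i => num G q (y i + i) Z / num G q (y i + i) S with hf
  have h1 : yProduct G q y u v = ∏' i, f i := by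
    rw [yProduct]
    refine tprod_congr fun i => ?_
    rw [one_sub_cpow_mul _ _ _ rfl, one_sub_cpow_mul _ _ _ rfl]
  have h2 : ∀ n, numRatio G q (charFinset y n) S Z = ∏ i ∈ Finset.range n, f i := fun n => by
    rw [numRatio, charFinset, Finset.prod_image fun a _ b _ h =>
      (strictMono_add_self hy).injective h]
  have h3 : Summable fun i => ‖f i - 1‖ := by
    refine Summable.of_nonneg_of_le (fun _ => norm_nonneg _) (fun i => ?_)
      ((summable_geometric_of_lt_one (q_pos q).le (q_lt_one q)).mul_right ‖Z - S‖)
    have hS := num_ne_zero_of_onLines (G := G) (y i + i) hu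
    have e : f i - 1 = -qe G q (y i + i) * (Z - S) / num G q (y i + i) S := by
      simp only [hf]
      rw [div_sub_one hS, num_eq, num_eq]
      ring
    rw [e, norm_div, norm_mul, norm_neg, Complex.norm_real, Real.norm_of_nonneg (qe_pos _).le]
    refine (div_le_self (by have := qe_pos (G := G) (q := q) (y i + i); positivity)
      (le_norm_num_of_onLines _ hu).1).trans ?_
    refine mul_le_mul_of_nonneg_right ((qe_le _).trans ?_) (norm_nonneg _)
    exact pow_le_pow_of_le_one (q_pos q).le (q_lt_one q).le (Nat.le_add_left _ _)
  have h4 : Multipliable f := by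
    have := multipliable_one_add_of_summable h3
    simpa using this
  rw [h1]
  simp only [h2]
  exact h4.hasProd.tendsto_prod_nat

/-- The expression in braces in the definition of the one-variable function. -/
lemma brace_charSet (G : ClassicalType) (m : ℕ) (c : ℂ) {y : ℕ → ℕ} (hy : Monotone y) :
    segmentIntegral (Real.pi / Real.log q) (fun v => contourIntegral q fun u =>
        Complex.exp (c * u) * kernel G q m u v * yProduct G q y u v) +
      1 / (Real.log q : ℂ) * segmentIntegral (Real.pi / (2 * Real.log q)) (fun v =>
        Complex.exp (c * v) * singleFactor G q m v) =
    wnorm G m / (Real.log q : ℂ) ^ 2 * (den G c / dn G q m) * hfun G q m (charSet y) (ch c) := by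
  have hL : 0 < |Real.log q| := abs_pos.2 (log_q_neg q).ne
  -- The first N exponents already provide the decay required of S, and they belong to all later
  -- truncations.
  obtain ⟨N, hN⟩ := exists_nat_ge ((‖c‖ + 3 * |Real.log q| + 1) / |Real.log q|)
  have hS : ‖c‖ + 3 * |Real.log q| + 1 ≤ (charFinset y N).card * |Real.log q| := by
    rw [card_charFinset hy]
    rwa [div_le_iff₀ hL] at hN
  have hs : ∀ᶠ n in atTop, charFinset y N ⊆ charFinset y n := by
    filter_upwards [eventually_ge_atTop N] with n hn using charFinset_mono y hn
  have h1 := (tendsto_segmentIntegral_contourIntegral G m c hS hs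
    (ψ := fun u v => Complex.exp (c * u) * kernel G q m u v * yProduct G q y u v)
    fun u hu v => (tendsto_numRatio hy hu v).const_mul _).2
  have h2 := (tendsto_hfun (G := G) (q := q) (eventually_mem_charFinset_iff y)
    (charSet_infinite y) m (tendsto_const_nhds (x := ch c))).const_mul
      (wnorm G m / (Real.log q : ℂ) ^ 2 * (den G c / dn G q m))
  refine tendsto_nhds_unique (h1.add_const _) (h2.congr' ?_)
  filter_upwards [hs, eventually_gt_atTop 0] with n hn hn0
  refine (brace_finset G m c hS hn (Finset.card_pos.1 ?_)).symm
  rwa [card_charFinset hy]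

end


/-! ### The prefactor and the existence of the limit functions. -/

open MeasureTheory

section

variable {G : ClassicalType} {q : ℝ} [hq : Fact (0 < q ∧ q < 1)]

lemma tendsto_poch (a : ℂ) : Tendsto (poch q a) atTop (𝓝 (pochInf q a)) := by
  have h : Summable fun i : ℕ => ‖-(a * (q : ℂ) ^ i)‖ := by
    simp only [norm_neg, norm_mul, norm_pow, Complex.norm_real, Real.norm_of_nonneg (q_pos q).le]
    exact (summable_geometric_of_lt_one (q_pos q).le (q_lt_one q)).mul_left _
  have h2 := (multipliable_one_add_of_summable h).hasProd.tendsto_prod_nat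
  simp only [← sub_eq_add_neg] at h2
  exact h2

lemma pochInf_ne_zero {a : ℂ} (h : ∀ i : ℕ, 1 - a * (q : ℂ) ^ i ≠ 0) : pochInf q a ≠ 0 := by
  have e : pochInf q a = ∏' i : ℕ, (1 + -(a * (q : ℂ) ^ i)) := by
    simp only [pochInf, sub_eq_add_neg]
  rw [e]
  refine tprod_one_add_ne_zero_of_summable (fun i => by rw [← sub_eq_add_neg]; exact h i) ?_
  simp only [norm_neg, norm_mul, norm_pow, Complex.norm_real, Real.norm_of_nonneg (q_pos q).le]
  exact (summable_geometric_of_lt_one (q_pos q).le (q_lt_one q)).mul_left _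

/-- The numerator of the last factor of `prefactor`. -/
def phiNum (G : ClassicalType) (q : ℝ) (m : ℕ) : ℂ :=
  poch q ((q : ℂ) ^ ((m : ℂ) + 2 * eps G)) m * poch q ((q : ℂ) ^ (-(m : ℂ))) m * pochInf q q *
    pochInf q ((q : ℂ) ^ (2 * (m : ℂ) + 1 + 2 * eps G))

/-- The denominator of the last factor of `prefactor`. -/
def phiDen (G : ClassicalType) (q : ℝ) (m : ℕ) (x : ℂ) : ℂ :=
  poch q ((q : ℂ) ^ (eps G : ℂ) * x) m * poch q ((q : ℂ) ^ (eps G : ℂ) / x) m *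
    pochInf q ((q : ℂ) ^ ((m : ℂ) + 1 + eps G) * x) *
      pochInf q ((q : ℂ) ^ ((m : ℂ) + 1 + eps G) / x)

/-- One formula for the three types; the factor (2 - 1_{m=0})/2 of type D is 1 / `wnorm`. -/
lemma prefactor_eq (m : ℕ) {x : ℂ} (hx : x ≠ 0) : prefactor G q m x =
    (Real.log q : ℂ) ^ 2 / wnorm G m * (dn G q m / den G (Complex.log x)) * phiNum G q m /
      phiDen G q m x := by
  have hxe : ∀ a : ℂ, x ^ a = Complex.exp (Complex.log x * a) :=
    Complex.cpow_def_of_ne_zero hx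
  cases G
  · have e1 : dn .B q m / den .B (Complex.log x) =
        ((q : ℂ) ^ (((m : ℂ) + 1 / 2) / 2) - (q : ℂ) ^ (-(((m : ℂ) + 1 / 2) / 2))) /
        (x ^ (1 / 2 : ℂ) - x ^ (-(1 / 2) : ℂ)) := by
      rw [dn, den, den, cpow_eq_exp, cpow_eq_exp, hxe, hxe]
      simp only [eps]
      push_cast
      ring_nf
    have e2 : ((eps .B : ℝ) : ℂ) = 1 / 2 := by simp [eps]
    rw [e1, phiNum, phiDen, prefactor, wnorm, e2]
    ring_nf
    simp
  · have e1 : dn .C q m / den .C (Complex.log x) =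
        ((q : ℂ) ^ ((m : ℂ) + 1) - (q : ℂ) ^ (-((m : ℂ) + 1))) / (x - x⁻¹) := by
      rw [dn, den, den, cpow_eq_exp, cpow_eq_exp, Complex.exp_neg (Complex.log x),
        Complex.exp_log hx]
      simp only [eps]
      push_cast
      ring_nf
    have e2 : ((eps .C : ℝ) : ℂ) = 1 := by simp [eps]
    rw [e1, phiNum, phiDen, prefactor, wnorm, e2, Complex.cpow_one]
    ring_nf
    simp
  · have e2 : ((eps .D : ℝ) : ℂ) = 0 := by simp [eps]
    have e3 : ((2 : ℂ) - if m = 0 then 1 else 0) / 2 = 1 / wnorm .D m := by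
      rcases m with _ | m <;> norm_num [wnorm]
    rw [dn, den, den, phiNum, phiDen, prefactor, e2, Complex.cpow_zero]
    rw [show ((2 : ℂ) - if m = 0 then 1 else 0) * (Real.log q : ℂ) ^ 2 / 2 =
      (((2 : ℂ) - if m = 0 then 1 else 0) / 2) * (Real.log q : ℂ) ^ 2 by ring, e3]
    ring_nf

lemma prod_num_node_erase (m n : ℕ) :
    ∏ r ∈ (Finset.range (m + 1 + n)).erase m, num G q r (node G q m) =
      poch q ((q : ℂ) ^ ((m : ℂ) + 2 * eps G)) m * poch q ((q : ℂ) ^ (-(m : ℂ))) m * poch q q n *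
        poch q ((q : ℂ) ^ (2 * (m : ℂ) + 1 + 2 * eps G)) n := by
  rw [prod_range_erase _ (by omega), show m + 1 + n - 1 - m = n by omega, mul_assoc]
  congr 1
  · rw [poch, poch, ← Finset.prod_mul_distrib]
    refine Finset.prod_congr rfl fun r _ => ?_
    rw [num_node_cpow, cpow_mul_pow, cpow_mul_pow]
    ring_nf
  · rw [poch, poch, ← Finset.prod_mul_distrib]
    refine Finset.prod_congr rfl fun r _ => ?_
    have : (q : ℂ) * (q : ℂ) ^ r = (q : ℂ) ^ ((1 : ℂ) + r) := by
      rw [← cpow_mul_pow, Complex.cpow_one]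
    rw [num_node_cpow, cpow_mul_pow, this]
    push_cast
    ring_nf

/-- For finitely many nodes this is a regrouping of factors into Pochhammer symbols; let the number
of nodes grow. The q-factor of the prefactor is thus the reciprocal of the Lagrange function of all
nodes, so prefactor times braces equals h_m / L_m. -/
lemma lag_univ_mul_phiNum (m : ℕ) {x : ℂ} (hx : x ≠ 0) :
    lag G q univ m (jk x) * phiNum G q m = phiDen G q m x := by
  have h1 : Tendsto (fun n : ℕ => lag G q (Finset.range (m + 1 + n) : Finset ℕ) m (jk x)) atTop
      (𝓝 (lag G q univ m (jk x))) := by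
    refine tendsto_lag (fun r => ?_) m tendsto_const_nhds
    filter_upwards [eventually_ge_atTop r] with n hn
    simp only [Finset.coe_range, mem_Iio, mem_univ, iff_true]
    omega
  have h2 := h1.mul (((tendsto_poch (q := q) (q : ℂ)).const_mul
    (poch q ((q : ℂ) ^ ((m : ℂ) + 2 * eps G)) m * poch q ((q : ℂ) ^ (-(m : ℂ))) m)).mul
      (tendsto_poch (q := q) ((q : ℂ) ^ (2 * (m : ℂ) + 1 + 2 * eps G))))
  refine tendsto_nhds_unique h2 ?_
  have h3 := ((tendsto_poch (q := q) ((q : ℂ) ^ ((m : ℂ) + 1 + eps G) * x)).const_mul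
    (poch q ((q : ℂ) ^ (eps G : ℂ) * x) m * poch q ((q : ℂ) ^ (eps G : ℂ) / x) m)).mul
      (tendsto_poch (q := q) ((q : ℂ) ^ ((m : ℂ) + 1 + eps G) / x))
  refine h3.congr fun n => ?_
  rw [← prod_num_node_erase, lag_finset, ← Finset.prod_mul_distrib]
  have e : ∏ r ∈ (Finset.range (m + 1 + n)).erase m, num G q r (jk x) =
      ∏ r ∈ (Finset.range (m + 1 + n)).erase m, (num G q r (jk x) / num G q r (node G q m) *
        num G q r (node G q m)) := by
    refine Finset.prod_congr rfl fun r hr => ?_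
    rw [div_mul_cancel₀ _ (num_node_ne_zero (Finset.ne_of_mem_erase hr))]
  rw [← e, prod_range_erase _ (by omega), show m + 1 + n - 1 - m = n by omega, ← poch_mul_poch_div
    (m + 1) n hx]
  have e0 := poch_mul_poch_div (G := G) (q := q) 0 m hx
  simp only [Nat.cast_zero, zero_add] at e0
  rw [← e0]
  push_cast
  ring

lemma jk_ne_node {x : ℂ} (hx : x ∈ phiDomain G q) (r : ℕ) : jk x ≠ node G q r := by
  have hx0 : x ≠ 0 := Complex.slitPlane_ne_zero hx.1
  have hq0 : (q : ℂ) ≠ 0 := by exact_mod_cast (q_pos q).ne'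
  rw [Ne, ← num_eq_zero_iff, num_jk r hx0, mul_eq_zero, ← cpow_eq_qe, not_or]
  -- A node has two preimages, q^(r+ε) and its inverse. As 2ε is an integer, the inverse is again of
  -- the form q^(n+ε) and so excluded from the domain.
  have e : -((r : ℂ) + eps G) = ((-r - twoEps G : ℤ) : ℂ) + eps G := by
    push_cast; rw [twoEps_eq]; ring
  constructor
  · intro h
    refine hx.2.2 (-r - twoEps G) ?_
    rw [← e, Complex.cpow_neg]
    refine eq_inv_of_mul_eq_one_right ?_
    linear_combination -h
  · intro h
    refine hx.2.2 r ?_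
    rw [sub_eq_zero, eq_div_iff hx0, one_mul] at h
    exact_mod_cast h

omit hq in
lemma den_log_ne_zero {x : ℂ} (hx : x ∈ phiDomain G q) : den G (Complex.log x) ≠ 0 := by
  have hx0 : x ≠ 0 := Complex.slitPlane_ne_zero hx.1
  have h2 : Complex.exp (Complex.log x) = x := Complex.exp_log hx0
  cases G
  · intro h
    simp only [den] at h
    refine hx.2.1 ?_
    have e : Complex.exp (Complex.log x) =
        Complex.exp (Complex.log x / 2) * Complex.exp (Complex.log x / 2) := by
      rw [← Complex.exp_add]; ring_nf
    rw [← h2, e]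
    nth_rw 2 [sub_eq_zero.1 h]
    rw [← Complex.exp_add, add_neg_cancel, Complex.exp_zero]
  · intro h
    simp only [den] at h
    rw [Complex.exp_neg, h2, sub_eq_zero] at h
    replace h : x * x = 1 := by nth_rw 2 [h]; exact mul_inv_cancel₀ hx0
    rcases mul_self_eq_one_iff.1 h with h | h
    · exact hx.2.1 h
    · have := hx.1
      rw [h, Complex.mem_slitPlane_iff] at this
      rcases this with h | h <;> norm_num at h
  · exact one_ne_zero

lemma phiDen_ne_zero (m : ℕ) {x : ℂ} (hx : x ∈ phiDomain G q) : phiDen G q m x ≠ 0 := by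
  have hx0 : x ≠ 0 := Complex.slitPlane_ne_zero hx.1
  have key : ∀ r : ℕ, 1 - (q : ℂ) ^ ((r : ℂ) + eps G) * x ≠ 0 ∧
      1 - (q : ℂ) ^ ((r : ℂ) + eps G) / x ≠ 0 := fun r => by
    rw [cpow_eq_qe]
    have := jk_ne_node hx r
    rw [Ne, ← num_eq_zero_iff, num_jk r hx0, mul_eq_zero, not_or] at this
    exact this
  have k1 : ∀ i : ℕ, 1 - (q : ℂ) ^ (eps G : ℂ) * x * (q : ℂ) ^ i ≠ 0 := fun i => by
    rw [mul_right_comm, cpow_mul_pow, add_comm]; exact (key i).1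
  have k2 : ∀ i : ℕ, 1 - (q : ℂ) ^ (eps G : ℂ) / x * (q : ℂ) ^ i ≠ 0 := fun i => by
    rw [div_mul_eq_mul_div, cpow_mul_pow, add_comm]; exact (key i).2
  have e : ∀ i : ℕ, (m : ℂ) + 1 + eps G + i = ((m + 1 + i : ℕ) : ℂ) + eps G := fun i => by
    push_cast; ring
  refine mul_ne_zero (mul_ne_zero (mul_ne_zero ?_ ?_) ?_) ?_
  · exact Finset.prod_ne_zero_iff.2 fun i _ => k1 i
  · exact Finset.prod_ne_zero_iff.2 fun i _ => k2 i
  · refine pochInf_ne_zero fun i => ?_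
    rw [mul_right_comm, cpow_mul_pow, e]; exact (key _).1
  · refine pochInf_ne_zero fun i => ?_
    rw [div_mul_eq_mul_div, cpow_mul_pow, e]; exact (key _).2

lemma phiFormula_eq {y : ℕ → ℕ} (hy : Monotone y) (m : ℕ) {x E : ℂ} (hx : x ∈ phiDomain G q)
    (hE : hfun G q m (charSet y) (jk x) = E * lag G q univ m (jk x)) :
    phiFormula G q y m x = E := by
  have hx0 : x ≠ 0 := Complex.slitPlane_ne_zero hx.1
  have hL : (Real.log q : ℂ) ≠ 0 := by exact_mod_cast (log_q_neg q).ne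
  have h1 := brace_charSet (q := q) G m (Complex.log x) hy
  have hch : ch (Complex.log x) = jk x := by rw [← jk_exp, Complex.exp_log hx0]
  have h2 := lag_univ_mul_phiNum (G := G) (q := q) m hx0
  have h3 : lag G q univ m (jk x) ≠ 0 := lag_ne_zero fun r _ _ => jk_ne_node hx r
  have h4 := den_log_ne_zero hx
  have h5 := dn_ne_zero (G := G) (q := q) m
  have h6 := wnorm_ne_zero G m
  have h7 := phiDen_ne_zero m hx
  have hxe : ∀ a : ℂ, x ^ a = Complex.exp (Complex.log x * a) :=
    Complex.cpow_def_of_ne_zero hx0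
  rw [phiFormula]
  simp only [hxe]
  rw [h1, hch, hE, prefactor_eq m hx0]
  field_simp
  linear_combination E * h2

/-- The analytic continuation of the one-variable function is z ↦ E_m(z + 1/z) with E_m entire. -/
lemma exists_isPhi (G : ClassicalType) (q : ℝ) [Fact (0 < q ∧ q < 1)] {y : ℕ → ℕ}
    (hy : Monotone y) (k : ℕ) :
    ∃ Φ : (Fin k → ℂ) → ℂ, IsPhi G q y k Φ ∧
      ∀ lam : (N : ℕ) → Fin N → ℕ, (∀ N, Antitone (lam N)) → Stabilizes lam y →
        CharsConvergeTo G q lam k Φ := by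
  obtain ⟨E, hE, hEy⟩ := exists_entire (G := G) (q := q) y hy
  refine ⟨phiLimit G q k E, ⟨analyticOnNhd_phiLimit hE, fun m z => E m (jk z), fun m => ⟨?_, ?_⟩,
    fun x hx hV => phiLimit_eq_phiDet hE hx hV⟩, fun lam hlam hs => charsConvergeTo_phiLimit hE
      (charSet_infinite y) hEy hlam (eventually_mem_rowSet_iff hs) k⟩
  · intro z hz
    exact ((hE m).analyticAt _).comp (analyticAt_id.add (analyticAt_id.inv hz))
  · intro x hx
    exact (phiFormula_eq hy m hx (hEy m _)).symm

end


/-! ### A lower bound for the coefficients of index zero. -/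

open MeasureTheory

section

variable {G : ClassicalType} {q : ℝ} [hq : Fact (0 < q ∧ q < 1)]

lemma segmentIntegral_eval_exp (P : Polynomial ℂ) {k : ℤ} (hk : k ≠ 0) :
    segmentIntegral (Real.pi / Real.log q) (fun v => P.eval (Complex.exp (k * (Real.log q * v)))) =
      P.eval 0 * (Real.log q : ℂ)⁻¹ := by
  have h1 : ∀ v : ℂ, P.eval (Complex.exp (k * (Real.log q * v))) =
      ∑ i ∈ Finset.range (P.natDegree + 1),
        P.coeff i * Complex.exp (((k * i : ℤ) : ℂ) * (Real.log q * v)) := fun v => by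
    rw [Polynomial.eval_eq_sum_range]
    refine Finset.sum_congr rfl fun i _ => ?_
    rw [← Complex.exp_nat_mul]
    push_cast
    ring_nf
  simp only [h1]
  rw [segmentIntegral_sum (f := fun i v => P.coeff i *
    Complex.exp (((k * i : ℤ) : ℂ) * (Real.log q * v))) _ _ (fun i _ => by fun_prop)]
  simp only [segmentIntegral_const_mul, segmentIntegral_exp]
  rw [Finset.sum_eq_single 0]
  · simp [Polynomial.coeff_zero_eq_eval_zero]
  · intro i _ hi
    rw [if_neg (mul_ne_zero hk (by exact_mod_cast hi)), mul_zero]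
  · simp

/-- A polynomial whose squared modulus on the unit circle is proportional to the product of
`-rho` and of factors `num`. -/
def outerPoly (G : ClassicalType) (q : ℝ) (t : Finset ℕ) : Polynomial ℂ :=
  (∏ r ∈ t, (1 - Polynomial.C (qe G q r : ℂ) * Polynomial.X)) *
    match G with
    | .B => 1 - Polynomial.X
    | .C => 1 - Polynomial.X ^ 2
    | .D => 1

omit hq in
lemma eval_zero_outerPoly (t : Finset ℕ) : (outerPoly G q t).eval 0 = 1 := by
  cases G <;> simp [outerPoly, Polynomial.eval_prod]

omit hq in
lemma rho_mul_prod_num (t : Finset ℕ) (w : ℂ) :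
    (weylPoly G 0).eval (ch w) * rho G (ch w) * ∏ r ∈ t, num G q r (ch w) =
      -wnorm G 0 * ((outerPoly G q t).eval (Complex.exp w) *
        (outerPoly G q t).eval (Complex.exp (-w))) := by
  have h : Complex.exp w * Complex.exp (-w) = 1 := by rw [← Complex.exp_add]; simp
  simp only [num_ch, Finset.prod_mul_distrib]
  cases G <;>
    simp [outerPoly, Polynomial.eval_prod, weylPoly, rho, wnorm, ch] <;>
    set a := ∏ r ∈ t, (1 - _ * Complex.exp w) <;>
    set b := ∏ r ∈ t, (1 - _ * Complex.exp (-w))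
  · linear_combination (a * b) * h
  · linear_combination (a * b) * (Complex.exp w * Complex.exp (-w) + 3) * h

omit hq in
lemma eval_outerPoly_exp_neg (t : Finset ℕ) (a : ℝ) :
    (outerPoly G q t).eval (Complex.exp (-(a * Complex.I))) =
      (starRingEnd ℂ) ((outerPoly G q t).eval (Complex.exp (a * Complex.I))) := by
  have h : Complex.exp (-(a * Complex.I)) = (starRingEnd ℂ) (Complex.exp (a * Complex.I)) := by
    rw [← Complex.exp_conj, map_mul, Complex.conj_ofReal, Complex.conj_I, mul_neg]
  rw [h]
  cases G <;> simp [outerPoly, Polynomial.eval_prod]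

/-- On the unit circle the integrand is, up to a constant, |F|² for a polynomial F with F(0) = 1.
Its mean is 1 plus the mean of |F - 1|², hence at least |F(0)|² = 1, whatever the set t. -/
lemma half_le_norm_coef_prod_num (t : Finset ℕ) :
    1 / 2 ≤ ‖coef G q 0 fun Z => ∏ r ∈ t, num G q r Z‖ := by
  have hL := log_q_neg q
  have hLc : (Real.log q : ℂ) ≠ 0 := by exact_mod_cast hL.ne
  have hT := pi_div_log_neg q
  have hw := wnorm_ne_zero G 0
  set T := Real.pi / Real.log q with hTdef
  set F := outerPoly G q t with hF
  have h1 : coef G q 0 (fun Z => ∏ r ∈ t, num G q r Z) = Real.log q / 2 *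
      segmentIntegral T fun v => F.eval (Complex.exp (Real.log q * v)) *
        F.eval (Complex.exp (-(Real.log q * v))) := by
    simp only [coef, rho_mul_prod_num]
    rw [segmentIntegral_const_mul, ← hTdef, ← hF]
    field_simp
  have c1 : Continuous fun t : ℝ => F.eval (Complex.exp (Real.log q * (t * Complex.I))) :=
    F.continuous.comp (by fun_prop)
  have c2 : Continuous fun t : ℝ => F.eval (Complex.exp (-(Real.log q * (t * Complex.I)))) :=
    F.continuous.comp (by fun_prop)
  have i1 := segmentIntegral_eval_exp (q := q) F (k := 1) one_ne_zero
  have i2 := segmentIntegral_eval_exp (q := q) F (k := -1) (by norm_num)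
  have i3 := segmentIntegral_exp (q := q) 0
  simp only [Int.cast_one, one_mul, Int.cast_neg, neg_mul, Int.cast_zero, zero_mul,
    Complex.exp_zero, if_true, ← hTdef, hF, eval_zero_outerPoly] at i1 i2 i3
  rw [← hF] at i1 i2
  have h2 : (segmentIntegral T fun v => (F.eval (Complex.exp (Real.log q * v)) - 1) *
      (F.eval (Complex.exp (-(Real.log q * v))) - 1)) = (segmentIntegral T fun v =>
        F.eval (Complex.exp (Real.log q * v)) * F.eval (Complex.exp (-(Real.log q * v)))) -
          (Real.log q : ℂ)⁻¹ := by
    have e : ∀ v : ℂ, (F.eval (Complex.exp (Real.log q * v)) - 1) *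
        (F.eval (Complex.exp (-(Real.log q * v))) - 1) =
        (F.eval (Complex.exp (Real.log q * v)) * F.eval (Complex.exp (-(Real.log q * v))) -
          F.eval (Complex.exp (Real.log q * v))) -
          (F.eval (Complex.exp (-(Real.log q * v))) - 1) := fun v => by ring
    simp only [e]
    rw [segmentIntegral_sub (((c1.mul c2).sub c1).intervalIntegrable _ _)
      ((c2.sub continuous_const).intervalIntegrable _ _), segmentIntegral_sub
      ((c1.mul c2).intervalIntegrable _ _) (c1.intervalIntegrable _ _), segmentIntegral_sub
      (c2.intervalIntegrable _ _) (continuous_const.intervalIntegrable _ _), i1, i2, i3]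
    ring
  have h3 : (segmentIntegral T fun v => (F.eval (Complex.exp (Real.log q * v)) - 1) *
      (F.eval (Complex.exp (-(Real.log q * v))) - 1)) = ((-(2 * Real.pi)⁻¹ *
        ∫ t in Ioc T (-T), ‖F.eval (Complex.exp (Real.log q * (t * Complex.I))) - 1‖ ^ 2 : ℝ) :
          ℂ) := by
    rw [segmentIntegral_eq_setIntegral hT.le]
    push_cast
    rw [← integral_complex_ofReal]
    congr 1
    refine integral_congr_ae (Eventually.of_forall fun t => ?_)
    simp only
    rw [show (Real.log q : ℂ) * (t * Complex.I) = ((Real.log q * t : ℝ) : ℂ) * Complex.I by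
      push_cast; ring, hF, eval_outerPoly_exp_neg]
    push_cast
    rw [← Complex.mul_conj', map_sub, map_one]
  set J := ∫ t in Ioc T (-T), ‖F.eval (Complex.exp (Real.log q * (t * Complex.I))) - 1‖ ^ 2
  have hJ : 0 ≤ J := integral_nonneg fun t => by positivity
  rw [h3] at h2
  have h4 : coef G q 0 (fun Z => ∏ r ∈ t, num G q r Z) =
      ((1 / 2 + Real.log q / 2 * (-(2 * Real.pi)⁻¹ * J) : ℝ) : ℂ) := by
    rw [h1, sub_eq_iff_eq_add.1 h2.symm]
    push_cast
    field_simp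
    ring
  rw [h4, Complex.norm_real]
  refine le_trans ?_ (Real.le_norm_self _)
  have : 0 ≤ (2 * Real.pi)⁻¹ * J := by positivity
  nlinarith

/-- A positive lower bound for the coefficient of index `0` of the Lagrange polynomials. -/
lemma exists_le_norm_coef_lag (G : ClassicalType) (q : ℝ) [hq : Fact (0 < q ∧ q < 1)] (β : ℕ) :
    ∃ c > 0, ∀ s : Finset ℕ, c ≤ ‖coef G q 0 (lag G q s β)‖ := by
  refine ⟨(Real.exp ((‖node G q β‖ + 1) * (1 - q)⁻¹))⁻¹ * (1 / 2), by positivity, fun s => ?_⟩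
  have h1 : lag G q s β = fun Z => ∑ _i ∈ ({0} : Finset ℕ),
      (∏ r ∈ s.erase β, num G q r (node G q β))⁻¹ * ∏ r ∈ s.erase β, num G q r Z := by
    funext Z
    rw [Finset.sum_singleton, lag_finset, Finset.prod_div_distrib]
    ring
  rw [h1, coef_sum 0 _ _ (fun _ _ => continuous_finsetProd _ fun r _ => continuous_num r),
    Finset.sum_singleton, norm_mul, norm_inv, norm_prod]
  refine mul_le_mul (inv_anti₀ (Finset.prod_pos fun r hr => norm_pos_iff.2
    (num_node_ne_zero (Finset.ne_of_mem_erase hr))) (prod_norm_num_le _ _))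
    (half_le_norm_coef_prod_num _) (by norm_num) (by positivity)

end


/-! ### Convergence in one variable determines the limiting exponents. -/

open MeasureTheory

/-- The two solutions are reciprocal, so one has modulus at least 1, and then |x| ≤ |Z| + 1. A
compact annulus in ℂ* thus covers the disc on which `coef` is controlled. -/
lemma exists_jk_eq {Z : ℂ} (hZ : ‖Z‖ ≤ 2) : ∃ x : ℂ, 1 ≤ ‖x‖ ∧ ‖x‖ ≤ 3 ∧ jk x = Z := by
  obtain ⟨s, hs⟩ := IsAlgClosed.exists_pow_nat_eq (Z ^ 2 - 4) (n := 2) (by norm_num)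
  have h1 : ((Z + s) / 2) ^ 2 - Z * ((Z + s) / 2) + 1 = 0 := by linear_combination hs / 4
  have h2 : (Z + s) / 2 ≠ 0 := fun h => by rw [h] at h1; norm_num at h1
  have key : ∀ x : ℂ, jk x = Z → 1 ≤ ‖x‖ → ∃ x : ℂ, 1 ≤ ‖x‖ ∧ ‖x‖ ≤ 3 ∧ jk x = Z := by
    intro x hx h
    refine ⟨x, h, ?_, hx⟩
    have e : x = Z - x⁻¹ := by rw [← hx, jk]; ring
    have h3 : ‖x⁻¹‖ ≤ 1 := by rw [norm_inv]; exact inv_le_one_of_one_le₀ h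
    rw [e]
    exact (norm_sub_le _ _).trans (by linarith)
  have h3 : jk ((Z + s) / 2) = Z := (jk_eq_iff h2).2 h1
  rcases le_total 1 ‖(Z + s) / 2‖ with h | h
  · exact key _ h3 h
  · refine key ((Z + s) / 2)⁻¹ (by rw [jk, inv_inv, add_comm]; exact h3) ?_
    rw [norm_inv]
    exact (one_le_inv₀ (norm_pos_iff.2 h2)).2 h

section

variable {G : ClassicalType} {q : ℝ} [hq : Fact (0 < q ∧ q < 1)]

lemma hfun_zero_eq {N : ℕ} (hN : 0 < N) {lam : Fin N → ℕ} (hlam : Antitone lam) {x : ℂ}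
    (hx : x ≠ 0) : hfun G q 0 (rowSet lam) (jk x) =
      normalizedChar G q lam (fun _ : Fin 1 => x) * lag G q (Finset.range N) 0 (jk x) := by
  obtain ⟨P, hP⟩ := exists_hfun_eq_eval_mul (G := G) (q := q) (rows_injective hlam) ⟨0, hN⟩
  have hx' : (fun _ : Fin 1 => x) ∈ punctured 1 := fun _ => hx
  obtain ⟨R, hR⟩ := exists_norm_jk_lt fun _ : Fin 1 => x
  have h1 := normalizedChar_eq_altQuot (G := G) (q := q) hN hlam (E := fun _ => P)
    (fun n hn X => by
      obtain rfl : n = 0 := by omega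
      exact hP X) hx' hR
  have h2 := altQuot_mul_vdm (p := fun n X => P.eval X * lag G q (Finset.range 1) n X)
    (X := fun _ : Fin 1 => jk x)
    (fun n => differentiable_mul_lag (E := fun _ X => P.eval X) (fun _ => P.differentiable) n)
    (Function.injective_of_subsingleton _) hR
  have e : ∀ X : Fin 1 → ℂ, vdm X = 1 := fun X => by
    simp [vdm]
  rw [e, mul_one] at h2
  rw [e, one_mul, h2] at h1
  have h3 : lag G q (Finset.range 1 : Finset ℕ) 0 (jk x) = 1 := by rw [lag_finset]; simp
  rw [h1, Matrix.det_unique, Matrix.of_apply, Fin.default_eq_zero, Fin.val_zero, h3, mul_one]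
  exact hP (jk x)

omit hq in
lemma continuous_hfun_finset (m : ℕ) (s : Finset ℕ) : Continuous (hfun G q m s) := by
  have : hfun G q m s = fun X => dn G q m * ∑ β ∈ s,
      (weylPoly G β).eval X / dn G q β * coef G q m (lag G q s β) :=
    funext fun X => hfun_finset m s X
  rw [this]
  exact continuous_const.mul (continuous_finsetSum _ fun β _ =>
    ((weylPoly G β).continuous.div_const _).mul continuous_const)

/-- This coefficient detects membership of β in the set of exponents. -/
lemma coef_hfun_zero (s : Finset ℕ) (β : ℕ) : coef G q β (hfun G q 0 s) =
    if β ∈ s then dn G q 0 / dn G q β * coef G q 0 (lag G q s β) else 0 := by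
  have h : hfun G q 0 s = fun X => ∑ b ∈ s,
      (dn G q 0 / dn G q b * coef G q 0 (lag G q s b)) * (fun X => (weylPoly G b).eval X) X := by
    funext X
    rw [hfun_finset, Finset.mul_sum]
    refine Finset.sum_congr rfl fun b _ => by ring
  rw [h, coef_sum _ _ _ fun b _ => (weylPoly G b).continuous]
  simp only [coef_weylPoly, mul_ite, mul_one, mul_zero, Finset.sum_ite_eq]

/-- For k = 1 the function h_0 is the normalized character times a convergent Lagrange function, so
it converges boundedly on the disc ‖Z‖ ≤ 2 and its coefficients converge. -/
lemma exists_tendsto_coef_hfun {lam : (N : ℕ) → Fin N → ℕ} (hlam : ∀ N, Antitone (lam N))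
    {f : (Fin 1 → ℂ) → ℂ} (hf : CharsConvergeTo G q lam 1 f) (β : ℕ) :
    ∃ a, Tendsto (fun N => coef G q β (hfun G q 0 (rowSet (lam N)))) atTop (𝓝 a) := by
  set K : Set (Fin 1 → ℂ) := (fun z : ℂ => fun _ : Fin 1 => z) ''
    (Metric.closedBall 0 3 \ Metric.ball 0 1) with hK
  have hKc : IsCompact K :=
    ((isCompact_closedBall (0 : ℂ) 3).diff Metric.isOpen_ball).image (by fun_prop)
  have hKp : K ⊆ punctured 1 := by
    rintro _ ⟨z, hz, rfl⟩ _
    rintro rfl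
    exact hz.2 (by simp)
  have hu := hf K hKc hKp
  have hcont : ContinuousOn f K := hu.continuousOn (Frequently.of_forall fun N x hx =>
    (analyticAt_normalizedChar (lam N) (hKp hx)).continuousAt.continuousWithinAt)
  obtain ⟨M, hM⟩ := hKc.exists_bound_of_continuousOn hcont
  choose! x hx1 hx3 hxZ using fun (Z : ℂ) (hZ : ‖Z‖ ≤ 2) => exists_jk_eq hZ
  have hxK : ∀ Z : ℂ, ‖Z‖ ≤ 2 → (fun _ : Fin 1 => x Z) ∈ K := fun Z hZ =>
    ⟨x Z, ⟨by simpa using hx3 Z hZ, by simpa using hx1 Z hZ⟩, rfl⟩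
  have hval : ∀ N, 0 < N → ∀ Z : ℂ, ‖Z‖ ≤ 2 → hfun G q 0 (rowSet (lam N)) Z =
      normalizedChar G q (lam N) (fun _ : Fin 1 => x Z) * lag G q (Finset.range N : Finset ℕ) 0 Z := by
    intro N hN Z hZ
    have := hfun_zero_eq (G := G) (q := q) hN (hlam N) (hKp (hxK Z hZ) 0)
    rwa [hxZ Z hZ] at this
  refine ⟨_, tendsto_coef (M := (M + 1) * lagBound q)
    (f := fun Z => f (fun _ => x Z) * lag G q univ 0 Z) β
    (Eventually.of_forall fun N => continuous_hfun_finset 0 _) ?_ ?_⟩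
  · have h1 := Metric.tendstoUniformlyOn_iff.1 hu 1 one_pos
    filter_upwards [h1, eventually_gt_atTop 0] with N h1 hN Z hZ
    rw [hval N hN Z hZ, norm_mul]
    have h2 := h1 _ (hxK Z hZ)
    have h3 := hM _ (hxK Z hZ)
    have h4 := norm_lag_le_of_norm_le_two (G := G) (q := q) (Finset.empty_subset (Finset.range N))
      0 hZ
    rw [Finset.prod_empty, mul_one] at h4
    have h5 := norm_le_norm_add_norm_sub' (normalizedChar G q (lam N) fun _ : Fin 1 => x Z)
      (f fun _ => x Z)
    rw [dist_comm, dist_eq_norm] at h2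
    exact mul_le_mul (by linarith) h4 (norm_nonneg _) (by linarith [norm_nonneg (f fun _ => x Z)])
  · intro Z hZ
    have h1 := hu.tendsto_at (hxK Z hZ)
    have h2 : Tendsto (fun N : ℕ => lag G q (Finset.range N : Finset ℕ) 0 Z) atTop
        (𝓝 (lag G q univ 0 Z)) := by
      refine tendsto_lag (fun r => ?_) 0 tendsto_const_nhds
      filter_upwards [eventually_gt_atTop r] with n hn
      simp [hn]
    refine (h1.mul h2).congr' ?_
    filter_upwards [eventually_gt_atTop 0] with N hN
    exact (hval N hN Z hZ).symm

/-- Convergence of the characters of one variable forces the sets of exponents to converge. -/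
lemma eventually_mem_or_eventually_notMem {lam : (N : ℕ) → Fin N → ℕ}
    (hlam : ∀ N, Antitone (lam N)) {f : (Fin 1 → ℂ) → ℂ} (hf : CharsConvergeTo G q lam 1 f)
    (β : ℕ) : (∀ᶠ N in atTop, β ∈ rowSet (lam N)) ∨ ∀ᶠ N in atTop, β ∉ rowSet (lam N) := by
  obtain ⟨a, ha⟩ := exists_tendsto_coef_hfun hlam hf β
  obtain ⟨c, hc0, hc⟩ := exists_le_norm_coef_lag G q β
  simp only [coef_hfun_zero] at ha
  have hd : dn G q 0 / dn G q β ≠ 0 := div_ne_zero (dn_ne_zero 0) (dn_ne_zero β)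
  -- Limit zero contradicts the uniform lower bound whenever β is present, so β is eventually
  -- absent; a nonzero limit forces presence.
  by_cases h : a = 0
  · right
    rw [h] at ha
    have h1 := ha.norm.eventually_lt_const (u := ‖dn G q 0 / dn G q β‖ * c) (by
      rw [norm_zero]; positivity)
    filter_upwards [h1] with N hN hmem
    rw [if_pos hmem, norm_mul] at hN
    have := hc (rowSet (lam N))
    exact absurd hN (not_lt.2 (by gcongr))
  · left
    filter_upwards [ha.eventually_ne h] with N hN
    by_contra hmem
    exact hN (if_neg hmem)

end


/-! ### Decay when the limiting set of exponents is finite. -/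

open MeasureTheory

section

variable {G : ClassicalType} {q : ℝ} [hq : Fact (0 < q ∧ q < 1)]

omit hq in
lemma exists_degree_le_prod_num (t : Finset ℕ) : ∃ P : Polynomial ℂ, P.degree ≤ t.card ∧
    ∀ Z, ∏ r ∈ t, num G q r Z = P.eval Z := by
  refine ⟨∏ r ∈ t, (Polynomial.C (-(qe G q r : ℂ)) * Polynomial.X +
    Polynomial.C (1 + (qe G q r : ℂ) ^ 2)), ?_, fun Z => ?_⟩
  · refine (Polynomial.degree_prod_le _ _).trans ?_
    refine (Finset.sum_le_card_nsmul _ _ 1 fun r _ => Polynomial.degree_linear_le).trans ?_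
    simp
  · rw [Polynomial.eval_prod]
    refine Finset.prod_congr rfl fun r _ => ?_
    simp [num]
    ring

lemma norm_prod_num_sub_one_le {t : Finset ℕ} {M : ℕ} (ht : ∀ r ∈ t, M ≤ r) {Z : ℂ}
    (hZ : ‖Z‖ ≤ 2) :
    ‖∏ r ∈ t, num G q r Z - 1‖ ≤ Real.exp (3 * (q ^ M * (1 - q)⁻¹)) - 1 := by
  have h1 := t.norm_prod_one_add_sub_one_le fun r => num G q r Z - 1
  simp only [add_sub_cancel] at h1
  refine h1.trans (sub_le_sub_right (Real.exp_le_exp.2 ?_) 1)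
  have h2 : ∀ r ∈ t, ‖num G q r Z - 1‖ ≤ 3 * (q ^ M * q ^ (r - M)) := by
    intro r hr
    have e : num G q r Z - 1 = qe G q r * (qe G q r - Z) := by rw [num]; ring
    have h3 : ‖(qe G q r : ℂ) - Z‖ ≤ 3 := by
      refine (norm_sub_le _ _).trans ?_
      rw [Complex.norm_real, Real.norm_of_nonneg (qe_pos r).le]
      linarith [qe_le_one (G := G) (q := q) r]
    rw [e, norm_mul, Complex.norm_real, Real.norm_of_nonneg (qe_pos r).le, ← pow_add,
      Nat.add_sub_cancel' (ht r hr), mul_comm]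
    have := qe_le (G := G) (q := q) r
    have := (qe_pos (G := G) (q := q) r).le
    gcongr
  refine (Finset.sum_le_sum h2).trans ?_
  rw [← Finset.mul_sum, ← Finset.mul_sum]
  have h0 := q_pos q
  have h4 := sum_pow_le (q := q) t (fun r => r - M) fun a ha b hb h => by
    have := ht a ha; have := ht b hb; simp only at h; omega
  gcongr

/-- The factor over A has degree below m, so its coefficient of index m vanishes. Only the deviation
from 1 of the product over far indices contributes, and it is small in M. One element b of s is kept
to have a factor q^β, making the bound summable in β. -/
lemma norm_coef_lag_le {A s : Finset ℕ} (hA : A ⊆ s) {m M b : ℕ} (hm : A.card < m)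
    (hM : ∀ r ∈ s \ A, M ≤ r) (hb : b ∈ s) (β : ℕ) :
    ‖coef G q m (lag G q s β)‖ ≤ Real.exp (4 * (1 - q)⁻¹ ^ 2) * (q ^ β / q ^ b) *
      (8 * 3 ^ m * (Real.exp (3 * (1 - q)⁻¹) * (Real.exp (3 * (q ^ M * (1 - q)⁻¹)) - 1))) := by
  have h0 := q_pos q
  set D := ∏ r ∈ s.erase β, num G q r (node G q β)
  set F : ℂ → ℂ := fun Z => ∏ r ∈ A.erase β, num G q r Z with hF
  set H : ℂ → ℂ := fun Z => ∏ r ∈ (s \ A).erase β, num G q r Z with hH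
  have hFc : Continuous F := continuous_finsetProd _ fun r _ => continuous_num r
  have hHc : Continuous H := continuous_finsetProd _ fun r _ => continuous_num r
  have h1 : lag G q s β = fun Z => ∑ i : Fin 2, D⁻¹ * (![fun Z => F Z * (H Z - 1), F] i) Z := by
    funext Z
    have : s.erase β = A.erase β ∪ (s \ A).erase β := by
      ext r
      have := @hA r
      simp only [Finset.mem_erase, Finset.mem_union, Finset.mem_sdiff]
      tauto
    have h2 : ∏ r ∈ s.erase β, num G q r Z = F Z * H Z := by
      rw [this, Finset.prod_union]
      rw [Finset.disjoint_left]
      intro r h3 h4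
      exact (Finset.mem_sdiff.1 (Finset.mem_of_mem_erase h4)).2 (Finset.mem_of_mem_erase h3)
    rw [lag_finset, Finset.prod_div_distrib, h2, Fin.sum_univ_two]
    simp only [Matrix.cons_val_zero, Matrix.cons_val_one]
    simp only [D]
    ring
  have hc : ∀ i ∈ (Finset.univ : Finset (Fin 2)),
      Continuous ((![fun Z => F Z * (H Z - 1), F] : Fin 2 → ℂ → ℂ) i) := by
    intro i _
    fin_cases i
    · exact hFc.mul (hHc.sub continuous_const)
    · exact hFc
  have hF0 : coef G q m F = 0 := by
    obtain ⟨P, hP, hPF⟩ := exists_degree_le_prod_num (G := G) (q := q) (A.erase β)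
    have : F = fun Z => P.eval Z := funext hPF
    rw [this]
    refine coef_eq_zero_of_degree_lt (hP.trans_lt ?_)
    exact_mod_cast (Finset.card_erase_le).trans_lt hm
  rw [h1, coef_sum _ _ _ hc, Fin.sum_univ_two]
  simp only [Matrix.cons_val_zero, Matrix.cons_val_one]
  rw [hF0, mul_zero, add_zero, norm_mul]
  refine mul_le_mul ?_ ?_ (norm_nonneg _) (by positivity)
  · have := prod_inv_norm_num_node_le (G := G) (q := q) (Finset.singleton_subset_iff.2 hb) β
    rw [Finset.prod_singleton] at this
    rw [norm_inv, norm_prod, ← Finset.prod_inv_distrib]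
    exact this
  · refine norm_coef_le m fun Z hZ => ?_
    rw [norm_mul]
    refine mul_le_mul ?_ (norm_prod_num_sub_one_le (fun r hr =>
      hM r (Finset.mem_of_mem_erase hr)) hZ) (norm_nonneg _) (by positivity)
    simp only [hF]
    rw [norm_prod]
    refine (prod_norm_num_le _ Z).trans (Real.exp_le_exp.2 ?_)
    have : 0 < (1 - q)⁻¹ := inv_pos.2 (by linarith [q_lt_one q])
    gcongr
    linarith

omit hq in
-- On the unit circle W_β is a bounded trigonometric numerator over the Weyl denominator, with no
-- growth in β. The single factor q^β of the coefficients then suffices.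
lemma norm_eval_weylPoly_mul_I_le (β : ℕ) {a : ℝ} (ha : den G (a * Complex.I) ≠ 0) :
    ‖(weylPoly G β).eval (ch (a * Complex.I))‖ ≤ 2 / ‖den G (a * Complex.I)‖ := by
  rw [le_div_iff₀' (norm_pos_iff.2 ha), ← norm_mul, ← exp_add_eq_den_mul]
  refine (norm_add_le _ _).trans ?_
  have hs : ‖sgn G‖ = 1 := by cases G <;> simp [sgn]
  have e1 : (a : ℂ) * Complex.I * (β + eps G) = ((a * (β + eps G) : ℝ) : ℂ) * Complex.I := by
    push_cast; ring
  have e2 : -((a : ℂ) * Complex.I * (β + eps G)) = ((-(a * (β + eps G)) : ℝ) : ℂ) * Complex.I := by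
    push_cast; ring
  rw [norm_mul, hs, one_mul, e2, e1, Complex.norm_exp_ofReal_mul_I, Complex.norm_exp_ofReal_mul_I]
  norm_num

/-- If the sets of exponents converge to a finite set, the functions `hfun` of larger index tend
to zero on the unit circle. -/
lemma tendsto_hfun_zero {s : ℕ → Finset ℕ} {A : Finset ℕ}
    (hs : ∀ r, ∀ᶠ N in atTop, (r ∈ s N ↔ r ∈ A)) {m : ℕ} (hm : A.card < m) {a : ℝ}
    (ha : den G (a * Complex.I) ≠ 0) :
    Tendsto (fun N => hfun G q m (s N) (ch (a * Complex.I))) atTop (𝓝 0) := by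
  have h0 := q_pos q
  have h1 := q_lt_one q
  have hq1 : 0 < (1 - q)⁻¹ := inv_pos.2 (by linarith)
  have hdel := one_sub_exp_pos q
  set δ := (1 - Real.exp (Real.log q / 4))⁻¹ with hδ
  have hδ0 : 0 < δ := inv_pos.2 hdel
  set κ : ℕ → ℝ := fun M =>
    8 * 3 ^ m * (Real.exp (3 * (1 - q)⁻¹) * (Real.exp (3 * (q ^ M * (1 - q)⁻¹)) - 1)) with hκ
  have hκ0 : ∀ M, 0 ≤ κ M := fun M => by
    have : 0 ≤ Real.exp (3 * (q ^ M * (1 - q)⁻¹)) - 1 :=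
      sub_nonneg.2 (Real.one_le_exp (by positivity))
    positivity
  set C : ℝ := ‖dn G q m‖ * (2 / ‖den G (a * Complex.I)‖ * δ *
    (Real.exp (4 * (1 - q)⁻¹ ^ 2) * (1 - q)⁻¹)) with hC
  have key : ∀ (M : ℕ) (t : Finset ℕ), A ⊆ t → (∀ r ∈ t \ A, M ≤ r) →
      ‖hfun G q m t (ch (a * Complex.I))‖ ≤ C * κ M := by
    intro M t hAt hMt
    have hC0 : 0 ≤ C := by positivity
    rcases t.eq_empty_or_nonempty with rfl | hne
    · rw [hfun_finset, Finset.sum_empty, mul_zero, norm_zero]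
      exact mul_nonneg hC0 (hκ0 M)
    rw [hfun_finset, norm_mul]
    have hterm : ∀ β ∈ t, ‖(weylPoly G β).eval (ch (a * Complex.I)) / dn G q β *
        coef G q m (lag G q t β)‖ ≤ 2 / ‖den G (a * Complex.I)‖ * δ *
          (Real.exp (4 * (1 - q)⁻¹ ^ 2) * q ^ (β - t.min' hne) * κ M) := by
      intro β hβ
      have e1 := norm_eval_weylPoly_mul_I_le β ha
      have e2 := norm_inv_dn_le (G := G) (q := q) β
      -- Taking b to be the least exponent gives q^(β - min), whose sum over β is bounded
      -- independently of the set, even if all exponents escape to infinity.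
      have e3 := norm_coef_lag_le (G := G) (q := q) hAt hm hMt (t.min'_mem hne) β
      have e4 : q ^ β / q ^ (t.min' hne) = q ^ (β - t.min' hne) := by
        rw [div_eq_iff (by positivity), ← pow_add, Nat.sub_add_cancel (t.min'_le β hβ)]
      rw [e4] at e3
      rw [norm_mul, div_eq_mul_inv, norm_mul]
      exact mul_le_mul (mul_le_mul e1 e2 (norm_nonneg _) (by positivity)) e3 (norm_nonneg _)
        (by positivity)
    have hsum := sum_pow_le (q := q) t (fun β => β - t.min' hne) fun x hx y hy h => by
      have := t.min'_le x hx; have := t.min'_le y hy; simp only at h; omega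
    have h2 : ‖∑ β ∈ t, (weylPoly G β).eval (ch (a * Complex.I)) / dn G q β *
        coef G q m (lag G q t β)‖ ≤ 2 / ‖den G (a * Complex.I)‖ * δ *
          (Real.exp (4 * (1 - q)⁻¹ ^ 2) * (1 - q)⁻¹ * κ M) := by
      refine (norm_sum_le _ _).trans ((Finset.sum_le_sum hterm).trans ?_)
      rw [← Finset.mul_sum, ← Finset.sum_mul, ← Finset.mul_sum]
      have := hκ0 M
      gcongr
    calc _ ≤ ‖dn G q m‖ * (2 / ‖den G (a * Complex.I)‖ * δ *
          (Real.exp (4 * (1 - q)⁻¹ ^ 2) * (1 - q)⁻¹ * κ M)) :=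
          mul_le_mul_of_nonneg_left h2 (norm_nonneg _)
      _ = C * κ M := by rw [hC]; ring
  have hlim : Tendsto (fun M => C * κ M) atTop (𝓝 0) := by
    have e1 : Tendsto (fun M : ℕ => 3 * (q ^ M * (1 - q)⁻¹)) atTop (𝓝 (3 * (0 * (1 - q)⁻¹))) :=
      ((tendsto_pow_atTop_nhds_zero_of_lt_one h0.le h1).mul_const _).const_mul 3
    have e2 := ((((Real.continuous_exp.tendsto _).comp e1).sub_const 1).const_mul
      (Real.exp (3 * (1 - q)⁻¹))).const_mul (8 * 3 ^ m : ℝ) |>.const_mul C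
    simpa [hκ] using e2
  rw [NormedAddGroup.tendsto_nhds_zero]
  intro ε hε
  obtain ⟨M, hM⟩ := (hlim.eventually_lt_const hε).exists
  have h2 : ∀ᶠ N in atTop, ∀ r ∈ A ∪ Finset.range M, (r ∈ s N ↔ r ∈ A) :=
    (Filter.eventually_all_finset _).2 fun r _ => hs r
  filter_upwards [h2] with N hN
  refine (key M (s N) (fun r hr => ?_) fun r hr => ?_).trans_lt hM
  · exact (hN r (Finset.mem_union_left _ hr)).2 hr
  · by_contra hlt
    rw [Finset.mem_sdiff] at hr
    exact hr.2 ((hN r (Finset.mem_union_right _ (Finset.mem_range.2 (not_le.1 hlt)))).1 hr.1)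

end


/-! ### The limiting set of exponents is infinite. -/

open MeasureTheory

section

variable {G : ClassicalType} {q : ℝ} [hq : Fact (0 < q ∧ q < 1)]

/-- The point `(q^ε, …, q^(m-1+ε), x)`. -/
def lastPoint (G : ClassicalType) (q : ℝ) (m : ℕ) (x : ℂ) : Fin (m + 1) → ℂ :=
  fun j => if (j : ℕ) = m then x else (q : ℂ) ^ (((j : ℕ) : ℂ) + (eps G : ℂ))

lemma lastPoint_mem_punctured (m : ℕ) {x : ℂ} (hx : x ≠ 0) :
    lastPoint G q m x ∈ punctured (m + 1) := by
  intro j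
  rw [lastPoint]
  split_ifs
  · exact hx
  · rw [cpow_eq_qe]; exact qe_ne_zero _

lemma jk_lastPoint (m : ℕ) (x : ℂ) (j : Fin (m + 1)) : jk (lastPoint G q m x j) =
    if (j : ℕ) = m then jk x else node G q j := by
  rw [lastPoint]
  split_ifs
  · rfl
  · exact jk_cpow _

omit hq in
lemma continuous_lastPoint (m : ℕ) : Continuous (lastPoint G q m) := by
  refine continuous_pi fun j => ?_
  simp only [lastPoint]
  split_ifs
  · exact continuous_id
  · exact continuous_const

omit hq in
lemma det_eq_last {m : ℕ} {M : Matrix (Fin (m + 1)) (Fin (m + 1)) ℂ}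
    (hM : ∀ i j : Fin (m + 1), (j : ℕ) ≠ m → M i j = if (i : ℕ) = j then 1 else 0) :
    M.det = M (Fin.last m) (Fin.last m) := by
  have h : M.BlockTriangular id := fun i j hij => by
    have h1 : (j : ℕ) < i := hij
    rw [hM i j (by omega), if_neg (by omega)]
  rw [Matrix.det_of_isUpperTriangular h, Fin.prod_univ_castSucc, Finset.prod_eq_one, one_mul]
  intro i _
  have := i.isLt
  rw [hM _ _ (by rw [Fin.val_castSucc]; omega), if_pos rfl]

/-- With all variables but one at nodes, the other columns are unit vectors and the single entry of
index m remains. -/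
lemma normalizedChar_lastPoint_mul {N m : ℕ} (hm : m < N) {lam : Fin N → ℕ} (hlam : Antitone lam)
    {x : ℂ} (hx : x ≠ 0) (hxn : ∀ r, r ≠ m → jk x ≠ node G q r) :
    normalizedChar G q lam (lastPoint G q m x) * lag G q (Finset.range N) m (jk x) =
      hfun G q m (rowSet lam) (jk x) := by
  have h := normalizedChar_mul_det (G := G) (q := q) (show m + 1 ≤ N from hm) hlam
    (lastPoint_mem_punctured (G := G) (q := q) m hx) (by
      have e : ∀ i : Fin N, jk (specialPoint G q N (lastPoint G q m x) i) =
          if (i : ℕ) = m then jk x else node G q i := fun i => by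
        rw [jk_specialPoint]
        split_ifs with h1 h2 h2
        · rw [jk_lastPoint, if_pos h2]
        · rw [jk_lastPoint, if_neg h2]
        · omega
        · rfl
      intro i j hij
      simp only [e] at hij
      split_ifs at hij with h1 h2 h2
      · exact Fin.ext (h1.trans h2.symm)
      · exact absurd hij (hxn _ h2)
      · exact absurd hij.symm (hxn _ h1)
      · exact Fin.ext (node_injective hij))
  rw [det_eq_last, det_eq_last] at h
  · simpa [jk_lastPoint] using h
  · intro i j hj
    have hjN : (j : ℕ) < N := by omega
    have hiN : (i : ℕ) < N := by omega
    rw [Matrix.of_apply, jk_lastPoint, if_neg hj]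
    have := hfun_node (G := G) (q := q) (rows_injective hlam) ⟨i, hiN⟩ ⟨j, hjN⟩
    simpa [rowSet, Fin.ext_iff] using this
  · intro i j hj
    rw [Matrix.of_apply, jk_lastPoint, if_neg hj, lag_range_node (by omega)]

lemma normalizedChar_lastPoint_node {N m : ℕ} (hm : m < N) {lam : Fin N → ℕ}
    (hlam : Antitone lam) : normalizedChar G q lam (lastPoint G q m (qe G q m)) = 1 := by
  have e : jk (qe G q m : ℂ) = node G q m := by rw [← cpow_eq_qe, jk_cpow]
  have h := normalizedChar_lastPoint_mul (G := G) (q := q) hm hlam (x := qe G q m) (qe_ne_zero m)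
    (fun r hr h => hr (node_injective (h.symm.trans e)))
  have h2 := hfun_node (G := G) (q := q) (rows_injective hlam) ⟨m, hm⟩ ⟨m, hm⟩
  rw [e, lag_range_node hm, if_pos rfl, mul_one] at h
  rw [h]
  simpa [rowSet] using h2

/-- The limit in the last variable would be holomorphic on ℂ*, zero on the unit circle off ±1, and
equal to 1 at q^(m+ε), where the normalized character is 1 for every large N. -/
lemma not_charsConvergeTo_of_finite {lam : (N : ℕ) → Fin N → ℕ} (hlam : ∀ N, Antitone (lam N))
    {A : Finset ℕ} (hs : ∀ r, ∀ᶠ N in atTop, (r ∈ rowSet (lam N) ↔ r ∈ A))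
    {m : ℕ} (hm : A.card < m) {f : (Fin (m + 1) → ℂ) → ℂ} :
    ¬ CharsConvergeTo G q lam (m + 1) f := by
  intro hf
  have hL := (log_q_neg q).ne
  set g : ℂ → ℂ := fun x => f (lastPoint G q m x) with hg
  set F : ℕ → ℂ → ℂ := fun N x => normalizedChar G q (lam N) (lastPoint G q m x) with hF
  have hloc : TendstoLocallyUniformlyOn F g atTop {0}ᶜ := by
    rw [tendstoLocallyUniformlyOn_iff_forall_isCompact isOpen_compl_singleton]
    intro K hK hKc
    refine ((hf (lastPoint G q m '' K) (hKc.image (continuous_lastPoint m)) ?_).comp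
      (lastPoint G q m)).mono (subset_preimage_image _ _)
    rintro _ ⟨x, hx, rfl⟩
    exact lastPoint_mem_punctured (G := G) (q := q) m (hK hx)
  have hdiff : DifferentiableOn ℂ g {0}ᶜ := by
    refine hloc.differentiableOn (Eventually.of_forall fun N x hx => ?_) isOpen_compl_singleton
    have h1 := (analyticAt_normalizedChar (G := G) (q := q) (lam N)
      (lastPoint_mem_punctured (G := G) (q := q) m hx)).differentiableAt
    have h2 : DifferentiableAt ℂ (lastPoint G q m) x := by
      rw [differentiableAt_pi]
      intro j
      simp only [lastPoint]
      split_ifs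
      · exact differentiableAt_id
      · exact differentiableAt_const _
    exact (DifferentiableAt.comp x h1 h2).differentiableWithinAt
  have hpt : ∀ x : ℂ, x ≠ 0 → Tendsto (fun N => F N x) atTop (𝓝 (g x)) := fun x hx =>
    hloc.tendsto_at hx
  have hzero : ∀ t : ℝ, Real.sin (Real.log q * t) ≠ 0 →
      g (Complex.exp (Real.log q * (t * Complex.I))) = 0 := by
    intro t ht
    set x := Complex.exp (Real.log q * (t * Complex.I)) with hx
    have hx0 : x ≠ 0 := Complex.exp_ne_zero _
    have hjx : jk x = ch (Real.log q * (t * Complex.I)) := jk_exp _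
    have hne : ∀ r, jk x ≠ node G q r := fun r => by rw [hjx]; exact ch_mul_I_ne_node r ht
    have e : (Real.log q : ℂ) * (t * Complex.I) = ((Real.log q * t : ℝ) : ℂ) * Complex.I := by
      push_cast; ring
    have h1 : Tendsto (fun N => hfun G q m (rowSet (lam N)) (jk x)) atTop (𝓝 0) := by
      rw [hjx, e]
      refine tendsto_hfun_zero hs hm ?_
      rw [← e]
      exact den_mul_I_ne_zero G ht
    have h2 : Tendsto (fun N : ℕ => lag G q (Finset.range N : Finset ℕ) m (jk x)) atTop
        (𝓝 (lag G q univ m (jk x))) := by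
      refine tendsto_lag (fun r => ?_) m tendsto_const_nhds
      filter_upwards [eventually_gt_atTop r] with n hn
      simp [hn]
    have h3 := tendsto_nhds_unique (((hpt x hx0).mul h2).congr' (by
      filter_upwards [eventually_gt_atTop m] with N hN
      exact normalizedChar_lastPoint_mul hN (hlam N) hx0 fun r _ => hne r)) h1
    exact (mul_eq_zero.1 h3).resolve_right (lag_ne_zero fun r _ _ => hne r)
  set γ : ℝ → ℂ := fun t => Complex.exp (Real.log q * (t * Complex.I)) with hγ
  -- This parametrizes the point i of the circle. The curve has nonzero velocity there, so the zeros
  -- of g accumulate at i and the identity theorem applies on the connected set ℂ*.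
  set t₀ : ℝ := Real.pi / 2 / Real.log q with ht₀
  have hfreq : ∃ᶠ z in 𝓝[≠] (γ t₀), g z = 0 := by
    have hd : HasDerivAt γ (Complex.exp (Real.log q * (t₀ * Complex.I)) *
        (Real.log q * (1 * Complex.I))) t₀ :=
      ((((hasDerivAt_id t₀).ofReal_comp).mul_const Complex.I).const_mul (Real.log q : ℂ)).cexp
    have hd0 : Complex.exp (Real.log q * (t₀ * Complex.I)) *
        (Real.log q * (1 * Complex.I)) ≠ 0 := by
      refine mul_ne_zero (Complex.exp_ne_zero _) (mul_ne_zero (by exact_mod_cast hL) ?_)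
      rw [one_mul]; exact Complex.I_ne_zero
    have hsin : ∀ᶠ t in 𝓝 t₀, Real.sin (Real.log q * t) ≠ 0 := by
      refine ContinuousAt.eventually_ne (by fun_prop) ?_
      rw [ht₀, mul_div_cancel₀ _ hL, Real.sin_pi_div_two]
      exact one_ne_zero
    refine (hd.tendsto_nhdsNE hd0).frequently (Eventually.frequently ?_)
    filter_upwards [nhdsWithin_le_nhds hsin] with t ht using hzero t ht
  have hg0 := (hdiff.analyticOnNhd isOpen_compl_singleton).eqOn_zero_of_preconnected_of_frequently_eq_zero
    (isConnected_compl_singleton_of_one_lt_rank (by simp) _).isPreconnected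
    (z₀ := γ t₀) (Complex.exp_ne_zero _) hfreq
  have h1 : g (qe G q m) = 1 := by
    refine tendsto_nhds_unique (hpt _ (qe_ne_zero m)) (tendsto_const_nhds.congr' ?_)
    filter_upwards [eventually_gt_atTop m] with N hN
    exact (normalizedChar_lastPoint_node hN (hlam N)).symm
  have h2 := hg0 (qe_ne_zero (G := G) (q := q) m : (qe G q m : ℂ) ∈ ({0}ᶜ : Set ℂ))
  rw [h1] at h2
  exact one_ne_zero h2

end

/-! ### From convergence of the exponents to stabilization. -/

section

variable {N : ℕ} {lam : Fin N → ℕ}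

/-- The exponents decrease strictly, so those below the i-th are exactly the exponents of the later
rows. -/
lemma count_mem_rowSet (hlam : Antitone lam) (i : Fin N) :
    Nat.count (fun r => r ∈ rowSet lam) (rows lam i) = N - 1 - i := by
  have hanti : StrictAnti (rows lam) := fun a b hab => by
    have h1 := hlam hab.le
    have h2 : (a : ℕ) < b := hab
    have := b.isLt
    simp only [rows]; omega
  have h : (Finset.range (rows lam i)).filter (fun r => r ∈ rowSet lam) =
      (Finset.Ioi i).image (rows lam) := by
    ext r
    simp only [Finset.mem_filter, Finset.mem_range, rowSet, Finset.mem_image, Finset.mem_univ,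
      true_and, Finset.mem_Ioi]
    constructor
    · rintro ⟨h1, j, rfl⟩
      exact ⟨j, hanti.lt_iff_gt.1 h1, rfl⟩
    · rintro ⟨j, hj, rfl⟩
      exact ⟨hanti hj, j, rfl⟩
  rw [Nat.count_eq_card_filter_range, h, Finset.card_image_of_injective _ hanti.injective,
    Fin.card_Ioi]

/-- Convergence of the sets of exponents to an infinite set implies stabilization. -/
lemma exists_stabilizes {lam : (N : ℕ) → Fin N → ℕ} (hlam : ∀ N, Antitone (lam N)) {A : Set ℕ}
    (hA : A.Infinite) (hs : ∀ r, ∀ᶠ N in atTop, (r ∈ rowSet (lam N) ↔ r ∈ A)) :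
    ∃ y : ℕ → ℕ, Monotone y ∧ Stabilizes lam y := by
  classical
  have hA' : (Set.ofPred (· ∈ A)).Infinite := hA
  -- The increasing enumeration of A. Strict increase makes b i - i nondecreasing, and b i ≥ i makes
  -- the truncated subtraction faithful.
  set b : ℕ → ℕ := Nat.nth (· ∈ A) with hb
  have hbm : StrictMono b := Nat.nth_strictMono hA'
  refine ⟨fun i => b i - i, monotone_nat_of_le_succ fun i => ?_, fun i => ?_⟩
  · have h1 : b i < b (i + 1) := hbm (Nat.lt_succ_self i)
    change b i - i ≤ b (i + 1) - (i + 1)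
    omega
  rw [nhds_discrete, tendsto_pure]
  have h1 : ∀ᶠ N in atTop, ∀ r ∈ Finset.range (b i + 1), (r ∈ rowSet (lam N) ↔ r ∈ A) :=
    (Filter.eventually_all_finset _).2 fun r _ => hs r
  filter_upwards [h1, eventually_gt_atTop i] with N hN hi
  rw [dif_pos hi]
  have hmem : b i ∈ rowSet (lam N) :=
    (hN _ (Finset.mem_range.2 (Nat.lt_succ_self _))).2 (Nat.nth_mem_of_infinite hA' i)
  obtain ⟨j, -, hj⟩ := Finset.mem_image.1 hmem
  -- Exactly i exponents lie below b i, which identifies the row carrying b i as the i-th from the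
  -- bottom.
  have h2 : Nat.count (fun r => r ∈ rowSet (lam N)) (b i) = Nat.count (· ∈ A) (b i) := by
    rw [Nat.count_eq_card_filter_range, Nat.count_eq_card_filter_range]
    congr 1
    refine Finset.filter_congr fun r hr => hN r ?_
    exact Finset.mem_range.2 (by have := Finset.mem_range.1 hr; omega)
  rw [hb, Nat.count_nth_of_infinite hA', ← hb, ← hj, count_mem_rowSet (hlam N)] at h2
  have hjlt := j.isLt
  have hjeq : (⟨N - 1 - i, by omega⟩ : Fin N) = j := by
    ext; simp only; omega
  rw [hjeq, ← hj, rows]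
  omega

end

/-- The case k = 1 produces the limiting set A; if A were finite, the case k = |A| + 2, that is m =
|A| + 1, would be contradictory. -/
lemma exists_stabilizes_of_charsConvergeTo {G : ClassicalType} {q : ℝ}
    [hq : Fact (0 < q ∧ q < 1)] {lam : (N : ℕ) → Fin N → ℕ} (hlam : ∀ N, Antitone (lam N))
    (h : ∀ k : ℕ, 1 ≤ k → ∃ f : (Fin k → ℂ) → ℂ, CharsConvergeTo G q lam k f) :
    ∃ y : ℕ → ℕ, Monotone y ∧ Stabilizes lam y := by
  obtain ⟨f, hf⟩ := h 1 le_rfl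
  set A : Set ℕ := {r | ∀ᶠ N in atTop, r ∈ rowSet (lam N)} with hA
  have hs : ∀ r, ∀ᶠ N in atTop, (r ∈ rowSet (lam N) ↔ r ∈ A) := fun r => by
    by_cases hr : ∀ᶠ N in atTop, r ∈ rowSet (lam N)
    · filter_upwards [hr] with N hN using iff_of_true hN hr
    · filter_upwards [(eventually_mem_or_eventually_notMem hlam hf r).resolve_left hr] with N hN
        using iff_of_false hN hr
  by_cases hfin : A.Finite
  · obtain ⟨f', hf'⟩ := h (hfin.toFinset.card + 1 + 1) (by omega)
    exact absurd hf' (not_charsConvergeTo_of_finite hlam (by simpa using hs)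
      (Nat.lt_succ_self _))
  · exact exists_stabilizes hlam hfin hs

end QChar

end

theorem mainTheorem1 (G : ClassicalType) (q : ℝ) (hq0 : 0 < q) (hq1 : q < 1) :
    (∀ y : ℕ → ℕ, Monotone y → ∀ k : ℕ, 1 ≤ k →
      ∃ Φ : (Fin k → ℂ) → ℂ, QChar.IsPhi G q y k Φ ∧
        ∀ lam : (N : ℕ) → Fin N → ℕ, (∀ N, Antitone (lam N)) → QChar.Stabilizes lam y →
          QChar.CharsConvergeTo G q lam k Φ) ∧
    (∀ lam : (N : ℕ) → Fin N → ℕ, (∀ N, Antitone (lam N)) →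
      (∀ k : ℕ, 1 ≤ k → ∃ f : (Fin k → ℂ) → ℂ, QChar.CharsConvergeTo G q lam k f) →
      ∃ y : ℕ → ℕ, Monotone y ∧ QChar.Stabilizes lam y ∧
        ∀ k : ℕ, 1 ≤ k →
          ∃ Φ : (Fin k → ℂ) → ℂ, QChar.IsPhi G q y k Φ ∧ QChar.CharsConvergeTo G q lam k Φ) := by
  have : Fact (0 < q ∧ q < 1) := ⟨⟨hq0, hq1⟩⟩
  refine ⟨fun y hy k _ => QChar.exists_isPhi G q hy k, fun lam hlam h => ?_⟩
  obtain ⟨y, hy, hs⟩ := QChar.exists_stabilizes_of_charsConvergeTo hlam h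
  refine ⟨y, hy, hs, fun k _ => ?_⟩
  obtain ⟨Φ, h1, h2⟩ := QChar.exists_isPhi G q hy k
  exact ⟨Φ, h1, h2 lam hlam hs⟩
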